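/- Let $b>0$ and, for $k\in\mathbb R$, let $h(k)=-\frac{d^2}{dx^2}+(k-b|x|)^2$, a self-adjoint operator in $L^2(\mathbb R)$ with simple discrete spectrum $\omega_1(k)<\omega_2(k)<\cdots$. The band functions $\omega_{2j-1}$ (resp. $\omega_{2j}$), $j\ge 1$, correspond to the even (resp. odd) eigenfunctions. Let $\mathrm{Ai}$ be the Airy function, and let $z_{\mathrm{Ai},j}$ and $z_{\mathrm{Ai}',j}$ be the $j$-th real zero of $\mathrm{Ai}$ and of $\mathrm{Ai}'$, counted from the right. For $X\in\{\mathrm{Ai},\mathrm{Ai}'\}$ put $$c_{X,j}=\int_0^\infty \mathrm{Ai}(v+z_{X,j})^2\,dv,\qquad D_{X,j}=\Big(\frac{1}{c_{X,j}}\int_0^\infty v^4\,\mathrm{Ai}(v+z_{X,j})^2\,dv\Big)^{1/2},\qquad C_{X,j}(b,k)=\Big(\frac{(2b|k|)^{1/3}}{2c_{X,j}}\Big)^{1/2},$$ and define, for $k<0$, the functions $$\Psi_j^{e}(x,k)=C_{\mathrm{Ai}',j}(b,k)\,\mathrm{Ai}\big((2b|k|)^{1/3}|x|+z_{\mathrm{Ai}',j}\big),\qquad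 \Psi_j^{o}(x,k)=C_{\mathrm{Ai},j}(b,k)\,\mathrm{sign}(x)\,\mathrm{Ai}\big((2b|k|)^{1/3}|x|+z_{\mathrm{Ai},j}\big).$$ Let $j\ge1$. The zeros $z_{X,j}$ exist, $c_{X,j}$ is finite and positive, and $D_{X,j}$ is finite (by definition it does not depend on $b$ and $k$). For $(X,u)=(\mathrm{Ai}',e)$ and for $(X,u)=(\mathrm{Ai},o)$, and for every $b>0$: (1) For all $k<0$, $\Psi_j^u(\cdot,k)$ is a unit vector in the domain of $h(k)$ and $$\big\|\big(h(k)-[k^2-(2b|k|)^{2/3}z_{X,j}]\big)\Psi_j^{u}(\cdot,k)\big\|\le \frac{b^{4/3}}{(2|k|)^{2/3}}\,D_{X,j}.$$ (2) For all sufficiently negative $k$ (depending on $b$ and $j$), the eigenvalues $\omega_{2j-1}(k)$ and $\omega_{2j}(k)$ exist and $$\big|\omega_{2j-1}(k)-[k^2-(2b|k|)^{2/3}z_{\mathrm{Ai}',j}]\big|\le \frac{b^{4/3}}{(2|k|)^{2/3}}D_{\mathrm{Ai}',j},\qquad \big|\omega_{2j}(k)-[k^2-(2b|k|)^{2/3}z_{\mathrm{Ai},j}]\big|\le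 \frac{b^{4/3}}{(2|k|)^{2/3}}D_{\mathrm{Ai},j}.$$ -/

import Mathlib

open MeasureTheory Filter
open scoped ENNReal

noncomputable section

/-- The Hilbert space `L²(ℝ; ℂ)` for Lebesgue measure. -/
abbrev L2R : Type := Lp ℂ 2 (volume : Measure ℝ)

/-- The effective potential `(k - b|x|)²`. -/
def effPotential (b k x : ℝ) : ℝ := (k - b * |x|) ^ 2

/-- `ψ' - ψ'(0)` is the primitive of `V ψ - f`; together with `ψ' = dψ/dx` everywhere this says that
`ψ` is `C¹`, `ψ'` is locally absolutely continuous and `-ψ'' + V ψ = f` almost everywhere. -/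
def SolvesFiberEq (b k : ℝ) (ψ ψ' : ℝ → ℂ) (f : ℝ → ℂ) : Prop :=
  (∀ x, HasDerivAt ψ (ψ' x) x) ∧
    ∀ x, ψ' x = ψ' 0 + ∫ t in (0 : ℝ)..x, ((effPotential b k t : ℂ) * ψ t - f t)

theorem intervalIntegrable_coe_L2R (f : L2R) (x y : ℝ) :
    IntervalIntegrable (fun t => f t) volume x y :=
  intervalIntegrable_iff.mpr <|
    (LocallyIntegrable.integrableOn_isCompact ((Lp.memLp f).locallyIntegrable (by norm_num))
      isCompact_uIcc).mono_set Set.uIoc_subset_uIcc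

theorem SolvesFiberEq.intervalIntegrable_aux {b k : ℝ} {ψ ψ' : ℝ → ℂ}
    (h : ∀ x, HasDerivAt ψ (ψ' x) x) (f : L2R) (x y : ℝ) :
    IntervalIntegrable (fun t => (effPotential b k t : ℂ) * ψ t - f t) volume x y := by
  have hc : Continuous ψ := continuous_iff_continuousAt.2 fun x => (h x).continuousAt
  have hV : Continuous (fun t => (effPotential b k t : ℂ)) := by
    unfold effPotential; fun_prop
  exact ((hV.mul hc).intervalIntegrable x y).sub (intervalIntegrable_coe_L2R f x y)

/-- The graph of `h(k) = -d²/dx² + (k - b|x|)²` on its maximal domain in `L²(ℝ)`: the pairs `(u, f)`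
in `L² × L²` such that `u` is `C¹` with locally absolutely continuous derivative and
`-u'' + (k - b|x|)² u = f`. -/
def fiberGraph (b k : ℝ) : Submodule ℂ (L2R × L2R) where
  carrier := {p | ∃ ψ ψ' : ℝ → ℂ, p.1 =ᵐ[volume] ψ ∧ SolvesFiberEq b k ψ ψ' p.2}
  zero_mem' := by
    refine ⟨0, 0, Lp.coeFn_zero _ _ _, fun x => hasDerivAt_const x 0, fun x => ?_⟩
    have h0 : ∀ᵐ t ∂(volume : Measure ℝ), (0 : L2R) t = 0 := Lp.coeFn_zero _ _ _
    rw [intervalIntegral.integral_zero_ae]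
    · simp
    · filter_upwards [h0] with t ht _
      simp only [Prod.snd_zero, Pi.zero_apply, mul_zero, zero_sub, neg_eq_zero]
      exact ht
  add_mem' := by
    rintro p q ⟨ψ, ψ', hp, hd, hi⟩ ⟨χ, χ', hq, hd', hi'⟩
    refine ⟨fun x => ψ x + χ x, fun x => ψ' x + χ' x, ?_, fun x => (hd x).add (hd' x), fun x => ?_⟩
    · filter_upwards [Lp.coeFn_add p.1 q.1, hp, hq] with x h1 h2 h3
      simp only [Prod.fst_add, h1, Pi.add_apply, h2, h3]
    · have hsum : ∫ t in (0 : ℝ)..x, ((effPotential b k t : ℂ) * (ψ t + χ t) - (p + q).2 t)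
          = ∫ t in (0 : ℝ)..x, (((effPotential b k t : ℂ) * ψ t - p.2 t)
            + ((effPotential b k t : ℂ) * χ t - q.2 t)) := by
        refine intervalIntegral.integral_congr_ae ?_
        filter_upwards [Lp.coeFn_add p.2 q.2] with t ht _
        simp only [Prod.snd_add, ht, Pi.add_apply]
        ring
      simp only [hsum]
      rw [intervalIntegral.integral_add (SolvesFiberEq.intervalIntegrable_aux hd p.2 0 x)
        (SolvesFiberEq.intervalIntegrable_aux hd' q.2 0 x), hi x, hi' x]
      ring
  smul_mem' := by
    rintro c p ⟨ψ, ψ', hp, hd, hi⟩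
    refine ⟨fun x => c * ψ x, fun x => c * ψ' x, ?_, fun x => (hd x).const_mul c, fun x => ?_⟩
    · filter_upwards [Lp.coeFn_smul c p.1, hp] with x h1 h2
      simp only [Prod.smul_fst, h1, Pi.smul_apply, h2, smul_eq_mul]
    · have hsum : ∫ t in (0 : ℝ)..x, ((effPotential b k t : ℂ) * (c * ψ t) - (c • p).2 t)
          = ∫ t in (0 : ℝ)..x, c * ((effPotential b k t : ℂ) * ψ t - p.2 t) := by
        refine intervalIntegral.integral_congr_ae ?_
        filter_upwards [Lp.coeFn_smul c p.2] with t ht _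
        simp only [Prod.smul_snd, ht, Pi.smul_apply, smul_eq_mul]
        ring
      simp only [hsum]
      rw [intervalIntegral.integral_const_mul, hi x]
      ring

/-- `fiberGraph b k` is single-valued, hence the graph of an operator. -/
theorem fiberGraph_single_valued (b k : ℝ) :
    ∀ p : L2R × L2R, p ∈ fiberGraph b k → p.1 = 0 → p.2 = 0 := by
  rintro ⟨u, f⟩ ⟨ψ, ψ', hu, hd, hi⟩ h0
  obtain rfl : u = 0 := h0
  have hc : Continuous ψ := continuous_iff_continuousAt.2 fun x => (hd x).continuousAt
  have hψ : ψ = 0 := by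
    refine (Continuous.ae_eq_iff_eq volume hc continuous_zero).1 ?_
    exact hu.symm.trans (Lp.coeFn_zero _ _ _)
  subst hψ
  have hψ' : ∀ x, ψ' x = 0 := fun x => (hd x).unique (hasDerivAt_const x 0)
  have hint : ∀ x, ∫ t in (0 : ℝ)..x, f t = 0 := by
    intro x
    have := hi x
    simpa [hψ', intervalIntegral.integral_neg] using this
  refine (Lp.eq_zero_iff_ae_eq_zero).2 ?_
  have hloc : LocallyIntegrable (fun t => f t) volume :=
    (Lp.memLp f).locallyIntegrable (by norm_num)
  filter_upwards [LocallyIntegrable.ae_hasDerivAt_integral hloc] with x hx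
  have h1 := hx 0
  simp only [hint] at h1
  exact h1.unique (hasDerivAt_const x 0)

/-- The fiber operator `h(k) = p_x² + (k - b|x|)²`, `p_x = -i d/dx`, as an unbounded operator in
`L²(ℝ)` on its maximal domain. -/
def fiberOp (b k : ℝ) : L2R →ₗ.[ℂ] L2R := (fiberGraph b k).toLinearPMap

/-- The eigenvalues of `h(k)`. -/
def fiberEigenvalues (b k : ℝ) : Set ℝ :=
  {E | ∃ u : (fiberOp b k).domain, (u : L2R) ≠ 0 ∧ fiberOp b k u = (E : ℂ) • (u : L2R)}

/-- The band function `ω_n(k)`, `n ≥ 1`: the `n`-th eigenvalue of `h(k)` in increasing order, i.e. the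
least `E` such that at least `n` eigenvalues lie in `(-∞, E]`. -/
def bandFunction (b : ℝ) (n : ℕ) (k : ℝ) : ℝ :=
  sInf {E : ℝ | (n : ℕ∞) ≤ (fiberEigenvalues b k ∩ Set.Iic E).encard}

/-- The Airy function `Ai` on the real line, by the absolutely convergent contour integral
`Ai(x) = (1/2π) ∫ exp(i(ζ³/3 + xζ)) dζ` along the line `ζ = t + i`, `t ∈ ℝ` (the integral is real). -/
def airyAi (x : ℝ) : ℝ :=
  ((2 * Real.pi : ℂ)⁻¹ *
    ∫ t : ℝ, Complex.exp (Complex.I * (((t : ℂ) + Complex.I) ^ 3 / 3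
      + (x : ℂ) * ((t : ℂ) + Complex.I)))).re

/-- The `j`-th real zero of `f`, `j ≥ 1`, counted from the right: the largest `z` such that `f` has
at least `j` zeros in `[z, ∞)`. -/
def nthZero (f : ℝ → ℝ) (j : ℕ) : ℝ :=
  sSup {z : ℝ | (j : ℕ∞) ≤ ({x | f x = 0} ∩ Set.Ici z).encard}

/-- `z_{Ai,j}`. -/
def zAi (j : ℕ) : ℝ := nthZero airyAi j

/-- `z_{Ai',j}`. -/
def zAi' (j : ℕ) : ℝ := nthZero (deriv airyAi) j

/-- `∫₀^∞ Ai(v + z)² dv`; this is `c_{X,j}` for `z = z_{X,j}`. -/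
def airyC (z : ℝ) : ℝ := ∫ v in Set.Ioi (0 : ℝ), airyAi (v + z) ^ 2

/-- `(∫₀^∞ v⁴ Ai(v + z)² dv / ∫₀^∞ Ai(v + z)² dv)^{1/2}`; this is `D_{X,j}` for `z = z_{X,j}`. -/
def airyD (z : ℝ) : ℝ :=
  Real.sqrt ((∫ v in Set.Ioi (0 : ℝ), v ^ 4 * airyAi (v + z) ^ 2) / airyC z)

/-- The normalization constant `((2b|k|)^{1/3} / (2c))^{1/2}`, `c = ∫₀^∞ Ai(v + z)² dv`. -/
def airyNorm (b k z : ℝ) : ℝ :=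
  Real.sqrt ((2 * b * |k|) ^ (1 / 3 : ℝ) / (2 * airyC z))

/-- The even scaled Airy quasimode `C_{Ai',j} Ai((2b|k|)^{1/3} |x| + z_{Ai',j})`. -/
def airyEven (b k : ℝ) (j : ℕ) (x : ℝ) : ℂ :=
  ((airyNorm b k (zAi' j) * airyAi ((2 * b * |k|) ^ (1 / 3 : ℝ) * |x| + zAi' j) : ℝ) : ℂ)

/-- The odd scaled Airy quasimode `C_{Ai,j} sign(x) Ai((2b|k|)^{1/3} |x| + z_{Ai,j})`. -/
def airyOdd (b k : ℝ) (j : ℕ) (x : ℝ) : ℂ :=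
  ((airyNorm b k (zAi j) * Real.sign x *
    airyAi ((2 * b * |k|) ^ (1 / 3 : ℝ) * |x| + zAi j) : ℝ) : ℂ)

/-- The approximate energy `k² - (2b|k|)^{2/3} z`. -/
def airyEnergy (b k z : ℝ) : ℝ := k ^ 2 - (2 * b * |k|) ^ (2 / 3 : ℝ) * z

/-- `D b^{4/3} / (2|k|)^{2/3}` with `D = airyD z`. -/
def airyBound (b k z : ℝ) : ℝ := b ^ (4 / 3 : ℝ) / (2 * |k|) ^ (2 / 3 : ℝ) * airyD z

/-- `z` is the `j`-th zero of `f` from the right: `f z = 0` and `f` has exactly `j` zeros in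
`[z, ∞)`. -/
def IsNthZero (f : ℝ → ℝ) (j : ℕ) (z : ℝ) : Prop :=
  f z = 0 ∧ ({x | f x = 0} ∩ Set.Ici z).encard = j

/-- `E` is the `n`-th eigenvalue of `h(k)`: an eigenvalue such that exactly `n` eigenvalues lie in
`(-∞, E]`. -/
def IsNthEigenvalue (b k : ℝ) (n : ℕ) (E : ℝ) : Prop :=
  E ∈ fiberEigenvalues b k ∧ (fiberEigenvalues b k ∩ Set.Iic E).encard = n

/-- `Ψ` is (a representative of) a unit vector `u` in the domain of `h(k)` and
`‖(h(k) - E) u‖ ≤ δ`. -/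
def IsQuasimode (b k E δ : ℝ) (Ψ : ℝ → ℂ) : Prop :=
  ∃ u : (fiberOp b k).domain, (u : L2R) =ᵐ[volume] Ψ ∧ ‖(u : L2R)‖ = 1 ∧
    ‖fiberOp b k u - (E : ℂ) • (u : L2R)‖ ≤ δ

end

/-! For k < 0 the potential is k² + 2b|k||x| + b²x². With α = (2b|k|)^{1/3}, v = αx and e = b²/α⁴
this gives h(k) = k² + α²(-d²/dv² + |v| + e v²), and e → 0⁺ as k → -∞. At e = 0 the decaying
solutions are Ai(|v| - l), even when Ai'(-l) = 0, and odd with a factor sign(v) when Ai(-l) = 0.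
Inserted in h(k), they leave exactly the residual b²x²Ψ, whose norm is (b²/α²) D; this is the
quasimode estimate.

The band estimate is proved separately, by shooting rather than through the spectral theorem. A
solution with even or odd initial data is an eigenfunction iff u u' ≤ 0 in the forbidden region
(`OscEigen`); otherwise u and u' eventually share a sign (`OscGrows`), which is an open condition on
(l, e). Four facts control the eigenvalues near an unperturbed l₀ for small e:

Existence (`exists_oscEigen_near`): the sign of growth flips across l₀ at e = 0, and connectedness
of an interval of energies forces an eigenvalue in between.

Size (`eventually_abs_sub_le`): Wronskian integration gives (l - l₀)∫u u₀ = e∫v² u u₀. The quotient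
of the integrals tends to the mean of v², which is strictly below D, the root of the mean of v⁴, by
Cauchy–Schwarz. Strictness is what yields the constant D itself once e is small.

Uniqueness (`exists_radius_oscEigen`): two eigenfunctions at the same e and distinct energies are
orthogonal, while near (l₀, 0) their overlap is close to ∫u₀² > 0.

Absence (`eventually_not_oscEigen`): no eigenvalue appears near an l₀ that is not one.

Compactness of an energy interval turns these into a count (`eventually_oscSpec_count`): the
eigenvalues up to the one near l₀ are as many as the zeros of Ai Ai' in [-l₀, ∞). Zeros of Ai' and
Ai alternate, starting from the right with one of Ai' (`airy_zeros_spec`), so the indices are 2j - 1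
and 2j. -/

noncomputable section

/-! ### Linear differential equations with a parameter. -/

/-- The Picard iterates of the linear equation `X' = A(p, t) X`, `X(p, 0) = x₀`. -/
def picardTerm {P E : Type*} [NormedAddCommGroup E] [NormedSpace ℝ E]
    (A : P × ℝ → E →L[ℝ] E) (x₀ : E) : ℕ → P × ℝ → E
  | 0 => fun _ => x₀
  | n + 1 => fun q => ∫ s in (0 : ℝ)..q.2, A (q.1, s) (picardTerm A x₀ n (q.1, s))

section Picard

variable {P E : Type*} [TopologicalSpace P]
  [NormedAddCommGroup E] [NormedSpace ℝ E] {A : P × ℝ → E →L[ℝ] E}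

theorem continuous_picardTerm (hA : Continuous A) (x₀ : E) (n : ℕ) :
    Continuous (picardTerm A x₀ n) := by
  induction n with
  | zero => exact continuous_const
  | succ n ih =>
    have h : Continuous (Function.uncurry fun (q : P × ℝ) (s : ℝ) =>
        A (q.1, s) (picardTerm A x₀ n (q.1, s))) := by
      have h1 : Continuous fun z : (P × ℝ) × ℝ => (z.1.1, z.2) := by fun_prop
      exact (hA.comp h1).clm_apply (ih.comp h1)
    exact intervalIntegral.continuous_parametric_intervalIntegral_of_continuous h continuous_snd

theorem hasDerivAt_picardTerm_succ [CompleteSpace E] (hA : Continuous A) (x₀ : E) (n : ℕ) (p : P)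
    (t : ℝ) :
    HasDerivAt (fun t => picardTerm A x₀ (n + 1) (p, t)) (A (p, t) (picardTerm A x₀ n (p, t))) t := by
  have h : Continuous fun s : ℝ => A (p, s) (picardTerm A x₀ n (p, s)) := by
    have h1 : Continuous fun s : ℝ => (p, s) := by fun_prop
    exact (hA.comp h1).clm_apply ((continuous_picardTerm hA x₀ n).comp h1)
  exact intervalIntegral.integral_hasDerivAt_right (h.intervalIntegrable _ _)
    (h.stronglyMeasurableAtFilter _ _) h.continuousAt

theorem norm_picardTerm_le (hA : Continuous A) (x₀ : E) {K : Set P} {R M : ℝ}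
    (hM : ∀ p ∈ K, ∀ s, |s| ≤ R → ‖A (p, s)‖ ≤ M) (n : ℕ) {p : P} (hp : p ∈ K) {t : ℝ}
    (ht : |t| ≤ R) :
    ‖picardTerm A x₀ n (p, t)‖ ≤ ‖x₀‖ * (M * |t|) ^ n / n.factorial := by
  have hM0 : 0 ≤ M := (norm_nonneg _).trans (hM p hp t ht)
  induction n generalizing t with
  | zero => simp [picardTerm]
  | succ n ih =>
    have hstep : ‖picardTerm A x₀ (n + 1) (p, t)‖ ≤
        ∫ s in Set.uIoc 0 t, (M * (‖x₀‖ * M ^ n / n.factorial)) * |s - 0| ^ n := by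
      refine (intervalIntegral.norm_integral_le_integral_norm_uIoc).trans ?_
      refine setIntegral_mono_on ?_ ?_ measurableSet_uIoc ?_
      · have h1 : Continuous fun s : ℝ => (p, s) := by fun_prop
        have h : Continuous fun s : ℝ => A (p, s) (picardTerm A x₀ n (p, s)) :=
          (hA.comp h1).clm_apply ((continuous_picardTerm hA x₀ n).comp h1)
        exact intervalIntegrable_iff.1 (h.norm.intervalIntegrable 0 t)
      · have h : Continuous fun s : ℝ => (M * (‖x₀‖ * M ^ n / n.factorial)) * |s - 0| ^ n := by
          fun_prop
        exact intervalIntegrable_iff.1 (h.intervalIntegrable 0 t)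
      · intro s hs
        have hst : |s| ≤ |t| := by
          rcases Set.mem_uIoc.1 hs with h | h
          · rw [abs_of_pos h.1]; exact h.2.trans (le_abs_self t)
          · rw [abs_of_nonpos h.2, abs_of_neg (h.1.trans_le h.2)]; linarith [h.1]
        have hsR := hst.trans ht
        calc ‖A (p, s) (picardTerm A x₀ n (p, s))‖
            ≤ ‖A (p, s)‖ * ‖picardTerm A x₀ n (p, s)‖ := (A (p, s)).le_opNorm _
          _ ≤ M * (‖x₀‖ * (M * |s|) ^ n / n.factorial) :=
              mul_le_mul (hM p hp s hsR) (ih hsR) (norm_nonneg _) hM0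
          _ = _ := by rw [sub_zero]; ring
    refine hstep.trans (le_of_eq ?_)
    rw [integral_const_mul, integral_pow_abs_sub_uIoc, sub_zero, Nat.factorial_succ]
    push_cast
    field_simp
    ring

/-- On a compact neighbourhood of the parameter the coefficient is bounded by one M, so one
exponential series dominates all iterates. This local uniformity gives both joint continuity of the
sum and termwise differentiation. -/
theorem exists_bound_picardTerm [LocallyCompactSpace P] (hA : Continuous A) (x₀ : E) (p : P)
    (R : ℝ) :
    ∃ U ∈ nhds p, ∃ M : ℝ, (∀ q ∈ U, ∀ s, |s| ≤ R → ‖A (q, s)‖ ≤ M) ∧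
      ∃ c : ℕ → ℝ, Summable c ∧
        ∀ n, ∀ q ∈ U, ∀ t, |t| ≤ R → ‖picardTerm A x₀ n (q, t)‖ ≤ c n := by
  obtain ⟨U, hUc, hU⟩ := exists_compact_mem_nhds p
  obtain ⟨M, hM⟩ := (hUc.prod (isCompact_Icc (a := -R) (b := R))).exists_bound_of_continuousOn
    hA.continuousOn
  have hM' : ∀ q ∈ U, ∀ s, |s| ≤ R → ‖A (q, s)‖ ≤ M := fun q hq s hs =>
    hM (q, s) ⟨hq, abs_le.1 hs⟩
  refine ⟨U, hU, M, hM', fun n => ‖x₀‖ * ((M * R) ^ n / n.factorial),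
    (Real.summable_pow_div_factorial _).mul_left _, fun n q hq t ht => ?_⟩
  have hM0 : 0 ≤ M := (norm_nonneg _).trans (hM' q hq t ht)
  refine (norm_picardTerm_le hA x₀ hM' n hq ht).trans ?_
  rw [mul_div_assoc]
  exact mul_le_mul_of_nonneg_left (div_le_div_of_nonneg_right (pow_le_pow_left₀
    (mul_nonneg hM0 (abs_nonneg t)) (mul_le_mul_of_nonneg_left ht hM0) n)
    (Nat.cast_nonneg _)) (norm_nonneg _)

/-- A linear equation `X' = A(p, t) X` whose coefficient is jointly continuous in time and
parameter has a global solution that is jointly continuous in time and parameter. -/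
theorem exists_linear_ode_solution [LocallyCompactSpace P] [CompleteSpace E] (hA : Continuous A)
    (x₀ : E) :
    ∃ X : P × ℝ → E, Continuous X ∧ (∀ p, X (p, 0) = x₀) ∧
      ∀ p t, HasDerivAt (fun t => X (p, t)) (A (p, t) (X (p, t))) t := by
  have hsum : ∀ p t, Summable fun n => picardTerm A x₀ n (p, t) := fun p t => by
    obtain ⟨U, hU, M, -, c, hc, hb⟩ := exists_bound_picardTerm hA x₀ p |t|
    exact Summable.of_norm_bounded hc fun n => hb n p (mem_of_mem_nhds hU) t le_rfl
  refine ⟨fun q => ∑' n, picardTerm A x₀ n q, ?_, fun p => ?_, fun p t => ?_⟩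
  · refine continuous_iff_continuousAt.2 fun ⟨p, t⟩ => ?_
    obtain ⟨U, hU, M, -, c, hc, hb⟩ := exists_bound_picardTerm hA x₀ p (|t| + 1)
    have hW : U ×ˢ Set.Icc (-(|t| + 1)) (|t| + 1) ∈ nhds (p, t) :=
      prod_mem_nhds hU (Icc_mem_nhds (by linarith [neg_abs_le t]) (by linarith [le_abs_self t]))
    exact (continuousOn_tsum (fun n => (continuous_picardTerm hA x₀ n).continuousOn) hc
      (fun n q hq => hb n q.1 hq.1 q.2 (abs_le.2 hq.2))).continuousAt hW
  · simp only
    rw [tsum_eq_single 0]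
    · rfl
    · intro n hn
      obtain ⟨m, rfl⟩ := Nat.exists_eq_succ_of_ne_zero hn
      simp [picardTerm]
  · obtain ⟨U, hU, M, hM, c, hc, hb⟩ := exists_bound_picardTerm hA x₀ p (|t| + 1)
    have hpU := mem_of_mem_nhds hU
    have hM0 : 0 ≤ M := (norm_nonneg _).trans (hM p hpU t (by linarith))
    have hsplit : (fun t => ∑' n, picardTerm A x₀ n (p, t)) =
        fun t => x₀ + ∑' n, picardTerm A x₀ (n + 1) (p, t) := by
      funext t
      rw [(hsum p t).tsum_eq_zero_add]
      rfl
    have hval : A (p, t) (∑' n, picardTerm A x₀ n (p, t)) =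
        ∑' n, A (p, t) (picardTerm A x₀ n (p, t)) := (A (p, t)).map_tsum (hsum p t)
    change HasDerivAt (fun t => ∑' n, picardTerm A x₀ n (p, t)) _ t
    rw [hsplit, hval]
    refine HasDerivAt.const_add x₀ ?_
    have hin : ∀ y ∈ Set.Ioo (-(|t| + 1)) (|t| + 1), |y| ≤ |t| + 1 := fun y hy =>
      abs_le.2 ⟨hy.1.le, hy.2.le⟩
    have ht : t ∈ Set.Ioo (-(|t| + 1)) (|t| + 1) :=
      ⟨by linarith [neg_abs_le t], by linarith [le_abs_self t]⟩
    exact hasDerivAt_tsum_of_isPreconnected (hc.mul_left M) isOpen_Ioo isPreconnected_Ioo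
      (fun n y _ => hasDerivAt_picardTerm_succ hA x₀ n p y)
      (fun n y hy => ((A (p, y)).le_opNorm _).trans (mul_le_mul (hM p hpU y (hin y hy))
        (hb n p hpU y (hin y hy)) (norm_nonneg _) hM0)) ht
      ((summable_nat_add_iff 1).2 (hsum p t)) ht

end Picard

/-! ### Second-order equations on the half line: uniqueness, decay, Wronskians. -/

/-- `u` solves `u'' = Q u` on `[0, ∞)` and `w = u'`. -/
structure SolvesOn (Q u w : ℝ → ℝ) : Prop where
  fst : ∀ v, 0 ≤ v → HasDerivAt u (w v) v
  snd : ∀ v, 0 ≤ v → HasDerivAt w (Q v * u v) v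

/-- Grönwall's inequality for the pair (f, f'), with constant max(1, sup |Q|). The values lie in a
general normed space so that real solutions and complex eigenfunctions are both covered. -/
theorem eq_zero_of_second_order {F : Type*} [NormedAddCommGroup F] [NormedSpace ℝ F] {Q : ℝ → ℝ}
    {f f' : ℝ → F} (hQ : Continuous Q) (hf : ∀ v, 0 ≤ v → HasDerivAt f (f' v) v)
    (hf' : ∀ v, 0 ≤ v → HasDerivAt f' (Q v • f v) v) (h0 : f 0 = 0) (h0' : f' 0 = 0) {v : ℝ}
    (hv : 0 ≤ v) : f v = 0 := by
  obtain ⟨M, hM⟩ := (isCompact_Icc (a := (0 : ℝ)) (b := v)).exists_bound_of_continuousOn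
    hQ.continuousOn
  have hd : ∀ x, 0 ≤ x → HasDerivAt (fun x => (f x, f' x)) (f' x, Q x • f x) x := fun x hx =>
    (hf x hx).prodMk (hf' x hx)
  have := eq_zero_of_abs_deriv_le_mul_abs_self_of_eq_zero_right (K := max 1 M)
    (f := fun x => (f x, f' x)) (f' := fun x => (f' x, Q x • f x)) (a := 0) (b := v)
    (fun x hx => (hd x hx.1).continuousAt.continuousWithinAt)
    (fun x hx => (hd x hx.1).hasDerivWithinAt) (by simp [h0, h0'])
    (fun x hx => by
      have hMx := hM x ⟨hx.1, hx.2.le⟩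
      simp only [Prod.norm_def]
      refine max_le ?_ ?_
      · calc ‖f' x‖ ≤ 1 * max ‖f x‖ ‖f' x‖ := by rw [one_mul]; exact le_max_right _ _
          _ ≤ _ := mul_le_mul_of_nonneg_right (le_max_left _ _) (by positivity)
      · rw [norm_smul]
        exact mul_le_mul (hMx.trans (le_max_right _ _)) (le_max_left _ _) (norm_nonneg _)
          (by positivity)) v ⟨hv, le_rfl⟩
  exact congrArg Prod.fst this

namespace SolvesOn

variable {Q u w Q₁ u₁ w₁ Q₂ u₂ w₂ : ℝ → ℝ}

theorem const_mul (h : SolvesOn Q u w) (c : ℝ) :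
    SolvesOn Q (fun v => c * u v) fun v => c * w v :=
  ⟨fun v hv => (h.fst v hv).const_mul c, fun v hv => by
    refine HasDerivAt.congr_deriv ((h.snd v hv).const_mul c) ?_; ring⟩

theorem eq_of_initial (hQ : Continuous Q) (h₁ : SolvesOn Q u₁ w₁) (h₂ : SolvesOn Q u₂ w₂)
    (h0 : u₁ 0 = u₂ 0) (h0' : w₁ 0 = w₂ 0) {v : ℝ} (hv : 0 ≤ v) : u₁ v = u₂ v := by
  refine sub_eq_zero.1 (eq_zero_of_second_order (f := fun v => u₁ v - u₂ v)
    (f' := fun v => w₁ v - w₂ v) hQ (fun x hx => (h₁.fst x hx).sub (h₂.fst x hx))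
    (fun x hx => ?_) (by simp [h0]) (by simp [h0']) hv)
  refine HasDerivAt.congr_deriv ((h₁.snd x hx).sub (h₂.snd x hx)) ?_
  simp only [smul_eq_mul]; ring

theorem continuousOn (h : SolvesOn Q u w) : ContinuousOn u (Set.Ici 0) := fun v hv =>
  (h.fst v hv).continuousAt.continuousWithinAt

theorem hasDerivAt_mul (h : SolvesOn Q u w) {v : ℝ} (hv : 0 ≤ v) :
    HasDerivAt (fun v => u v * w v) (w v ^ 2 + Q v * u v ^ 2) v := by
  refine HasDerivAt.congr_deriv ((h.fst v hv).mul (h.snd v hv)) ?_; ring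

/-- The derivative of u u' is u'² + Q u². Where Q ≥ 0, u u' can therefore never return below zero
once positive; this is the dichotomy between decay and growth. -/
theorem monotoneOn_mul (h : SolvesOn Q u w) {v₀ : ℝ} (hv₀ : 0 ≤ v₀) (hQ : ∀ v, v₀ ≤ v → 0 ≤ Q v) :
    MonotoneOn (fun v => u v * w v) (Set.Ici v₀) := by
  refine monotoneOn_of_hasDerivWithinAt_nonneg (convex_Ici v₀)
    (f' := fun v => w v ^ 2 + Q v * u v ^ 2)
    (fun v hv => (h.hasDerivAt_mul (hv₀.trans hv)).continuousAt.continuousWithinAt)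
    (fun v hv => ?_) (fun v hv => ?_)
  · rw [interior_Ici] at hv
    exact (h.hasDerivAt_mul (hv₀.trans hv.le)).hasDerivWithinAt
  · rw [interior_Ici] at hv
    have := hQ v hv.le
    positivity

/-- Put y = u². Then y' ≤ 0 and y'' ≥ 2y, so e^{-v}(y + y') is nondecreasing. If y + y' were
positive somewhere it would grow exponentially, although y + y' ≤ y stays bounded. Hence y' ≤ -y,
and e^v y is nonincreasing. -/
theorem sq_le_exp (h : SolvesOn Q u w) {v₀ : ℝ} (hv₀ : 0 ≤ v₀) (hQ : ∀ v, v₀ ≤ v → 1 ≤ Q v)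
    (hd : ∀ v, v₀ ≤ v → u v * w v ≤ 0) {v : ℝ} (hv : v₀ ≤ v) :
    u v ^ 2 ≤ u v₀ ^ 2 * Real.exp (-(v - v₀)) := by
  have hsq : ∀ v, v₀ ≤ v → HasDerivAt (fun v => u v ^ 2) (2 * (u v * w v)) v := fun v hv => by
    refine HasDerivAt.congr_deriv ((h.fst v (hv₀.trans hv)).pow 2) ?_; push_cast; ring
  have hanti : AntitoneOn (fun v => u v ^ 2) (Set.Ici v₀) := by
    refine antitoneOn_of_hasDerivWithinAt_nonpos (convex_Ici v₀) (f' := fun v => 2 * (u v * w v))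
      (fun v hv => (hsq v hv).continuousAt.continuousWithinAt)
      (fun v hv => ?_) (fun v hv => ?_)
    · rw [interior_Ici] at hv; exact (hsq v hv.le).hasDerivWithinAt
    · rw [interior_Ici] at hv; linarith [hd v hv.le]
  have hmono : MonotoneOn (fun v => Real.exp (-v) * (u v ^ 2 + 2 * (u v * w v))) (Set.Ici v₀) := by
    have hder : ∀ v, v₀ ≤ v → HasDerivAt (fun v => Real.exp (-v) * (u v ^ 2 + 2 * (u v * w v)))
        (Real.exp (-v) * (2 * w v ^ 2 + (2 * Q v - 1) * u v ^ 2)) v := fun v hv => by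
      refine HasDerivAt.congr_deriv (((hasDerivAt_neg v).exp).mul
        ((hsq v hv).add ((h.hasDerivAt_mul (hv₀.trans hv)).const_mul 2))) ?_
      ring
    refine monotoneOn_of_hasDerivWithinAt_nonneg (convex_Ici v₀)
      (f' := fun v => Real.exp (-v) * (2 * w v ^ 2 + (2 * Q v - 1) * u v ^ 2))
      (fun v hv => (hder v hv).continuousAt.continuousWithinAt)
      (fun v hv => ?_) (fun v hv => ?_)
    · rw [interior_Ici] at hv; exact (hder v hv.le).hasDerivWithinAt
    · rw [interior_Ici] at hv
      have : 0 ≤ 2 * Q v - 1 := by linarith [hQ v hv.le]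
      positivity
  have hneg : ∀ v, v₀ ≤ v → u v ^ 2 + 2 * (u v * w v) ≤ 0 := by
    intro v₁ hv₁
    by_contra! hpos
    set δ := u v₁ ^ 2 + 2 * (u v₁ * w v₁) with hδ
    have hlim : Tendsto (fun v => Real.exp (v - v₁) * δ) atTop atTop :=
      (Real.tendsto_exp_atTop.comp (tendsto_atTop_add_const_right _ (-v₁) tendsto_id)).atTop_mul_const
        hpos
    obtain ⟨v, hv, hvv⟩ := ((hlim.eventually_gt_atTop (u v₁ ^ 2)).and
      (eventually_ge_atTop v₁)).exists
    have h1 := hmono hv₁ (hv₁.trans hvv : v₀ ≤ v) hvv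
    have h2 := hanti hv₁ (hv₁.trans hvv : v₀ ≤ v) hvv
    have h3 := hd v (hv₁.trans hvv)
    simp only [← hδ] at h1 h2
    have h4 : Real.exp (v - v₁) * δ ≤ u v ^ 2 + 2 * (u v * w v) := by
      have := mul_le_mul_of_nonneg_left h1 (Real.exp_pos v).le
      rw [← mul_assoc, ← mul_assoc, ← Real.exp_add, ← Real.exp_add] at this
      simpa [sub_eq_add_neg] using this
    linarith
  have hanti' : AntitoneOn (fun v => Real.exp v * u v ^ 2) (Set.Ici v₀) := by
    have hder : ∀ v, v₀ ≤ v → HasDerivAt (fun v => Real.exp v * u v ^ 2)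
        (Real.exp v * (u v ^ 2 + 2 * (u v * w v))) v := fun v hv => by
      refine HasDerivAt.congr_deriv ((Real.hasDerivAt_exp v).mul (hsq v hv)) ?_
      ring
    refine antitoneOn_of_hasDerivWithinAt_nonpos (convex_Ici v₀)
      (f' := fun v => Real.exp v * (u v ^ 2 + 2 * (u v * w v)))
      (fun v hv => (hder v hv).continuousAt.continuousWithinAt)
      (fun v hv => ?_) (fun v hv => ?_)
    · rw [interior_Ici] at hv; exact (hder v hv.le).hasDerivWithinAt
    · rw [interior_Ici] at hv
      exact mul_nonpos_of_nonneg_of_nonpos (Real.exp_pos v).le (hneg v hv.le)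
  have h1 := mul_le_mul_of_nonneg_left (hanti' (le_refl v₀ : v₀ ≤ v₀) hv hv) (Real.exp_pos (-v)).le
  simp only [← mul_assoc, ← Real.exp_add] at h1
  rw [neg_add_cancel, Real.exp_zero, one_mul] at h1
  rw [show -(v - v₀) = -v + v₀ by ring, mul_comm]
  exact h1

theorem abs_le_exp (h : SolvesOn Q u w) {v₀ B : ℝ} (hv₀ : 0 ≤ v₀) (hQ : ∀ v, v₀ ≤ v → 1 ≤ Q v)
    (hd : ∀ v, v₀ ≤ v → u v * w v ≤ 0) (hB : ∀ v ∈ Set.Icc 0 v₀, |u v| ≤ B) {v : ℝ} (hv : 0 ≤ v) :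
    |u v| ≤ B * Real.exp (v₀ / 2) * Real.exp (-v / 2) := by
  have hB0 : 0 ≤ B := (abs_nonneg _).trans (hB v₀ ⟨hv₀, le_rfl⟩)
  rw [mul_assoc, ← Real.exp_add]
  rcases le_total v v₀ with hvv | hvv
  · refine (hB v ⟨hv, hvv⟩).trans (le_mul_of_one_le_right hB0 (Real.one_le_exp (by linarith)))
  · refine abs_le_of_sq_le_sq ?_ (by positivity)
    refine (h.sq_le_exp hv₀ hQ hd hvv).trans ?_
    rw [mul_pow, ← Real.exp_nat_mul]
    have : u v₀ ^ 2 ≤ B ^ 2 := by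
      rw [← sq_abs]; exact pow_le_pow_left₀ (abs_nonneg _) (hB v₀ ⟨hv₀, le_rfl⟩) 2
    refine mul_le_mul this (Real.exp_le_exp.2 (by push_cast; linarith)) (Real.exp_pos _).le
      (by positivity)

theorem exists_abs_le_exp (h : SolvesOn Q u w) {v₀ : ℝ} (hv₀ : 0 ≤ v₀)
    (hQ : ∀ v, v₀ ≤ v → 1 ≤ Q v) (hd : ∀ v, v₀ ≤ v → u v * w v ≤ 0) :
    ∃ C, ∀ v, 0 ≤ v → |u v| ≤ C * Real.exp (-v / 2) := by
  obtain ⟨B, hB⟩ := (isCompact_Icc (a := (0 : ℝ)) (b := v₀)).exists_bound_of_continuousOn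
    (h.continuousOn.mono Set.Icc_subset_Ici_self)
  exact ⟨_, fun v hv => h.abs_le_exp hv₀ hQ hd hB hv⟩

/-- Here w² is nonincreasing, and the mean value theorem for u w on [v, v + 1] bounds w(v + 1)² by
-u(v) w(v), hence by a constant times |u(v)|, which decays. -/
theorem tendsto_snd (h : SolvesOn Q u w) {v₀ : ℝ} (hv₀ : 0 ≤ v₀)
    (hQ : ∀ v, v₀ ≤ v → 1 ≤ Q v) (hd : ∀ v, v₀ ≤ v → u v * w v ≤ 0) :
    Tendsto w atTop (nhds 0) := by
  obtain ⟨C, hC⟩ := h.exists_abs_le_exp hv₀ hQ hd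
  have hsq : ∀ v, v₀ ≤ v → HasDerivAt (fun v => w v ^ 2) (2 * Q v * (u v * w v)) v := fun v hv => by
    refine HasDerivAt.congr_deriv ((h.snd v (hv₀.trans hv)).pow 2) ?_; push_cast; ring
  have hanti : AntitoneOn (fun v => w v ^ 2) (Set.Ici v₀) := by
    refine antitoneOn_of_hasDerivWithinAt_nonpos (convex_Ici v₀)
      (f' := fun v => 2 * Q v * (u v * w v))
      (fun v hv => (hsq v hv).continuousAt.continuousWithinAt)
      (fun v hv => ?_) (fun v hv => ?_)
    · rw [interior_Ici] at hv; exact (hsq v hv.le).hasDerivWithinAt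
    · rw [interior_Ici] at hv
      exact mul_nonpos_of_nonneg_of_nonpos (by linarith [hQ v hv.le]) (hd v hv.le)
  have hstep : ∀ v, v₀ ≤ v → w (v + 1) ^ 2 ≤ |u v| * |w v₀| := fun v hv => by
    obtain ⟨ξ, hξ, hξe⟩ := exists_hasDerivAt_eq_slope (fun v => u v * w v)
      (fun v => w v ^ 2 + Q v * u v ^ 2) (lt_add_one v)
      (fun x hx => (h.hasDerivAt_mul (hv₀.trans (hv.trans hx.1))).continuousAt.continuousWithinAt)
      (fun x hx => h.hasDerivAt_mul (hv₀.trans (hv.trans hx.1.le)))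
    have hξv : v₀ ≤ ξ := hv.trans hξ.1.le
    have h1 := hanti hξv (hv.trans (by linarith) : v₀ ≤ v + 1) hξ.2.le
    have h2 := hd (v + 1) (by linarith)
    have h3 : 0 ≤ Q ξ * u ξ ^ 2 := mul_nonneg (by linarith [hQ ξ hξv]) (sq_nonneg _)
    have h4 : w v ^ 2 ≤ w v₀ ^ 2 := hanti (le_refl v₀ : v₀ ≤ v₀) hv hv
    have h5 : |w v| ≤ |w v₀| := sq_le_sq.1 h4
    have h6 : -(u v * w v) ≤ |u v| * |w v₀| := by
      calc -(u v * w v) ≤ |u v * w v| := neg_le_abs _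
        _ = |u v| * |w v| := abs_mul _ _
        _ ≤ _ := mul_le_mul_of_nonneg_left h5 (abs_nonneg _)
    simp only [add_sub_cancel_left, div_one] at hξe h1
    linarith
  have hu0 : Tendsto (fun v : ℝ => C * Real.exp (-v / 2) * |w v₀|) atTop (nhds 0) := by
    have : Tendsto (fun v : ℝ => Real.exp (-v / 2)) atTop (nhds 0) := by
      refine Real.tendsto_exp_atBot.comp ?_
      exact (tendsto_neg_atTop_atBot).atBot_div_const two_pos
    simpa using (this.const_mul C).mul_const |w v₀|
  have h1 : Tendsto (fun v => w (v + 1) ^ 2) atTop (nhds 0) := by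
    refine squeeze_zero' (Eventually.of_forall fun v => sq_nonneg _) ?_ hu0
    filter_upwards [eventually_ge_atTop v₀] with v hv
    exact (hstep v hv).trans (mul_le_mul_of_nonneg_right (hC v (hv₀.trans hv)) (abs_nonneg _))
  have h2 : Tendsto (fun v => w v ^ 2) atTop (nhds 0) := by
    have := h1.comp (tendsto_atTop_add_const_right atTop (-1 : ℝ) tendsto_id)
    simpa [Function.comp_def] using this
  have h3 := (Real.continuous_sqrt.tendsto 0).comp h2
  simp only [Function.comp_def, Real.sqrt_sq_eq_abs, Real.sqrt_zero] at h3
  exact (tendsto_zero_iff_abs_tendsto_zero _).2 h3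

/-- If u u' is positive at one point it stays positive, so u² is bounded below by a positive
constant on a half line. -/
theorem mul_nonpos_of_integrable (h : SolvesOn Q u w) {v₀ : ℝ} (hv₀ : 0 ≤ v₀)
    (hQ : ∀ v, v₀ ≤ v → 0 ≤ Q v) (hi : IntegrableOn (fun v => u v ^ 2) (Set.Ioi 0)) {v : ℝ}
    (hv : v₀ ≤ v) : u v * w v ≤ 0 := by
  by_contra! hpos
  have hge : ∀ x, v ≤ x → u v ^ 2 ≤ u x ^ 2 := by
    have hm : MonotoneOn (fun v => u v ^ 2) (Set.Ici v) := by
      have hsq : ∀ x, v ≤ x → HasDerivAt (fun v => u v ^ 2) (2 * (u x * w x)) x := fun x hx => by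
        refine HasDerivAt.congr_deriv ((h.fst x (hv₀.trans (hv.trans hx))).pow 2) ?_; push_cast; ring
      refine monotoneOn_of_hasDerivWithinAt_nonneg (convex_Ici v) (f' := fun v => 2 * (u v * w v))
        (fun x hx => (hsq x hx).continuousAt.continuousWithinAt)
        (fun x hx => ?_) (fun x hx => ?_)
      · rw [interior_Ici] at hx; exact (hsq x hx.le).hasDerivWithinAt
      · rw [interior_Ici] at hx
        have := h.monotoneOn_mul hv₀ hQ hv (hv.trans hx.le : v₀ ≤ x) hx.le
        simp only at this
        linarith
    exact fun x hx => hm (le_refl v : v ≤ v) hx hx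
  have hu : u v ≠ 0 := by rintro h0; simp [h0] at hpos
  have hi' : IntegrableOn (fun _ : ℝ => u v ^ 2) (Set.Ioi v) := by
    refine Integrable.mono' (hi.mono_set (Set.Ioi_subset_Ioi (hv₀.trans hv)))
      aestronglyMeasurable_const ?_
    filter_upwards [ae_restrict_mem measurableSet_Ioi] with x hx
    rw [Real.norm_eq_abs, abs_of_nonneg (sq_nonneg _)]
    exact hge x hx.le
  rw [IntegrableOn, integrable_const_iff] at hi'
  rcases hi' with h1 | h1
  · exact hu (by simpa using h1)
  · rw [isFiniteMeasure_restrict] at h1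
    simp at h1

theorem hasDerivAt_wronskian (h₁ : SolvesOn Q₁ u₁ w₁) (h₂ : SolvesOn Q₂ u₂ w₂) {v : ℝ}
    (hv : 0 ≤ v) :
    HasDerivAt (fun v => u₁ v * w₂ v - w₁ v * u₂ v) ((Q₂ v - Q₁ v) * (u₁ v * u₂ v)) v := by
  refine HasDerivAt.congr_deriv (((h₁.fst v hv).mul (h₂.snd v hv)).sub ((h₁.snd v hv).mul (h₂.fst v hv))) ?_
  ring

end SolvesOn

theorem tendsto_zero_of_abs_le_exp {u : ℝ → ℝ} {C : ℝ}
    (h : ∀ v, 0 ≤ v → |u v| ≤ C * Real.exp (-v / 2)) : Tendsto u atTop (nhds 0) := by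
  have h1 : Tendsto (fun v : ℝ => C * Real.exp (-v / 2)) atTop (nhds 0) := by
    have : Tendsto (fun v : ℝ => Real.exp (-v / 2)) atTop (nhds 0) := by
      refine Real.tendsto_exp_atBot.comp ?_
      exact (tendsto_neg_atTop_atBot).atBot_div_const two_pos
    simpa using this.const_mul C
  refine squeeze_zero_norm' ?_ h1
  filter_upwards [eventually_ge_atTop 0] with v hv
  exact h v hv

theorem integrableOn_pow_mul_exp_neg (n : ℕ) :
    IntegrableOn (fun v : ℝ => v ^ n * Real.exp (-v)) (Set.Ioi 0) := by
  have := Real.GammaIntegral_convergent (s := n + 1) (by positivity)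
  refine this.congr_fun (fun v hv => ?_) measurableSet_Ioi
  simp only [add_sub_cancel_right, Real.rpow_natCast]
  ring

theorem abs_pow_mul_mul_le {u₁ u₂ : ℝ → ℝ} {C₁ C₂ : ℝ} (n : ℕ)
    (h₁ : ∀ v, 0 ≤ v → |u₁ v| ≤ C₁ * Real.exp (-v / 2))
    (h₂ : ∀ v, 0 ≤ v → |u₂ v| ≤ C₂ * Real.exp (-v / 2)) {v : ℝ} (hv : 0 ≤ v) :
    ‖v ^ n * (u₁ v * u₂ v)‖ ≤ C₁ * C₂ * (v ^ n * Real.exp (-v)) := by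
  rw [norm_mul, norm_mul, Real.norm_eq_abs, Real.norm_eq_abs, Real.norm_eq_abs,
    abs_of_nonneg (pow_nonneg hv n)]
  have h1 : |u₁ v| * |u₂ v| ≤ (C₁ * Real.exp (-v / 2)) * (C₂ * Real.exp (-v / 2)) :=
    mul_le_mul (h₁ v hv) (h₂ v hv) (abs_nonneg _) ((abs_nonneg _).trans (h₁ v hv))
  have h2 : Real.exp (-v) = Real.exp (-v / 2) * Real.exp (-v / 2) := by
    rw [← Real.exp_add]; ring_nf
  rw [h2]
  calc v ^ n * (|u₁ v| * |u₂ v|) ≤ v ^ n * _ := mul_le_mul_of_nonneg_left h1 (pow_nonneg hv n)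
    _ = _ := by ring

theorem integrableOn_pow_mul_mul {u₁ u₂ : ℝ → ℝ} {C₁ C₂ : ℝ} (n : ℕ)
    (hc₁ : ContinuousOn u₁ (Set.Ici 0)) (hc₂ : ContinuousOn u₂ (Set.Ici 0))
    (h₁ : ∀ v, 0 ≤ v → |u₁ v| ≤ C₁ * Real.exp (-v / 2))
    (h₂ : ∀ v, 0 ≤ v → |u₂ v| ≤ C₂ * Real.exp (-v / 2)) :
    IntegrableOn (fun v => v ^ n * (u₁ v * u₂ v)) (Set.Ioi 0) := by
  refine Integrable.mono' ((integrableOn_pow_mul_exp_neg n).const_mul (C₁ * C₂)) ?_ ?_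
  · refine ContinuousOn.aestronglyMeasurable ?_ measurableSet_Ioi
    exact (((continuous_pow n).continuousOn).mul (hc₁.mul hc₂)).mono Set.Ioi_subset_Ici_self
  · filter_upwards [ae_restrict_mem measurableSet_Ioi] with v hv
    exact abs_pow_mul_mul_le n h₁ h₂ (le_of_lt hv)

/-! ### The Airy function: contour integral, differential equation, nonvanishing. -/

/-- The integrand of the contour integral for the Airy function. -/
def airyKernel (x t : ℝ) : ℂ :=
  Complex.exp (Complex.I * (((t : ℂ) + Complex.I) ^ 3 / 3 + (x : ℂ) * ((t : ℂ) + Complex.I)))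

/-- The contour integral for the `n`-th derivative of `2π Ai`. -/
def airyIntegral (n : ℕ) (x : ℝ) : ℂ :=
  ∫ t : ℝ, (Complex.I * ((t : ℂ) + Complex.I)) ^ n * airyKernel x t

theorem norm_airyKernel (x t : ℝ) :
    ‖airyKernel x t‖ = Real.exp (1 / 3 - t ^ 2 - x) := by
  have h : Complex.I * (((t : ℂ) + Complex.I) ^ 3 / 3 + (x : ℂ) * ((t : ℂ) + Complex.I)) =
      ((1 / 3 - t ^ 2 - x : ℝ) : ℂ) + ((t ^ 3 / 3 - t + x * t : ℝ) : ℂ) * Complex.I := by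
    have h2 : Complex.I ^ 2 = -1 := Complex.I_sq
    have h3 : Complex.I ^ 3 = -Complex.I := by rw [pow_succ, h2]; ring
    have h4 : Complex.I ^ 4 = 1 := Complex.I_pow_four
    push_cast
    ring_nf
    rw [h4, h3, h2]
    ring
  rw [airyKernel, Complex.norm_exp, h, Complex.add_re, Complex.re_ofReal_mul, Complex.I_re,
    mul_zero, add_zero, Complex.ofReal_re]

theorem continuous_airyKernel (x : ℝ) : Continuous (airyKernel x) := by
  unfold airyKernel; fun_prop

/-- On the line Im ζ = 1 the kernel has Gaussian modulus exp(1/3 - t² - x). The polynomial factor is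
absorbed by (|t| + 1)^n ≤ n! e^{|t| + 1}, at the cost of half the Gaussian. The factor e^{-x}
supplies the decay of Ai and Ai' at +∞. -/
theorem norm_airyIntegrand_le (n : ℕ) (x t : ℝ) :
    ‖(Complex.I * ((t : ℂ) + Complex.I)) ^ n * airyKernel x t‖ ≤
      Real.exp (-x) * (n.factorial * Real.exp 2 * Real.exp (-(1 / 2) * t ^ 2)) := by
  have h1 : ‖Complex.I * ((t : ℂ) + Complex.I)‖ ≤ |t| + 1 := by
    rw [norm_mul, Complex.norm_I, one_mul]
    exact (norm_add_le _ _).trans (by simp)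
  have h2 : (|t| + 1) ^ n ≤ n.factorial * Real.exp (|t| + 1) := by
    have := Real.pow_div_factorial_le_exp (|t| + 1) (by positivity) n
    rwa [div_le_iff₀' (by positivity)] at this
  have h3 : Real.exp (|t| + 1) * Real.exp (1 / 3 - t ^ 2 - x) ≤
      Real.exp (-x) * (Real.exp 2 * Real.exp (-(1 / 2) * t ^ 2)) := by
    rw [← Real.exp_add, ← Real.exp_add, ← Real.exp_add]
    refine Real.exp_le_exp.2 ?_
    nlinarith [sq_nonneg (|t| - 1), sq_abs t]
  rw [norm_mul, norm_pow, norm_airyKernel]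
  calc ‖Complex.I * ((t : ℂ) + Complex.I)‖ ^ n * Real.exp (1 / 3 - t ^ 2 - x)
      ≤ (n.factorial * Real.exp (|t| + 1)) * Real.exp (1 / 3 - t ^ 2 - x) :=
        mul_le_mul_of_nonneg_right ((pow_le_pow_left₀ (norm_nonneg _) h1 n).trans h2)
          (Real.exp_pos _).le
    _ = n.factorial * (Real.exp (|t| + 1) * Real.exp (1 / 3 - t ^ 2 - x)) := by ring
    _ ≤ n.factorial * (Real.exp (-x) * (Real.exp 2 * Real.exp (-(1 / 2) * t ^ 2))) :=
        mul_le_mul_of_nonneg_left h3 (by positivity)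
    _ = _ := by ring

theorem integrable_airyBound (c : ℝ) :
    Integrable fun t : ℝ => c * Real.exp (-(1 / 2) * t ^ 2) :=
  (integrable_exp_neg_mul_sq (by norm_num)).const_mul c

theorem continuous_airyIntegrand (n : ℕ) (x : ℝ) :
    Continuous fun t : ℝ => (Complex.I * ((t : ℂ) + Complex.I)) ^ n * airyKernel x t := by
  have := continuous_airyKernel x
  fun_prop

theorem integrable_airyIntegrand (n : ℕ) (x : ℝ) :
    Integrable fun t : ℝ => (Complex.I * ((t : ℂ) + Complex.I)) ^ n * airyKernel x t :=
  ((integrable_airyBound _).const_mul _).mono'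
    (continuous_airyIntegrand n x).aestronglyMeasurable
    (Eventually.of_forall fun t => norm_airyIntegrand_le n x t)

theorem exists_norm_airyIntegral_le (n : ℕ) :
    ∃ K, ∀ x, ‖airyIntegral n x‖ ≤ K * Real.exp (-x) := by
  refine ⟨∫ t : ℝ, n.factorial * Real.exp 2 * Real.exp (-(1 / 2) * t ^ 2), fun x => ?_⟩
  rw [mul_comm, ← integral_const_mul]
  exact norm_integral_le_of_norm_le ((integrable_airyBound _).const_mul _)
    (Eventually.of_forall fun t => norm_airyIntegrand_le n x t)

theorem hasDerivAt_airyKernel_left (x t : ℝ) :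
    HasDerivAt (fun x => airyKernel x t)
      (Complex.I * ((t : ℂ) + Complex.I) * airyKernel x t) x := by
  have h0 : HasDerivAt (fun x : ℝ => (x : ℂ)) 1 x := Complex.ofRealCLM.hasDerivAt
  refine ((((h0.mul_const ((t : ℂ) + Complex.I)).const_add
    (((t : ℂ) + Complex.I) ^ 3 / 3)).const_mul Complex.I).cexp).congr_deriv ?_
  rw [airyKernel]; ring

theorem hasDerivAt_airyKernel_right (x t : ℝ) :
    HasDerivAt (airyKernel x)
      (Complex.I * (((t : ℂ) + Complex.I) ^ 2 + x) * airyKernel x t) t := by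
  have h0 : HasDerivAt (fun t : ℝ => (t : ℂ) + Complex.I) 1 t :=
    (Complex.ofRealCLM.hasDerivAt (x := t)).add_const Complex.I
  refine (((((h0.pow 3).div_const 3).add (h0.const_mul (x : ℂ))).const_mul
    Complex.I).cexp).congr_deriv ?_
  simp only [airyKernel, Pi.add_apply, Pi.pow_apply]
  push_cast
  ring

theorem hasDerivAt_airyIntegral (n : ℕ) (x : ℝ) :
    HasDerivAt (airyIntegral n) (airyIntegral (n + 1) x) x := by
  refine (hasDerivAt_integral_of_dominated_loc_of_deriv_le (s := Metric.ball x 1)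
    (bound := fun t => Real.exp (-(x - 1)) *
      ((n + 1).factorial * Real.exp 2 * Real.exp (-(1 / 2) * t ^ 2)))
    (F' := fun x t => (Complex.I * ((t : ℂ) + Complex.I)) ^ (n + 1) * airyKernel x t)
    (Metric.ball_mem_nhds x one_pos)
    (Eventually.of_forall fun y => (continuous_airyIntegrand n y).aestronglyMeasurable)
    (integrable_airyIntegrand n x) (continuous_airyIntegrand (n + 1) x).aestronglyMeasurable
    (Eventually.of_forall fun t y hy => ?_) ((integrable_airyBound _).const_mul _)
    (Eventually.of_forall fun t y _ => ?_)).2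
  · refine (norm_airyIntegrand_le (n + 1) y t).trans (mul_le_mul_of_nonneg_right ?_ (by positivity))
    refine Real.exp_le_exp.2 ?_
    have := (abs_lt.1 (Real.dist_eq y x ▸ Metric.mem_ball.1 hy)).1
    linarith
  · refine ((hasDerivAt_airyKernel_left y t).const_mul _).congr_deriv ?_
    ring

/-- Airy's equation: the t-derivative of the kernel is i(ζ² + x) times the kernel, and its integral
over the line vanishes. -/
theorem airyIntegral_two (x : ℝ) : airyIntegral 2 x = x * airyIntegral 0 x := by
  have hi : Integrable fun t : ℝ => Complex.I * (((t : ℂ) + Complex.I) ^ 2 + x) * airyKernel x t := by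
    have := ((integrable_airyIntegrand 2 x).const_mul (-Complex.I)).add
      ((integrable_airyIntegrand 0 x).const_mul (Complex.I * x))
    refine this.congr (Eventually.of_forall fun t => ?_)
    simp only [Pi.add_apply, mul_pow, Complex.I_sq]
    ring
  have hi0 : Integrable (airyKernel x) := by simpa using integrable_airyIntegrand 0 x
  have h0 := integral_eq_zero_of_hasDerivAt_of_integrable
    (fun t => hasDerivAt_airyKernel_right x t) hi hi0
  have h1 : ∫ t : ℝ, Complex.I * (((t : ℂ) + Complex.I) ^ 2 + x) * airyKernel x t =
      -Complex.I * airyIntegral 2 x + Complex.I * x * airyIntegral 0 x := by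
    rw [airyIntegral, airyIntegral, ← integral_const_mul, ← integral_const_mul,
      ← integral_add ((integrable_airyIntegrand 2 x).const_mul _)
        ((integrable_airyIntegrand 0 x).const_mul _)]
    refine integral_congr_ae (Eventually.of_forall fun t => ?_)
    simp only [mul_pow, Complex.I_sq]
    ring
  rw [h1] at h0
  have h2 : Complex.I * (x * airyIntegral 0 x - airyIntegral 2 x) = 0 := by rw [← h0]; ring
  rcases mul_eq_zero.1 h2 with h | h
  · exact absurd h Complex.I_ne_zero
  · exact (sub_eq_zero.1 h).symm

theorem airyIntegral_zero_im (x : ℝ) : (airyIntegral 0 x).im = 0 := by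
  rw [← Complex.conj_eq_iff_im]
  simp only [airyIntegral, pow_zero, one_mul]
  rw [← integral_conj, ← integral_neg_eq_self (airyKernel x)]
  refine integral_congr_ae (Eventually.of_forall fun t => ?_)
  simp only [airyKernel]
  rw [← Complex.exp_conj]
  congr 1
  simp only [map_mul, map_add, map_div₀, map_pow, Complex.conj_I, Complex.conj_ofReal,
    Complex.ofReal_neg, map_ofNat]
  ring

/-- Up to the factor e^{-2πw}, the integral at x = -2πw is the Fourier transform at w of the kernel
for x = 0. Were it zero for all w, Fourier inversion would make that kernel vanish. -/
theorem airyIntegral_zero_ne_zero : ∃ x, airyIntegral 0 x ≠ 0 := by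
  by_contra! h
  have hi0 : Integrable (airyKernel 0) := by simpa using integrable_airyIntegrand 0 0
  have hF : FourierTransform.fourier (airyKernel 0) = 0 := by
    funext w
    rw [Real.fourier_real_eq_integral_exp_smul]
    have := h (-(2 * Real.pi * w))
    simp only [airyIntegral, pow_zero, one_mul] at this
    have h1 : ∀ t : ℝ, Complex.exp (((-2 * Real.pi * t * w : ℝ) : ℂ) * Complex.I) • airyKernel 0 t =
        Complex.exp (((-(2 * Real.pi * w) : ℝ) : ℂ)) * airyKernel (-(2 * Real.pi * w)) t := by
      intro t
      rw [airyKernel, airyKernel, smul_eq_mul, ← Complex.exp_add, ← Complex.exp_add]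
      congr 1
      push_cast
      linear_combination (2 * Real.pi * w : ℂ) * Complex.I_sq
    simp only [h1]
    rw [integral_const_mul, this, mul_zero]
    rfl
  have hinv := (continuous_airyKernel 0).fourierInv_fourier_eq hi0
    (by rw [hF]; exact integrable_zero _ _ _)
  have h0 := congrFun hinv 0
  rw [hF, Real.fourierInv_eq] at h0
  have : ‖airyKernel 0 0‖ = 0 := by rw [← h0]; simp
  rw [norm_airyKernel] at this
  exact (Real.exp_pos _).ne' this

theorem airyAi_eq (x : ℝ) : airyAi x = (2 * Real.pi)⁻¹ * (airyIntegral 0 x).re := by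
  have : airyAi x = ((2 * Real.pi : ℂ)⁻¹ * airyIntegral 0 x).re := by
    simp [airyAi, airyIntegral, airyKernel]
  rw [this, show (2 * Real.pi : ℂ)⁻¹ = (((2 * Real.pi)⁻¹ : ℝ) : ℂ) by push_cast; rfl,
    Complex.re_ofReal_mul]

theorem hasDerivAt_airyIntegral_re (n : ℕ) (x : ℝ) :
    HasDerivAt (fun x => (2 * Real.pi)⁻¹ * (airyIntegral n x).re)
      ((2 * Real.pi)⁻¹ * (airyIntegral (n + 1) x).re) x :=
  ((Complex.reCLM.hasFDerivAt.comp_hasDerivAt x (hasDerivAt_airyIntegral n x))).const_mul _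

theorem deriv_airyAi (x : ℝ) : deriv airyAi x = (2 * Real.pi)⁻¹ * (airyIntegral 1 x).re := by
  rw [show airyAi = _ from funext airyAi_eq]
  exact (hasDerivAt_airyIntegral_re 0 x).deriv

theorem hasDerivAt_airyAi (x : ℝ) : HasDerivAt airyAi (deriv airyAi x) x := by
  rw [deriv_airyAi, show airyAi = _ from funext airyAi_eq]
  exact hasDerivAt_airyIntegral_re 0 x

theorem hasDerivAt_deriv_airyAi (x : ℝ) : HasDerivAt (deriv airyAi) (x * airyAi x) x := by
  rw [airyAi_eq, show deriv airyAi = _ from funext deriv_airyAi]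
  refine (hasDerivAt_airyIntegral_re 1 x).congr_deriv ?_
  rw [airyIntegral_two, Complex.re_ofReal_mul]
  ring

theorem continuous_airyAi : Continuous airyAi :=
  continuous_iff_continuousAt.2 fun x => (hasDerivAt_airyAi x).continuousAt

theorem continuous_deriv_airyAi : Continuous (deriv airyAi) :=
  continuous_iff_continuousAt.2 fun x => (hasDerivAt_deriv_airyAi x).continuousAt

theorem exists_abs_airy_le (n : ℕ) :
    ∃ K, ∀ x, |(2 * Real.pi)⁻¹ * (airyIntegral n x).re| ≤ K * Real.exp (-x) := by
  obtain ⟨K, hK⟩ := exists_norm_airyIntegral_le n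
  refine ⟨(2 * Real.pi)⁻¹ * K, fun x => ?_⟩
  rw [abs_mul, abs_of_nonneg (by positivity), mul_assoc]
  exact mul_le_mul_of_nonneg_left ((Complex.abs_re_le_norm _).trans (hK x)) (by positivity)

theorem exists_abs_airyAi_shift_le (z : ℝ) :
    ∃ C, ∀ v, 0 ≤ v → |airyAi (v + z)| ≤ C * Real.exp (-v / 2) := by
  obtain ⟨K, hK⟩ := exists_abs_airy_le 0
  have hK0 : 0 ≤ K := by
    have := (abs_nonneg _).trans (hK 0)
    simpa using this
  refine ⟨K * Real.exp (-z), fun v hv => ?_⟩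
  rw [airyAi_eq]
  refine (hK _).trans ?_
  rw [mul_assoc, ← Real.exp_add]
  exact mul_le_mul_of_nonneg_left (Real.exp_le_exp.2 (by linarith)) hK0

theorem tendsto_deriv_airyAi : Tendsto (deriv airyAi) atTop (nhds 0) := by
  obtain ⟨K, hK⟩ := exists_abs_airy_le 1
  rw [show deriv airyAi = _ from funext deriv_airyAi]
  refine squeeze_zero_norm hK ?_
  simpa using (Real.tendsto_exp_neg_atTop_nhds_zero).const_mul K

theorem tendsto_airyAi : Tendsto airyAi atTop (nhds 0) := by
  obtain ⟨K, hK⟩ := exists_abs_airy_le 0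
  rw [show airyAi = _ from funext airyAi_eq]
  refine squeeze_zero_norm hK ?_
  simpa using (Real.tendsto_exp_neg_atTop_nhds_zero).const_mul K

theorem solvesOn_airyAi_shift (z : ℝ) :
    SolvesOn (fun v => v + z) (fun v => airyAi (v + z)) fun v => deriv airyAi (v + z) :=
  ⟨fun v _ => (hasDerivAt_airyAi (v + z)).comp_add_const v z,
    fun v _ => (hasDerivAt_deriv_airyAi (v + z)).comp_add_const v z⟩

/-- A common zero would make Ai vanish on both sides by uniqueness, hence identically; the contour
integral is real, so it would vanish identically too. -/
theorem airyAi_or_deriv_ne_zero (x : ℝ) : airyAi x ≠ 0 ∨ deriv airyAi x ≠ 0 := by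
  by_contra! h
  obtain ⟨y, hy⟩ := airyIntegral_zero_ne_zero
  refine hy (Complex.ext ?_ (airyIntegral_zero_im y))
  suffices airyAi y = 0 by
    rw [airyAi_eq] at this
    simpa [Real.pi_ne_zero] using this
  rcases le_total x y with hxy | hxy
  · have := eq_zero_of_second_order (f := fun v => airyAi (v + x))
      (f' := fun v => deriv airyAi (v + x)) (Q := fun v => v + x) (by fun_prop)
      (solvesOn_airyAi_shift x).fst (solvesOn_airyAi_shift x).snd
      (by simpa using h.1) (by simpa using h.2) (sub_nonneg.2 hxy)
    simpa using this
  -- Uniqueness is available only forward in v, so the left side is reached by reflection.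
  · have := eq_zero_of_second_order (f := fun v => airyAi (x - v))
      (f' := fun v => -deriv airyAi (x - v)) (Q := fun v => x - v) (by fun_prop)
      (fun v _ => (hasDerivAt_airyAi (x - v)).comp_const_sub x v)
      (fun v _ => by
        refine ((hasDerivAt_deriv_airyAi (x - v)).comp_const_sub x v).neg.congr_deriv ?_
        simp)
      (by simpa using h.1) (by simpa using h.2) (sub_nonneg.2 hxy)
    simpa using this

/-- On [0, ∞) the product Ai Ai' is nondecreasing with limit 0, hence nonpositive. If it vanished at
x it would vanish on [x, ∞), and so would its derivative Ai'² + v Ai², giving a common zero of Ai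
and Ai'. -/
theorem airyAi_mul_deriv_neg {x : ℝ} (hx : 0 ≤ x) : airyAi x * deriv airyAi x < 0 := by
  have hs := solvesOn_airyAi_shift 0
  simp only [add_zero] at hs
  have hmono := hs.monotoneOn_mul le_rfl fun v hv => hv
  have hlim : Tendsto (fun v => airyAi v * deriv airyAi v) atTop (nhds 0) := by
    simpa using tendsto_airyAi.mul tendsto_deriv_airyAi
  have hle : ∀ v, 0 ≤ v → airyAi v * deriv airyAi v ≤ 0 := fun v hv => by
    refine ge_of_tendsto hlim ?_
    filter_upwards [eventually_ge_atTop v] with y hy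
    exact hmono hv (hv.trans hy : 0 ≤ y) hy
  refine lt_of_le_of_ne (hle x hx) fun h0 => ?_
  have hz : ∀ v, x < v → airyAi v * deriv airyAi v = 0 := fun v hv => by
    refine le_antisymm (hle v (hx.trans hv.le)) ?_
    rw [← h0]
    exact hmono hx (hx.trans hv.le : 0 ≤ v) hv.le
  have hx1 : x < x + 1 := lt_add_one x
  have hd : HasDerivAt (fun v => airyAi v * deriv airyAi v) 0 (x + 1) := by
    refine (hasDerivAt_const (x + 1) (0 : ℝ)).congr_of_eventuallyEq ?_
    filter_upwards [Ioi_mem_nhds hx1] with v hv using hz v hv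
  have he := (hs.hasDerivAt_mul (by linarith : 0 ≤ x + 1)).unique hd
  have h1 : 0 ≤ (x + 1) * airyAi (x + 1) ^ 2 := by positivity
  have h2 : deriv airyAi (x + 1) = 0 := by
    have := sq_nonneg (deriv airyAi (x + 1))
    exact pow_eq_zero_iff (two_ne_zero) |>.1 (by linarith)
  have h3 : airyAi (x + 1) = 0 := by
    rw [h2] at he
    have : (x + 1) * airyAi (x + 1) ^ 2 = 0 := by simpa using he
    rcases mul_eq_zero.1 this with h | h
    · linarith
    · exact pow_eq_zero_iff (two_ne_zero) |>.1 h
  rcases airyAi_or_deriv_ne_zero (x + 1) with h | h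
  · exact h h3
  · exact h h2

/-! ### Zeros of Ai and Ai': counting and interlacing. -/

theorem nthZero_eq {f : ℝ → ℝ} {j : ℕ} {z : ℝ} (h : IsNthZero f j z) : nthZero f j = z := by
  have hset : {w : ℝ | (j : ℕ∞) ≤ ({x | f x = 0} ∩ Set.Ici w).encard} = Set.Iic z := by
    ext w
    simp only [Set.mem_ofPred_eq, Set.mem_Iic]
    refine ⟨fun hw => ?_, fun hw => ?_⟩
    · by_contra! hzw
      have hfin : ({x | f x = 0} ∩ Set.Ici z).Finite := by
        rw [← Set.encard_lt_top_iff, h.2]; exact ENat.natCast_lt_top j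
      have hss : {x | f x = 0} ∩ Set.Ici w ⊂ {x | f x = 0} ∩ Set.Ici z := by
        refine ⟨Set.inter_subset_inter_right _ (Set.Ici_subset_Ici.2 hzw.le), fun hc => ?_⟩
        exact absurd (hc ⟨h.1, le_refl z⟩).2 (not_le.2 hzw)
      have := (hfin.subset hss.1).encard_lt_encard hss
      rw [h.2] at this
      exact absurd hw (not_le.2 this)
    · rw [← h.2]
      exact Set.encard_le_encard (Set.inter_subset_inter_right _ (Set.Ici_subset_Ici.2 hw))
  rw [nthZero, hset, csSup_Iic]

/-- Infinitely many zeros in [z, 0] would accumulate at a zero, contradicting that simple zeros are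
isolated. -/
theorem finite_zeros_inter_Ici {f f' : ℝ → ℝ} (hf : ∀ x, HasDerivAt f (f' x) x)
    (hne : ∀ x, f x = 0 → f' x ≠ 0) (hneg : ∀ x, f x = 0 → x < 0) (z : ℝ) :
    ({x | f x = 0} ∩ Set.Ici z).Finite := by
  by_contra hinf
  have hsub : {x | f x = 0} ∩ Set.Ici z ⊆ Set.Icc z 0 := fun x hx => ⟨hx.2, (hneg x hx.1).le⟩
  obtain ⟨x, -, hx⟩ := Set.Infinite.exists_accPt_of_subset_isCompact hinf isCompact_Icc hsub
  have hfreq : ∃ᶠ y in nhdsWithin x {x}ᶜ, f y = 0 :=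
    (accPt_iff_frequently_nhdsNE.1 hx).mono fun y hy => hy.1
  have hc : Continuous f := continuous_iff_continuousAt.2 fun x => (hf x).continuousAt
  have hx0 : f x = 0 := by
    have hcl : IsClosed {x | f x = 0} := isClosed_eq hc continuous_const
    exact hcl.mem_of_frequently_of_tendsto (hfreq) (tendsto_nhdsWithin_of_tendsto_nhds tendsto_id)
  exact hfreq ((hf x).eventually_ne (hne x hx0))

theorem exists_next_below {S : Set ℝ} (hfin : ∀ z, (S ∩ Set.Ici z).Finite)
    (hunb : ∀ M, ∃ x ∈ S, x < M) (z : ℝ) :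
    ∃ x ∈ S, x < z ∧ (∀ y ∈ S, y < z → y ≤ x) ∧
      (S ∩ Set.Ici x).encard = (S ∩ Set.Ici z).encard + 1 := by
  obtain ⟨x₀, hx₀, hx₀z⟩ := hunb z
  have hF : (S ∩ Set.Ici x₀ ∩ Set.Iio z).Finite := (hfin x₀).subset Set.inter_subset_left
  obtain ⟨x, ⟨⟨hxS, hxx⟩, hxz⟩, hmax⟩ := Set.exists_max_image _ id hF ⟨x₀, ⟨hx₀, le_refl x₀⟩, hx₀z⟩
  have hm : ∀ y ∈ S, y < z → y ≤ x := fun y hy hyz => by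
    rcases le_total x₀ y with h | h
    · exact hmax y ⟨⟨hy, h⟩, hyz⟩
    · exact h.trans hxx
  refine ⟨x, hxS, hxz, hm, ?_⟩
  have : S ∩ Set.Ici x = insert x (S ∩ Set.Ici z) := by
    ext y
    simp only [Set.mem_inter_iff, Set.mem_Ici, Set.mem_insert_iff]
    refine ⟨fun h => ?_, fun h => ?_⟩
    · rcases lt_or_ge y z with hyz | hyz
      · exact Or.inl (le_antisymm (hm y h.1 hyz) h.2)
      · exact Or.inr ⟨h.1, hyz⟩
    · rcases h with rfl | h
      · exact ⟨hxS, le_rfl⟩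
      · exact ⟨h.1, (le_of_lt hxz).trans h.2⟩
  rw [this, Set.encard_insert_of_notMem fun h => absurd (Set.mem_Ici.1 h.2) (not_le.2 hxz)]

theorem inter_Ici_eq_of_forall {S : Set ℝ} {x z : ℝ} (hxz : x ≤ z) (h : ∀ s ∈ S, x ≤ s → z ≤ s) :
    S ∩ Set.Ici x = S ∩ Set.Ici z := by
  ext y
  exact ⟨fun hy => ⟨hy.1, h y hy.1 hy.2⟩, fun hy => ⟨hy.1, hxz.trans hy.2⟩⟩

/-- Two interlacing discrete sets of negative numbers, `S'` having the largest element. -/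
theorem exists_interlacing {S S' : Set ℝ} (hfin : ∀ z, (S ∩ Set.Ici z).Finite)
    (hfin' : ∀ z, (S' ∩ Set.Ici z).Finite) (hunb : ∀ M, ∃ x ∈ S, x < M)
    (hneg : ∀ x ∈ S, x < 0) (hneg' : ∀ x ∈ S', x < 0)
    (hSS : ∀ x ∈ S, ∀ y ∈ S, x < y → ∃ c ∈ S', x < c ∧ c < y)
    (hSS' : ∀ x ∈ S', ∀ y ∈ S', x < y → ∃ c ∈ S, x < c ∧ c < y)
    (htop : ∀ x ∈ S, ∃ y ∈ S', x < y) (j : ℕ) :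
    ∃ z' z, z' ∈ S' ∧ z ∈ S ∧ (S' ∩ Set.Ici z').encard = (j + 1 : ℕ) ∧
      (S ∩ Set.Ici z').encard = j ∧ (S ∩ Set.Ici z).encard = (j + 1 : ℕ) ∧
      (S' ∩ Set.Ici z).encard = (j + 1 : ℕ) := by
  have hunb' : ∀ M, ∃ x ∈ S', x < M := fun M => by
    obtain ⟨y, hy, hyM⟩ := hunb M
    obtain ⟨x, hx, hxy⟩ := hunb y
    obtain ⟨c, hc, -, hcy⟩ := hSS x hx y hy hxy
    exact ⟨c, hc, hcy.trans hyM⟩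
  -- The induction carries a cutoff z with j points of each set in [z, ∞). The side condition, that
  -- a point of S' separates z from every lower point of S, ensures that the next point down belongs
  -- to S'. It comes from `htop` at the initial cutoff 0 and from `hSS` afterwards, when z lies in
  -- S.
  have step : ∀ (j : ℕ) (z : ℝ), (S ∩ Set.Ici z).encard = j → (S' ∩ Set.Ici z).encard = j →
      (∀ s ∈ S, s < z → ∃ c ∈ S', s < c ∧ c < z) →
      ∃ z' z₂, z' ∈ S' ∧ z₂ ∈ S ∧ (S' ∩ Set.Ici z').encard = (j + 1 : ℕ) ∧
        (S ∩ Set.Ici z').encard = j ∧ (S ∩ Set.Ici z₂).encard = (j + 1 : ℕ) ∧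
        (S' ∩ Set.Ici z₂).encard = (j + 1 : ℕ) := by
    intro j z hN hN' hgood
    obtain ⟨z', hz', hz'z, hmax', hcard'⟩ := exists_next_below hfin' hunb' z
    obtain ⟨z₂, hz₂, hz₂z, hmax, hcard⟩ := exists_next_below hfin hunb z'
    have h1 : S ∩ Set.Ici z' = S ∩ Set.Ici z := by
      refine inter_Ici_eq_of_forall hz'z.le fun s hs hzs => ?_
      by_contra! hsz
      obtain ⟨c, hc, hsc, hcz⟩ := hgood s hs hsz
      exact absurd (hmax' c hc hcz) (not_le.2 (hzs.trans_lt hsc))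
    have h2 : S' ∩ Set.Ici z₂ = S' ∩ Set.Ici z' := by
      refine inter_Ici_eq_of_forall hz₂z.le fun s hs hzs => ?_
      by_contra! hsz
      obtain ⟨c, hc, hsc, hcz⟩ := hSS' s hs z' hz' hsz
      exact absurd (hmax c hc hcz) (not_le.2 (hzs.trans_lt hsc))
    refine ⟨z', z₂, hz', hz₂, ?_, ?_, ?_, ?_⟩
    · rw [hcard', hN']; push_cast; rfl
    · rw [h1, hN]
    · rw [hcard, h1, hN]; push_cast; rfl
    · rw [h2, hcard', hN']; push_cast; rfl
  induction j with
  | zero =>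
    refine step 0 0 ?_ ?_ fun s hs _ => ?_
    · rw [Nat.cast_zero, Set.encard_eq_zero]
      exact Set.eq_empty_of_forall_notMem fun x hx => absurd hx.2 (not_le.2 (hneg x hx.1))
    · rw [Nat.cast_zero, Set.encard_eq_zero]
      exact Set.eq_empty_of_forall_notMem fun x hx => absurd hx.2 (not_le.2 (hneg' x hx.1))
    · obtain ⟨y, hy, hsy⟩ := htop s hs
      exact ⟨y, hy, hsy, hneg' y hy⟩
  | succ j ih =>
    obtain ⟨z', z, -, hz, -, -, h1, h2⟩ := ih
    exact step (j + 1) z h1 h2 fun s hs hsz => hSS s hs z hz hsz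

theorem airyAi_ne_zero_of_nonneg {x : ℝ} (hx : 0 ≤ x) : airyAi x ≠ 0 := fun h => by
  have := airyAi_mul_deriv_neg hx
  simp [h] at this

theorem deriv_airyAi_ne_zero_of_nonneg {x : ℝ} (hx : 0 ≤ x) : deriv airyAi x ≠ 0 := fun h => by
  have := airyAi_mul_deriv_neg hx
  simp [h] at this

theorem airyAi_zero_neg {x : ℝ} (h : airyAi x = 0) : x < 0 :=
  not_le.1 fun hx => airyAi_ne_zero_of_nonneg hx h

theorem deriv_airyAi_zero_neg {x : ℝ} (h : deriv airyAi x = 0) : x < 0 :=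
  not_le.1 fun hx => deriv_airyAi_ne_zero_of_nonneg hx h

theorem deriv_airyAi_ne_zero {x : ℝ} (h : airyAi x = 0) : deriv airyAi x ≠ 0 :=
  (airyAi_or_deriv_ne_zero x).resolve_left (not_not.2 h)

theorem mul_airyAi_ne_zero {x : ℝ} (h : deriv airyAi x = 0) : x * airyAi x ≠ 0 :=
  mul_ne_zero (deriv_airyAi_zero_neg h).ne
    ((airyAi_or_deriv_ne_zero x).resolve_right (not_not.2 h))

/-- Sturm comparison with the sine function: a solution of `y'' = x y` does not stay positive on an
interval of length `π` contained in `(-∞, -1]`. -/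
theorem not_pos_of_airy_equation {y y' : ℝ → ℝ} (hy : ∀ x, HasDerivAt y (y' x) x)
    (hy' : ∀ x, HasDerivAt y' (x * y x) x) {a : ℝ} (ha : 1 ≤ a) :
    ¬ ∀ x ∈ Set.Icc (-a - Real.pi) (-a), 0 < y x := by
  intro hpos
  have hπ := Real.pi_pos
  -- This is the Wronskian of y with sin(x + a + π). It is nondecreasing as long as y > 0, yet its
  -- end values are y(-a - π) > 0 and -y(-a) < 0.
  have hd : ∀ x, HasDerivAt (fun x => y x * Real.cos (x + a + Real.pi) -
      y' x * Real.sin (x + a + Real.pi)) ((-1 - x) * y x * Real.sin (x + a + Real.pi)) x := by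
    intro x
    have h1 : HasDerivAt (fun x => x + a + Real.pi) 1 x :=
      ((hasDerivAt_id x).add_const a).add_const Real.pi
    refine (((hy x).mul h1.cos).sub ((hy' x).mul h1.sin)).congr_deriv ?_
    ring
  have hmono : MonotoneOn (fun x => y x * Real.cos (x + a + Real.pi) -
      y' x * Real.sin (x + a + Real.pi)) (Set.Icc (-a - Real.pi) (-a)) := by
    refine monotoneOn_of_hasDerivWithinAt_nonneg (convex_Icc _ _)
      (fun x _ => (hd x).continuousAt.continuousWithinAt) (fun x _ => (hd x).hasDerivWithinAt)
      fun x hx => ?_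
    rw [interior_Icc] at hx
    refine mul_nonneg (mul_nonneg (by linarith [hx.2]) (hpos x ⟨hx.1.le, hx.2.le⟩).le) ?_
    exact Real.sin_nonneg_of_nonneg_of_le_pi (by linarith [hx.1]) (by linarith [hx.2])
  have hl : (-a - Real.pi) ∈ Set.Icc (-a - Real.pi) (-a) := ⟨le_rfl, by linarith⟩
  have hr : -a ∈ Set.Icc (-a - Real.pi) (-a) := ⟨by linarith, le_rfl⟩
  have h := hmono hl hr (by linarith)
  have e1 : -a - Real.pi + a + Real.pi = 0 := by ring
  have e2 : -a + a + Real.pi = Real.pi := by ring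
  simp only [e1, e2, Real.cos_zero, Real.sin_zero, Real.cos_pi, Real.sin_pi] at h
  linarith [hpos _ hl, hpos _ hr]

theorem exists_airyAi_zero_lt (M : ℝ) : ∃ x, airyAi x = 0 ∧ x < M := by
  by_contra! h
  set a := max 1 (1 - M) with ha
  have ha1 : 1 ≤ a := le_max_left _ _
  have haM : -a < M := by linarith [le_max_right 1 (1 - M)]
  have hne : ∀ x ∈ Set.Icc (-a - Real.pi) (-a), airyAi x ≠ 0 := fun x hx h0 =>
    absurd (h x h0) (not_le.2 (hx.2.trans_lt haM))
  rcases lt_or_gt_of_ne (hne (-a) ⟨by linarith [Real.pi_pos], le_rfl⟩) with hs | hs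
  · refine not_pos_of_airy_equation (y := fun x => -airyAi x) (y' := fun x => -deriv airyAi x)
      (fun x => (hasDerivAt_airyAi x).neg)
      (fun x => (hasDerivAt_deriv_airyAi x).neg.congr_deriv (by ring)) ha1 fun x hx => ?_
    by_contra! hx0
    have h1 : 0 ≤ airyAi x := by linarith
    obtain ⟨c, hc, hc0⟩ := intermediate_value_Icc' hx.2 continuous_airyAi.continuousOn
      (⟨hs.le, h1⟩ : (0 : ℝ) ∈ Set.Icc _ _)
    exact hne c ⟨hx.1.trans hc.1, hc.2⟩ hc0
  · refine not_pos_of_airy_equation hasDerivAt_airyAi hasDerivAt_deriv_airyAi ha1 fun x hx => ?_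
    by_contra! hx0
    obtain ⟨c, hc, hc0⟩ := intermediate_value_Icc hx.2 continuous_airyAi.continuousOn
      (⟨hx0, hs.le⟩ : (0 : ℝ) ∈ Set.Icc _ _)
    exact hne c ⟨hx.1.trans hc.1, hc.2⟩ hc0

/-- Otherwise Ai would be strictly monotone on [x, ∞), starting from 0, and could not tend to 0. -/
theorem exists_deriv_airyAi_zero_gt {x : ℝ} (hx : airyAi x = 0) :
    ∃ y, deriv airyAi y = 0 ∧ x < y := by
  have hx0 := airyAi_zero_neg hx
  have hd0 : deriv (fun v => airyAi v) x ≠ 0 := deriv_airyAi_ne_zero hx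
  by_contra! h
  have hne : ∀ y, x < y → deriv airyAi y ≠ 0 := fun y hy h0 => absurd (h y h0) (not_le.2 hy)
  have hlim := tendsto_airyAi
  rcases hasDerivWithinAt_forall_lt_or_forall_gt_of_forall_ne (convex_Ioi x)
    (fun y _ => (hasDerivAt_airyAi y).hasDerivWithinAt) (m := 0) (fun y hy => hne y hy) with hs | hs
  · have hanti : StrictAntiOn airyAi (Set.Ici x) := by
      refine strictAntiOn_of_deriv_neg (convex_Ici x) continuous_airyAi.continuousOn fun y hy => ?_
      rw [interior_Ici] at hy
      exact hs y hy
    have h1 : airyAi (x + 1) < 0 := by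
      rw [← hx]; exact hanti (le_refl x : x ≤ x) (by simp) (lt_add_one x)
    have h2 : (0 : ℝ) ≤ airyAi (x + 1) := by
      refine le_of_tendsto hlim ?_
      filter_upwards [eventually_ge_atTop (x + 1)] with y hy
      exact hanti.antitoneOn (by simp) (by simp only [Set.mem_Ici]; linarith) hy
    linarith
  · have hmono : StrictMonoOn airyAi (Set.Ici x) := by
      refine strictMonoOn_of_deriv_pos (convex_Ici x) continuous_airyAi.continuousOn fun y hy => ?_
      rw [interior_Ici] at hy
      exact hs y hy
    have h1 : 0 < airyAi (x + 1) := by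
      rw [← hx]; exact hmono (le_refl x : x ≤ x) (by simp) (lt_add_one x)
    have h2 : airyAi (x + 1) ≤ 0 := by
      refine ge_of_tendsto hlim ?_
      filter_upwards [eventually_ge_atTop (x + 1)] with y hy
      exact hmono.monotoneOn (by simp) (by simp only [Set.mem_Ici]; linarith) hy
    linarith

/-- The zeros of `Ai Ai'`. -/
def airyZeros : Set ℝ := {x | airyAi x = 0 ∨ deriv airyAi x = 0}

theorem finite_airyAi_zeros (z : ℝ) : ({x | airyAi x = 0} ∩ Set.Ici z).Finite :=
  finite_zeros_inter_Ici hasDerivAt_airyAi (fun _ => deriv_airyAi_ne_zero)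
    (fun _ => airyAi_zero_neg) z

theorem finite_deriv_airyAi_zeros (z : ℝ) : ({x | deriv airyAi x = 0} ∩ Set.Ici z).Finite :=
  finite_zeros_inter_Ici hasDerivAt_deriv_airyAi (fun _ => mul_airyAi_ne_zero)
    (fun _ => deriv_airyAi_zero_neg) z

theorem airyZeros_inter (z : ℝ) : airyZeros ∩ Set.Ici z =
    ({x | airyAi x = 0} ∩ Set.Ici z) ∪ ({x | deriv airyAi x = 0} ∩ Set.Ici z) := by
  rw [← Set.union_inter_distrib_right]; rfl

theorem finite_airyZeros (z : ℝ) : (airyZeros ∩ Set.Ici z).Finite := by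
  rw [airyZeros_inter]
  exact (finite_airyAi_zeros z).union (finite_deriv_airyAi_zeros z)

theorem airyZeros_encard (z : ℝ) : (airyZeros ∩ Set.Ici z).encard =
    ({x | airyAi x = 0} ∩ Set.Ici z).encard + ({x | deriv airyAi x = 0} ∩ Set.Ici z).encard := by
  rw [airyZeros_inter, Set.encard_union_eq]
  exact Set.disjoint_left.2 fun x hx hx' => deriv_airyAi_ne_zero hx.1 hx'.1

/-- Rolle's theorem for Ai and for Ai', with Ai'' = x Ai and x ≠ 0 at the points concerned, gives
the interlacing. Hence [z_{Ai',j}, ∞) contains j zeros of Ai' and j - 1 of Ai, and [z_{Ai,j}, ∞)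
contains j of each. -/
theorem airy_zeros_spec (j : ℕ) (hj : 1 ≤ j) :
    IsNthZero (deriv airyAi) j (zAi' j) ∧ IsNthZero airyAi j (zAi j) ∧
      (airyZeros ∩ Set.Ici (zAi' j)).encard = (2 * j - 1 : ℕ) ∧
      (airyZeros ∩ Set.Ici (zAi j)).encard = (2 * j : ℕ) := by
  obtain ⟨i, rfl⟩ := Nat.exists_eq_add_of_le' hj
  obtain ⟨z', z, hz', hz, h1, h2, h3, h4⟩ := exists_interlacing finite_airyAi_zeros
    finite_deriv_airyAi_zeros exists_airyAi_zero_lt (fun _ => airyAi_zero_neg)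
    (fun _ => deriv_airyAi_zero_neg)
    (fun x hx y hy hxy => by
      obtain ⟨c, hc, hc0⟩ := exists_hasDerivAt_eq_zero hxy continuous_airyAi.continuousOn
        (show airyAi x = airyAi y from Eq.trans hx (Eq.symm hy)) fun t _ => hasDerivAt_airyAi t
      exact ⟨c, hc0, hc.1, hc.2⟩)
    (fun x hx y hy hxy => by
      obtain ⟨c, hc, hc0⟩ := exists_hasDerivAt_eq_zero hxy continuous_deriv_airyAi.continuousOn
        (show deriv airyAi x = deriv airyAi y from Eq.trans hx (Eq.symm hy))
        fun t _ => hasDerivAt_deriv_airyAi t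
      refine ⟨c, (mul_eq_zero.1 hc0).resolve_left ?_, hc.1, hc.2⟩
      exact (hc.2.trans (deriv_airyAi_zero_neg hy)).ne)
    (fun x hx => exists_deriv_airyAi_zero_gt hx) i
  have hZ' : IsNthZero (deriv airyAi) (i + 1) z' := ⟨hz', h1⟩
  have hZ : IsNthZero airyAi (i + 1) z := ⟨hz, h3⟩
  rw [zAi', zAi, nthZero_eq hZ', nthZero_eq hZ]
  refine ⟨hZ', hZ, ?_, ?_⟩
  · rw [airyZeros_encard, h1, h2, ← Nat.cast_add]
    congr 1; omega
  · rw [airyZeros_encard, h3, h4, ← Nat.cast_add]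
    congr 1; omega

/-! ### The rescaled oscillator: shooting solutions, decay and growth. -/

/-- The potential minus the energy, `|v| + e v² - l`, for `p = (l, e)`. -/
def oscPot (p : ℝ × ℝ) (v : ℝ) : ℝ := |v| + p.2 * v ^ 2 - p.1

theorem continuous_oscPot (p : ℝ × ℝ) : Continuous (oscPot p) := by
  unfold oscPot; fun_prop

theorem exists_oscSol (a c : ℝ) : ∃ X : (ℝ × ℝ) × ℝ → ℝ × ℝ, Continuous X ∧
    (∀ p, X (p, 0) = (a, c)) ∧
    ∀ p v, HasDerivAt (fun v => X (p, v)) ((X (p, v)).2, oscPot p v * (X (p, v)).1) v := by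
  obtain ⟨X, h1, h2, h3⟩ := exists_linear_ode_solution (P := ℝ × ℝ) (E := ℝ × ℝ)
    (A := fun q => (ContinuousLinearMap.inl ℝ ℝ ℝ).comp (ContinuousLinearMap.snd ℝ ℝ ℝ) +
      oscPot q.1 q.2 • (ContinuousLinearMap.inr ℝ ℝ ℝ).comp (ContinuousLinearMap.fst ℝ ℝ ℝ))
    (by unfold oscPot; fun_prop) (a, c)
  refine ⟨X, h1, h2, fun p v => (h3 p v).congr_deriv ?_⟩
  simp

/-- The solution of `u'' = (|v| + e v² - l) u` with `u(0) = a`, `u'(0) = c`, together with its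
derivative, as a function of `((l, e), v)`. -/
def oscSol (a c : ℝ) : (ℝ × ℝ) × ℝ → ℝ × ℝ := (exists_oscSol a c).choose

/-- The solution of `u'' = (|v| + e v² - l) u` with `u(0) = a`, `u'(0) = c`; `p = (l, e)`. -/
def oscU (a c : ℝ) (p : ℝ × ℝ) (v : ℝ) : ℝ := (oscSol a c (p, v)).1

/-- The derivative of `oscU`. -/
def oscW (a c : ℝ) (p : ℝ × ℝ) (v : ℝ) : ℝ := (oscSol a c (p, v)).2

section Solution

variable (a c : ℝ) (p : ℝ × ℝ)

theorem continuous_oscU : Continuous fun q : (ℝ × ℝ) × ℝ => oscU a c q.1 q.2 :=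
  continuous_fst.comp (exists_oscSol a c).choose_spec.1

theorem continuous_oscW : Continuous fun q : (ℝ × ℝ) × ℝ => oscW a c q.1 q.2 :=
  continuous_snd.comp (exists_oscSol a c).choose_spec.1

theorem oscU_zero : oscU a c p 0 = a :=
  congrArg Prod.fst ((exists_oscSol a c).choose_spec.2.1 p)

theorem oscW_zero : oscW a c p 0 = c :=
  congrArg Prod.snd ((exists_oscSol a c).choose_spec.2.1 p)

theorem hasDerivAt_oscU (v : ℝ) : HasDerivAt (oscU a c p) (oscW a c p v) v :=
  ((exists_oscSol a c).choose_spec.2.2 p v).fst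

theorem hasDerivAt_oscW (v : ℝ) : HasDerivAt (oscW a c p) (oscPot p v * oscU a c p v) v :=
  ((exists_oscSol a c).choose_spec.2.2 p v).snd

theorem solvesOn_osc : SolvesOn (oscPot p) (oscU a c p) (oscW a c p) :=
  ⟨fun v _ => hasDerivAt_oscU a c p v, fun v _ => hasDerivAt_oscW a c p v⟩

end Solution

/-- `u` and `u'` have opposite signs in the classically forbidden region, that is, the solution with
initial data `(a, c)` decays at infinity. -/
def OscEigen (a c : ℝ) (p : ℝ × ℝ) : Prop :=
  ∀ v, max 0 (p.1 + 1) ≤ v → oscU a c p v * oscW a c p v ≤ 0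

/-- The solution with initial data `(a, c)` eventually grows, with the sign of `s`. -/
def OscGrows (s a c : ℝ) (p : ℝ × ℝ) : Prop :=
  ∃ v, max 0 (p.1 + 1) ≤ v ∧ 0 < s * oscU a c p v ∧ 0 < s * oscW a c p v

theorem one_le_oscPot {p : ℝ × ℝ} (hp : 0 ≤ p.2) {v : ℝ} (hv : max 0 (p.1 + 1) ≤ v) :
    1 ≤ oscPot p v := by
  have h0 := (le_max_left _ _).trans hv
  have h1 := (le_max_right _ _).trans hv
  have : 0 ≤ p.2 * v ^ 2 := by positivity
  rw [oscPot, abs_of_nonneg h0]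
  linarith

section

variable {s a c : ℝ} {p q : ℝ × ℝ}

theorem OscEigen.exists_abs_le_exp (h : OscEigen a c p) (hp : 0 ≤ p.2) :
    ∃ C, ∀ v, 0 ≤ v → |oscU a c p v| ≤ C * Real.exp (-v / 2) :=
  (solvesOn_osc a c p).exists_abs_le_exp (le_max_left _ _) (fun _ => one_le_oscPot hp) h

theorem OscEigen.tendsto_oscW (h : OscEigen a c p) (hp : 0 ≤ p.2) :
    Tendsto (oscW a c p) atTop (nhds 0) :=
  (solvesOn_osc a c p).tendsto_snd (le_max_left _ _) (fun _ => one_le_oscPot hp) h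

theorem OscEigen.tendsto_oscU (h : OscEigen a c p) (hp : 0 ≤ p.2) :
    Tendsto (oscU a c p) atTop (nhds 0) := by
  obtain ⟨C, hC⟩ := h.exists_abs_le_exp hp
  exact tendsto_zero_of_abs_le_exp hC

theorem oscEigen_of_integrableOn (hp : 0 ≤ p.2)
    (hi : IntegrableOn (fun v => oscU a c p v ^ 2) (Set.Ioi 0)) : OscEigen a c p := fun _ hv =>
  (solvesOn_osc a c p).mul_nonpos_of_integrable (le_max_left _ _)
    (fun _ hv => zero_le_one.trans (one_le_oscPot hp hv)) hi hv

theorem OscEigen.integrableOn_pow_mul (h : OscEigen a c p) (hp : 0 ≤ p.2) (h' : OscEigen a c q)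
    (hq : 0 ≤ q.2) (n : ℕ) :
    IntegrableOn (fun v => v ^ n * (oscU a c p v * oscU a c q v)) (Set.Ioi 0) := by
  obtain ⟨C, hC⟩ := h.exists_abs_le_exp hp
  obtain ⟨C', hC'⟩ := h'.exists_abs_le_exp hq
  exact integrableOn_pow_mul_mul n (solvesOn_osc a c p).continuousOn
    (solvesOn_osc a c q).continuousOn hC hC'

/-- The Wronskian of two solutions with the same data vanishes at 0 and, by decay, at infinity, so
its derivative has integral zero. For equal couplings this is orthogonality; for q = (l₀, 0) it is
an exact form of first-order perturbation theory. -/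
theorem OscEigen.integral_identity (h : OscEigen a c p) (hp : 0 ≤ p.2) (h' : OscEigen a c q)
    (hq : 0 ≤ q.2) :
    (q.1 - p.1) * (∫ v in Set.Ioi 0, v ^ 0 * (oscU a c p v * oscU a c q v)) =
      (q.2 - p.2) * ∫ v in Set.Ioi 0, v ^ 2 * (oscU a c p v * oscU a c q v) := by
  have hi0 := (h.integrableOn_pow_mul hp h' hq 0).const_mul (q.1 - p.1)
  have hi2 := (h.integrableOn_pow_mul hp h' hq 2).const_mul (q.2 - p.2)
  have hW : Tendsto (fun v => oscU a c p v * oscW a c q v - oscW a c p v * oscU a c q v) atTop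
      (nhds 0) := by
    simpa using ((h.tendsto_oscU hp).mul (h'.tendsto_oscW hq)).sub
      ((h.tendsto_oscW hp).mul (h'.tendsto_oscU hq))
  have hder : ∀ v ∈ Set.Ici (0 : ℝ), HasDerivAt
      (fun v => oscU a c p v * oscW a c q v - oscW a c p v * oscU a c q v)
      ((q.2 - p.2) * (v ^ 2 * (oscU a c p v * oscU a c q v)) -
        (q.1 - p.1) * (v ^ 0 * (oscU a c p v * oscU a c q v))) v := fun v hv => by
    refine ((solvesOn_osc a c p).hasDerivAt_wronskian (solvesOn_osc a c q) hv).congr_deriv ?_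
    simp only [oscPot]; ring
  have := integral_Ioi_of_hasDerivAt_of_tendsto' hder (hi2.sub hi0) hW
  rw [integral_sub hi2 hi0, integral_const_mul, integral_const_mul, oscU_zero, oscW_zero,
    oscU_zero, oscW_zero] at this
  linarith

/-- Since u u' stays positive, u has no further zero and both signs are frozen. -/
theorem OscGrows.eventually (hs : s ≠ 0) (h : OscGrows s a c p) (hp : 0 ≤ p.2) :
    ∃ v₁, ∀ v, v₁ ≤ v → max 0 (p.1 + 1) ≤ v ∧ 0 < s * oscU a c p v ∧ 0 < s * oscW a c p v := by
  obtain ⟨v₁, hv₁, hu, hw⟩ := h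
  have hs2 : 0 < s ^ 2 := by positivity
  have hsol := solvesOn_osc a c p
  have hm := hsol.monotoneOn_mul (le_max_left _ _)
    fun _ hv => zero_le_one.trans (one_le_oscPot hp hv)
  have hpos : ∀ v, v₁ ≤ v → 0 < (s * oscU a c p v) * (s * oscW a c p v) := fun v hv => by
    have h1 : 0 < (s * oscU a c p v₁) * (s * oscW a c p v₁) := mul_pos hu hw
    have h2 := mul_le_mul_of_nonneg_left (hm hv₁ (hv₁.trans hv : max 0 (p.1 + 1) ≤ v) hv) hs2.le
    simp only at h2
    nlinarith
  have hupos : ∀ v, v₁ ≤ v → 0 < s * oscU a c p v := fun v hv => by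
    by_contra! hle
    have hc : ContinuousOn (fun v => s * oscU a c p v) (Set.Icc v₁ v) := fun x _ =>
      ((hasDerivAt_oscU a c p x).continuousAt.const_mul s).continuousWithinAt
    obtain ⟨x, hx, hx0⟩ := intermediate_value_Icc' hv hc (⟨hle, hu.le⟩ : (0 : ℝ) ∈ Set.Icc _ _)
    have := hpos x hx.1
    simp only at hx0
    rw [hx0, zero_mul] at this
    exact lt_irrefl _ this
  exact ⟨v₁, fun v hv => ⟨hv₁.trans hv, hupos v hv, (pos_iff_pos_of_mul_pos (hpos v hv)).1
    (hupos v hv)⟩⟩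

theorem OscGrows.not_neg (hs : s ≠ 0) (h : OscGrows s a c p) (hp : 0 ≤ p.2) :
    ¬ OscGrows (-s) a c p := fun h' => by
  obtain ⟨v₁, hv₁⟩ := h.eventually hs hp
  obtain ⟨v₂, hv₂⟩ := h'.eventually (neg_ne_zero.2 hs) hp
  have h1 := (hv₁ _ (le_max_left v₁ v₂)).2.1
  have h2 := (hv₂ _ (le_max_right v₁ v₂)).2.1
  linarith

theorem OscGrows.eventually_nhds (hs : s ≠ 0) (h : OscGrows s a c p) (hp : 0 ≤ p.2) :
    ∀ᶠ q in nhds p, OscGrows s a c q := by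
  obtain ⟨v₁, hv₁⟩ := h.eventually hs hp
  -- Going to l + 2, beyond the threshold l + 1, leaves room for the thresholds of nearby
  -- parameters.
  set v := max v₁ (max 0 (p.1 + 2)) with hv
  obtain ⟨-, hu, hw⟩ := hv₁ v (le_max_left _ _)
  have hcu : Continuous fun q : ℝ × ℝ => s * oscU a c q v :=
    ((continuous_oscU a c).comp (continuous_id.prodMk continuous_const)).const_mul s
  have hcw : Continuous fun q : ℝ × ℝ => s * oscW a c q v :=
    ((continuous_oscW a c).comp (continuous_id.prodMk continuous_const)).const_mul s
  have hvp : p.1 + 1 < v := by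
    have : p.1 + 2 ≤ v := (le_max_right _ _).trans (le_max_right _ _)
    linarith
  have hcf : Continuous fun q : ℝ × ℝ => q.1 + 1 := by fun_prop
  filter_upwards [hcu.continuousAt.eventually_const_lt hu, hcw.continuousAt.eventually_const_lt hw,
    hcf.continuousAt.eventually_lt_const hvp] with q h1 h2 h3
  exact ⟨v, max_le ((le_max_left _ _).trans (le_max_right _ _)) h3.le, h1, h2⟩

theorem OscGrows.not_oscEigen (h : OscGrows s a c p) : ¬ OscEigen a c p := fun h' => by
  obtain ⟨v, hv, hu, hw⟩ := h
  have h1 := h' v hv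
  have h2 := mul_pos hu hw
  nlinarith [sq_nonneg s]

theorem oscGrows_of_not_oscEigen (h : ¬ OscEigen a c p) : OscGrows 1 a c p ∨ OscGrows (-1) a c p := by
  simp only [OscEigen, not_forall, not_le] at h
  obtain ⟨v, hv, hpos⟩ := h
  rcases pos_and_pos_or_neg_and_neg_of_mul_pos hpos with h | h
  · exact Or.inl ⟨v, hv, by linarith [h.1], by linarith [h.2]⟩
  · exact Or.inr ⟨v, hv, by linarith [h.1], by linarith [h.2]⟩

theorem eventually_not_oscEigen (h : ¬ OscEigen a c p) (hp : 0 ≤ p.2) :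
    ∀ᶠ q in nhds p, ¬ OscEigen a c q := by
  rcases oscGrows_of_not_oscEigen h with h | h
  · exact (h.eventually_nhds one_ne_zero hp).mono fun q hq => hq.not_oscEigen
  · exact (h.eventually_nhds (by norm_num) hp).mono fun q hq => hq.not_oscEigen

/-- For l ≤ 0 the product u u' is nondecreasing on [0, ∞), starts at a c = 0 and is eventually
nonpositive. It is then identically zero, which forces u = 0 and contradicts the initial data. -/
theorem OscEigen.energy_pos (h : OscEigen a c p) (hp : 0 ≤ p.2) (hac : a * c = 0)
    (hne : a ≠ 0 ∨ c ≠ 0) : 0 < p.1 := by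
  by_contra! hp1
  have hsol := solvesOn_osc a c p
  have hQ : ∀ v, 0 < v → 0 < oscPot p v := fun v hv => by
    have : 0 ≤ p.2 * v ^ 2 := by positivity
    rw [oscPot, abs_of_pos hv]; linarith
  have hm := hsol.monotoneOn_mul le_rfl (fun v hv => by
    rcases hv.eq_or_lt with rfl | hv
    · simpa [oscPot] using hp1
    · exact (hQ v hv).le)
  have h0 : ∀ v, 0 ≤ v → oscU a c p v * oscW a c p v = 0 := fun v hv => by
    refine le_antisymm ?_ ?_
    · refine (hm hv ?_ (le_max_left v (max 0 (p.1 + 1)))).trans (h _ (le_max_right _ _))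
      exact hv.trans (le_max_left _ _)
    · have := hm (le_refl 0 : (0 : ℝ) ≤ 0) hv hv
      simpa only [oscU_zero, oscW_zero, hac] using this
  have h1 : ∀ v, 0 < v → oscU a c p v = 0 ∧ oscW a c p v = 0 := fun v hv => by
    have hd : HasDerivAt (fun v => oscU a c p v * oscW a c p v) 0 v := by
      refine (hasDerivAt_const v (0 : ℝ)).congr_of_eventuallyEq ?_
      filter_upwards [Ioi_mem_nhds hv] with x hx using h0 x (le_of_lt hx)
    have he := (hsol.hasDerivAt_mul hv.le).unique hd
    have hw := sq_nonneg (oscW a c p v)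
    have hu : 0 ≤ oscPot p v * oscU a c p v ^ 2 := mul_nonneg (hQ v hv).le (sq_nonneg _)
    have hu0 : oscPot p v * oscU a c p v ^ 2 = 0 := by linarith
    refine ⟨pow_eq_zero_iff two_ne_zero |>.1 ((mul_eq_zero.1 hu0).resolve_left (hQ v hv).ne'),
      pow_eq_zero_iff two_ne_zero |>.1 (by linarith)⟩
  have hlim : ∀ f : ℝ → ℝ, ContinuousAt f 0 → (∀ v, 0 < v → f v = 0) → f 0 = 0 := fun f hf hv => by
    refine tendsto_nhds_unique (hf.tendsto.mono_left nhdsWithin_le_nhds :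
      Tendsto f (nhdsWithin 0 (Set.Ioi 0)) _) ?_
    refine tendsto_const_nhds.congr' ?_
    filter_upwards [self_mem_nhdsWithin] with v hv' using (hv v hv').symm
  have ha := hlim _ (hasDerivAt_oscU a c p 0).continuousAt fun v hv => (h1 v hv).1
  have hc := hlim _ (hasDerivAt_oscW a c p 0).continuousAt fun v hv => (h1 v hv).2
  rw [oscU_zero] at ha
  rw [oscW_zero] at hc
  tauto

end

/-! ### The unperturbed problem: the Airy boundary function. -/

theorem setIntegral_Ioi_pos {f : ℝ → ℝ} (hc : ContinuousOn f (Set.Ioi 0))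
    (hnn : ∀ x, 0 < x → 0 ≤ f x) (hi : IntegrableOn f (Set.Ioi 0)) {x₀ : ℝ} (hx₀ : 0 < x₀)
    (hpos : 0 < f x₀) : 0 < ∫ x in Set.Ioi 0, f x := by
  rw [setIntegral_pos_iff_support_of_nonneg_ae _ hi]
  · have hev : ∀ᶠ x in nhds x₀, x ∈ Function.support f ∩ Set.Ioi 0 := by
      filter_upwards [(hc.continuousAt (Ioi_mem_nhds hx₀)).eventually_const_lt hpos,
        Ioi_mem_nhds hx₀] with x h1 h2
      exact ⟨h1.ne', h2⟩
    exact Measure.measure_pos_of_mem_nhds volume hev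
  · filter_upwards [ae_restrict_mem measurableSet_Ioi] with x hx using hnn x hx

/-- The boundary function of the Airy operator on the half line. -/
def airyBdry (a c l : ℝ) : ℝ := a * deriv airyAi (-l) - c * airyAi (-l)

theorem solvesOn_airy_oscPot (l : ℝ) :
    SolvesOn (oscPot (l, 0)) (fun v => airyAi (v + -l)) fun v => deriv airyAi (v + -l) := by
  have h := solvesOn_airyAi_shift (-l)
  refine ⟨h.fst, fun v hv => (h.snd v hv).congr_deriv ?_⟩
  simp [oscPot, abs_of_nonneg hv, sub_eq_add_neg]

theorem airy_wronskian_eq (a c l : ℝ) {v : ℝ} (hv : 0 ≤ v) :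
    oscU a c (l, 0) v * deriv airyAi (v + -l) - oscW a c (l, 0) v * airyAi (v + -l) =
      airyBdry a c l := by
  have hd : ∀ x, 0 ≤ x → HasDerivAt (fun v => oscU a c (l, 0) v * deriv airyAi (v + -l) -
      oscW a c (l, 0) v * airyAi (v + -l)) 0 x := fun x hx =>
    ((solvesOn_osc a c (l, 0)).hasDerivAt_wronskian (solvesOn_airy_oscPot l) hx).congr_deriv
      (by ring)
  have := constant_of_has_deriv_right_zero (a := 0) (b := v)
    (fun x hx => (hd x hx.1).continuousAt.continuousWithinAt)
    (fun x hx => (hd x hx.1).hasDerivWithinAt) v ⟨hv, le_rfl⟩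
  simp only [oscU_zero, oscW_zero, zero_add] at this
  exact this

theorem airyBdry_eq_zero_of_oscEigen {a c l : ℝ} (h : OscEigen a c (l, 0)) :
    airyBdry a c l = 0 := by
  have hlim : Tendsto (fun v => oscU a c (l, 0) v * deriv airyAi (v + -l) -
      oscW a c (l, 0) v * airyAi (v + -l)) atTop (nhds 0) := by
    have ht : Tendsto (fun v : ℝ => v + -l) atTop atTop :=
      tendsto_atTop_add_const_right _ _ tendsto_id
    simpa using ((h.tendsto_oscU le_rfl).mul (tendsto_deriv_airyAi.comp ht)).sub
      ((h.tendsto_oscW le_rfl).mul (tendsto_airyAi.comp ht))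
  refine tendsto_nhds_unique (tendsto_const_nhds.congr' ?_) hlim
  filter_upwards [eventually_ge_atTop 0] with v hv using (airy_wronskian_eq a c l hv).symm

theorem exists_airyAi_eq_mul_oscU {a c l : ℝ} (hne : a ≠ 0 ∨ c ≠ 0) (h : airyBdry a c l = 0) :
    ∃ t, t ≠ 0 ∧ airyAi (-l) = t * a ∧ deriv airyAi (-l) = t * c ∧
      ∀ v, 0 ≤ v → airyAi (v + -l) = t * oscU a c (l, 0) v := by
  have hpos : 0 < a ^ 2 + c ^ 2 := by
    rcases hne with h | h <;> positivity
  have hb : a * deriv airyAi (-l) = c * airyAi (-l) := sub_eq_zero.1 h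
  -- The vanishing boundary function says that (Ai(-l), Ai'(-l)) is parallel to (a, c); t is the
  -- coefficient of the orthogonal projection.
  set t := (a * airyAi (-l) + c * deriv airyAi (-l)) / (a ^ 2 + c ^ 2) with ht
  have h1 : airyAi (-l) = t * a := by
    rw [ht, div_mul_eq_mul_div, eq_div_iff hpos.ne']
    linear_combination (-c) * hb
  have h2 : deriv airyAi (-l) = t * c := by
    rw [ht, div_mul_eq_mul_div, eq_div_iff hpos.ne']
    linear_combination a * hb
  refine ⟨t, fun h0 => ?_, h1, h2, fun v hv => ?_⟩
  · rw [h0, zero_mul] at h1 h2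
    rcases airyAi_or_deriv_ne_zero (-l) with h | h
    · exact h h1
    · exact h h2
  · refine SolvesOn.eq_of_initial (continuous_oscPot (l, 0)) (solvesOn_airy_oscPot l)
      ((solvesOn_osc a c (l, 0)).const_mul t) ?_ ?_ hv
    · rw [oscU_zero, zero_add, h1]
    · rw [oscW_zero, zero_add, h2]

theorem integrableOn_pow_mul_airyAi_sq (n : ℕ) (z : ℝ) :
    IntegrableOn (fun v => v ^ n * (airyAi (v + z) * airyAi (v + z))) (Set.Ioi 0) := by
  obtain ⟨C, hC⟩ := exists_abs_airyAi_shift_le z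
  have hc : ContinuousOn (fun v => airyAi (v + z)) (Set.Ici 0) :=
    (solvesOn_airyAi_shift z).continuousOn
  exact integrableOn_pow_mul_mul n hc hc hC hC

theorem oscEigen_zero_iff {a c l : ℝ} (hne : a ≠ 0 ∨ c ≠ 0) :
    OscEigen a c (l, 0) ↔ airyBdry a c l = 0 := by
  refine ⟨airyBdry_eq_zero_of_oscEigen, fun h => oscEigen_of_integrableOn le_rfl ?_⟩
  obtain ⟨t, ht, -, -, hu⟩ := exists_airyAi_eq_mul_oscU hne h
  refine IntegrableOn.congr_fun (f := fun v => t⁻¹ ^ 2 * (v ^ 0 * (airyAi (v + -l) *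
    airyAi (v + -l)))) ((integrableOn_pow_mul_airyAi_sq 0 (-l)).const_mul _)
    (fun v hv => ?_) measurableSet_Ioi
  simp only [hu v (le_of_lt hv)]
  field_simp

theorem airyAi_zero_mul_pos {x : ℝ} (hx : 0 ≤ x) : 0 < airyAi 0 * airyAi x := by
  have h0 := airyAi_ne_zero_of_nonneg le_rfl
  by_contra! hle
  have hc : ContinuousOn (fun x => airyAi 0 * airyAi x) (Set.Icc 0 x) :=
    (continuous_const.mul continuous_airyAi).continuousOn
  obtain ⟨y, hy, hy0⟩ := intermediate_value_Icc' hx hc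
    (⟨hle, mul_self_nonneg _⟩ : (0 : ℝ) ∈ Set.Icc _ _)
  exact (mul_ne_zero h0 (airyAi_ne_zero_of_nonneg hy.1)) hy0

/-- Far out, u and u' have the sign of s while Ai and Ai' have opposite signs, so the constant
Wronskian reveals the direction of growth. The factor Ai(0) normalizes the sign of Ai, which need
not be known. -/
theorem OscGrows.mul_airyBdry_neg {s a c l : ℝ} (hs : s ≠ 0) (h : OscGrows s a c (l, 0)) :
    s * (airyAi 0 * airyBdry a c l) < 0 := by
  obtain ⟨v₁, hv₁⟩ := h.eventually hs le_rfl
  set v := max v₁ (max 0 l) with hv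
  have hv0 : 0 ≤ v := (le_max_left _ _).trans (le_max_right _ _)
  have hvl : 0 ≤ v + -l := by linarith [(le_max_right 0 l).trans (le_max_right v₁ (max 0 l))]
  obtain ⟨-, hu, hw⟩ := hv₁ v (le_max_left _ _)
  have h1 := airyAi_zero_mul_pos hvl
  have h2 : airyAi 0 * deriv airyAi (v + -l) < 0 := by
    by_contra! hge
    have h3 := mul_nonneg h1.le hge
    have h4 := airyAi_mul_deriv_neg hvl
    have h5 : 0 < airyAi 0 ^ 2 := by
      have := airyAi_ne_zero_of_nonneg (le_refl 0)
      positivity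
    nlinarith
  rw [← airy_wronskian_eq a c l hv0]
  nlinarith [mul_pos hu (neg_pos.2 h2), mul_pos hw h1]

/-! ### Limits of integrals as the coupling vanishes, and moments. -/

section Convergence

variable {a c : ℝ}

/-- Eigenfunctions near p₀ share one decay bound, because their maxima on a fixed compact interval
are controlled by continuity and the forbidden region starts before a common v₀. This is the
domination needed for limits of integrals. -/
theorem eventually_abs_oscU_le (a c : ℝ) (p₀ : ℝ × ℝ) :
    ∃ C, ∀ᶠ q in nhds p₀, 0 ≤ q.2 → OscEigen a c q →
      ∀ v, 0 ≤ v → |oscU a c q v| ≤ C * Real.exp (-v / 2) := by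
  set v₀ := max 0 (p₀.1 + 2) with hv₀
  have hv₀0 : 0 ≤ v₀ := le_max_left _ _
  obtain ⟨B, hB⟩ := (isCompact_Icc (a := (0 : ℝ)) (b := v₀)).exists_bound_of_continuousOn
    ((solvesOn_osc a c p₀).continuousOn.mono Set.Icc_subset_Ici_self)
  have hunif : ∀ᶠ q in nhds p₀, ∀ v ∈ Set.Icc 0 v₀, |oscU a c q v| < B + 1 := by
    refine isCompact_Icc.eventually_forall_of_forall_eventually fun v hv => ?_
    refine (continuous_oscU a c).abs.continuousAt.eventually_lt_const ?_
    exact (hB v hv).trans_lt (lt_add_one B)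
  have hcf : Continuous fun q : ℝ × ℝ => q.1 + 1 := by fun_prop
  have hl : p₀.1 + 1 < v₀ := by linarith [le_max_right 0 (p₀.1 + 2)]
  refine ⟨(B + 1) * Real.exp (v₀ / 2), ?_⟩
  filter_upwards [hunif, hcf.continuousAt.eventually_lt_const hl] with q h1 h2 hq he v hv
  have hle : max 0 (q.1 + 1) ≤ v₀ := max_le hv₀0 h2.le
  exact (solvesOn_osc a c q).abs_le_exp hv₀0 (fun x hx => one_le_oscPot hq (hle.trans hx))
    (fun x hx => he x (hle.trans hx)) (fun x hx => (h1 x hx).le) hv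

theorem tendsto_integral_oscU {ι : Type*} {L : Filter ι} [L.IsCountablyGenerated]
    {p q : ι → ℝ × ℝ} {p₀ : ℝ × ℝ} (hp : Tendsto p L (nhds p₀)) (hq : Tendsto q L (nhds p₀))
    (hpe : ∀ᶠ i in L, 0 ≤ (p i).2 ∧ OscEigen a c (p i))
    (hqe : ∀ᶠ i in L, 0 ≤ (q i).2 ∧ OscEigen a c (q i)) (n : ℕ) :
    Tendsto (fun i => ∫ v in Set.Ioi 0, v ^ n * (oscU a c (p i) v * oscU a c (q i) v)) L
      (nhds (∫ v in Set.Ioi 0, v ^ n * (oscU a c p₀ v * oscU a c p₀ v))) := by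
  obtain ⟨C, hC⟩ := eventually_abs_oscU_le a c p₀
  refine tendsto_integral_filter_of_dominated_convergence
    (fun v => C * C * (v ^ n * Real.exp (-v))) ?_ ?_
    ((integrableOn_pow_mul_exp_neg n).const_mul (C * C)) ?_
  · refine Eventually.of_forall fun i => ContinuousOn.aestronglyMeasurable ?_ measurableSet_Ioi
    exact (((continuous_pow n).continuousOn).mul ((solvesOn_osc a c (p i)).continuousOn.mul
      (solvesOn_osc a c (q i)).continuousOn)).mono Set.Ioi_subset_Ici_self
  · filter_upwards [hp.eventually hC, hq.eventually hC, hpe, hqe] with i h1 h2 h3 h4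
    filter_upwards [ae_restrict_mem measurableSet_Ioi] with v hv
    exact abs_pow_mul_mul_le n (h1 h3.1 h3.2) (h2 h4.1 h4.2) (le_of_lt hv)
  · refine Eventually.of_forall fun v => ?_
    have hc : Tendsto (fun q => oscU a c q v) (nhds p₀) (nhds (oscU a c p₀ v)) :=
      ((continuous_oscU a c).comp (continuous_id.prodMk continuous_const)).tendsto p₀
    exact ((hc.comp hp).mul (hc.comp hq)).const_mul _

end Convergence

section Moments

variable {a c l : ℝ}

theorem oscU_ne_zero (hne : a ≠ 0 ∨ c ≠ 0) (h : OscEigen a c (l, 0)) {v : ℝ} (hv : 0 ≤ v)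
    (hvl : l ≤ v) : oscU a c (l, 0) v ≠ 0 := fun h0 => by
  obtain ⟨t, -, -, -, hu⟩ := exists_airyAi_eq_mul_oscU hne ((oscEigen_zero_iff hne).1 h)
  refine airyAi_ne_zero_of_nonneg (by linarith : 0 ≤ v + -l) ?_
  rw [hu v hv, h0, mul_zero]

/-- The moments of the square of the unperturbed solution. -/
def oscMoment (a c l : ℝ) (n : ℕ) : ℝ :=
  ∫ v in Set.Ioi 0, v ^ n * (oscU a c (l, 0) v * oscU a c (l, 0) v)

theorem oscMoment_zero_pos (hne : a ≠ 0 ∨ c ≠ 0) (h : OscEigen a c (l, 0)) :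
    0 < oscMoment a c l 0 := by
  have hu := (solvesOn_osc a c (l, 0)).continuousOn
  refine setIntegral_Ioi_pos (x₀ := max 0 l + 1)
    ((((continuous_pow 0).continuousOn).mul (hu.mul hu)).mono Set.Ioi_subset_Ici_self)
    (fun x _ => ?_) (h.integrableOn_pow_mul le_rfl h le_rfl 0)
    (by linarith [le_max_left 0 l]) ?_
  · rw [pow_zero, one_mul]; exact mul_self_nonneg _
  · have := oscU_ne_zero hne h (v := max 0 l + 1) (by linarith [le_max_left 0 l])
      (by linarith [le_max_right 0 l])
    rw [pow_zero, one_mul]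
    exact mul_self_pos.2 this

/-- With m the mean of v², the variance ∫(v² - m)² u² equals the fourth moment minus m² times the
zeroth. It is positive since u² is not concentrated on v² = m. -/
theorem oscMoment_two_div_lt (hne : a ≠ 0 ∨ c ≠ 0) (h : OscEigen a c (l, 0)) :
    |oscMoment a c l 2 / oscMoment a c l 0| <
      Real.sqrt (oscMoment a c l 4 / oscMoment a c l 0) := by
  have hJ0 := oscMoment_zero_pos hne h
  set m := oscMoment a c l 2 / oscMoment a c l 0 with hm
  have hi := h.integrableOn_pow_mul le_rfl h le_rfl
  have hint : IntegrableOn (fun v => (v ^ 2 - m) ^ 2 * (oscU a c (l, 0) v * oscU a c (l, 0) v))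
      (Set.Ioi 0) := by
    refine IntegrableOn.congr_fun (((hi 4).sub ((hi 2).const_mul (2 * m))).add
      ((hi 0).const_mul (m ^ 2))) (fun v _ => ?_) measurableSet_Ioi
    simp only [Pi.add_apply, Pi.sub_apply]
    ring
  have hval : ∫ v in Set.Ioi 0, (v ^ 2 - m) ^ 2 * (oscU a c (l, 0) v * oscU a c (l, 0) v) =
      oscMoment a c l 4 - 2 * m * oscMoment a c l 2 + m ^ 2 * oscMoment a c l 0 := by
    have hi' : IntegrableOn (fun v => v ^ 4 * (oscU a c (l, 0) v * oscU a c (l, 0) v) -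
        2 * m * (v ^ 2 * (oscU a c (l, 0) v * oscU a c (l, 0) v))) (Set.Ioi 0) :=
      (hi 4).sub ((hi 2).const_mul _)
    rw [oscMoment, oscMoment, oscMoment, ← integral_const_mul, ← integral_const_mul,
      ← integral_sub (hi 4) ((hi 2).const_mul _), ← integral_add hi' ((hi 0).const_mul _)]
    refine integral_congr_ae (Eventually.of_forall fun v => ?_)
    ring
  set x₀ := max 0 l + |m| + 1 with hx₀
  have hx1 : 1 ≤ x₀ := by linarith [le_max_left 0 l, abs_nonneg m]
  have hxm : m < x₀ := by linarith [le_max_left 0 l, le_abs_self m]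
  have hpos : 0 < ∫ v in Set.Ioi 0, (v ^ 2 - m) ^ 2 *
      (oscU a c (l, 0) v * oscU a c (l, 0) v) := by
    have hu := (solvesOn_osc a c (l, 0)).continuousOn
    have hpoly : ContinuousOn (fun v : ℝ => (v ^ 2 - m) ^ 2) (Set.Ici 0) := by fun_prop
    refine setIntegral_Ioi_pos (x₀ := x₀) ((hpoly.mul (hu.mul hu)).mono Set.Ioi_subset_Ici_self)
      (fun x _ => mul_nonneg (sq_nonneg _) (mul_self_nonneg _)) hint (by linarith) ?_
    have h1 := oscU_ne_zero hne h (v := x₀) (by linarith)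
      (by linarith [le_max_right 0 l, abs_nonneg m])
    have h2 : 0 < x₀ ^ 2 - m := by nlinarith
    exact mul_pos (by positivity) (mul_self_pos.2 h1)
  rw [hval] at hpos
  have hm0 : oscMoment a c l 2 = m * oscMoment a c l 0 := by rw [hm, div_mul_cancel₀ _ hJ0.ne']
  rw [← Real.sqrt_sq_eq_abs]
  refine Real.sqrt_lt_sqrt (sq_nonneg _) ?_
  rw [lt_div_iff₀ hJ0]
  rw [hm0] at hpos
  linarith

theorem airyD_eq (hne : a ≠ 0 ∨ c ≠ 0) (h : OscEigen a c (l, 0)) :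
    airyD (-l) = Real.sqrt (oscMoment a c l 4 / oscMoment a c l 0) := by
  obtain ⟨t, ht, -, -, hu⟩ := exists_airyAi_eq_mul_oscU hne ((oscEigen_zero_iff hne).1 h)
  have h4 : ∫ v in Set.Ioi (0 : ℝ), v ^ 4 * airyAi (v + -l) ^ 2 = t ^ 2 * oscMoment a c l 4 := by
    rw [oscMoment, ← integral_const_mul]
    refine setIntegral_congr_fun measurableSet_Ioi fun v hv => ?_
    simp only [hu v (le_of_lt hv)]
    ring
  have h0 : airyC (-l) = t ^ 2 * oscMoment a c l 0 := by
    rw [airyC, oscMoment, ← integral_const_mul]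
    refine setIntegral_congr_fun measurableSet_Ioi fun v hv => ?_
    simp only [hu v (le_of_lt hv)]
    ring
  rw [airyD, h4, h0, mul_div_mul_left _ _ (pow_ne_zero 2 ht)]

end Moments

/-! ### Perturbation of a single eigenvalue. -/

section Perturbation

variable {a c l₀ : ℝ}

/-- A simple zero of the boundary function puts opposite directions of growth at two energies on
either side of l₀, and openness carries this to small e > 0. -/
theorem exists_oscEigen_near {F' : ℝ} (h₀ : airyBdry a c l₀ = 0)
    (hd : HasDerivAt (airyBdry a c) F' l₀) (hF' : F' ≠ 0) {r : ℝ} (hr : 0 < r) :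
    ∀ᶠ e in nhdsWithin 0 (Set.Ioi 0), ∃ l, |l - l₀| < r ∧ OscEigen a c (l, e) := by
  have hsign : ∃ l₁ l₂, l₁ < l₂ ∧ l₀ - r < l₁ ∧ l₂ < l₀ + r ∧
      airyBdry a c l₁ * airyBdry a c l₂ < 0 := by
    have key : ∀ f : ℝ → ℝ, f l₀ = 0 → 0 < deriv f l₀ → ∃ l₁ l₂, l₁ < l₂ ∧ l₀ - r < l₁ ∧
        l₂ < l₀ + r ∧ f l₁ < 0 ∧ 0 < f l₂ := fun f hf0 hf => by
      have hev := eventually_nhdsWithin_sign_eq_of_deriv_pos hf hf0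
      have h1 : ∀ᶠ x in nhdsWithin l₀ (Set.Iio l₀), f x < 0 ∧ l₀ - r < x := by
        filter_upwards [hev.filter_mono nhdsWithin_le_nhds, self_mem_nhdsWithin,
          Ioo_mem_nhdsLT (by linarith : l₀ - r < l₀)] with x h1 h2 h3
        refine ⟨?_, h3.1⟩
        rw [sign_neg (sub_neg.2 h2)] at h1
        exact sign_eq_neg_one_iff.1 h1
      have h2 : ∀ᶠ x in nhdsWithin l₀ (Set.Ioi l₀), 0 < f x ∧ x < l₀ + r := by
        filter_upwards [hev.filter_mono nhdsWithin_le_nhds, self_mem_nhdsWithin,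
          Ioo_mem_nhdsGT (by linarith : l₀ < l₀ + r)] with x h1 h2 h3
        refine ⟨?_, h3.2⟩
        rw [sign_pos (sub_pos.2 h2)] at h1
        exact sign_eq_one_iff.1 h1
      obtain ⟨l₁, h11, h12⟩ := (h1.and self_mem_nhdsWithin).exists
      obtain ⟨l₂, h21, h22⟩ := (h2.and self_mem_nhdsWithin).exists
      exact ⟨l₁, l₂, lt_trans h12 h22, h11.2, h21.2, h11.1, h21.1⟩
    rcases lt_or_gt_of_ne hF' with hs | hs
    · obtain ⟨l₁, l₂, h1, h2, h3, h4, h5⟩ := key (fun l => -airyBdry a c l) (by simp [h₀])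
        (by rw [show deriv (fun l => -airyBdry a c l) l₀ = -F' from hd.neg.deriv]; linarith)
      exact ⟨l₁, l₂, h1, h2, h3, by nlinarith⟩
    · obtain ⟨l₁, l₂, h1, h2, h3, h4, h5⟩ := key (airyBdry a c) h₀ (by rwa [hd.deriv])
      exact ⟨l₁, l₂, h1, h2, h3, by nlinarith⟩
  obtain ⟨l₁, l₂, hl, hl₁, hl₂, hneg⟩ := hsign
  have hA0 : 0 < airyAi 0 ^ 2 := by
    have := airyAi_ne_zero_of_nonneg (le_refl 0)
    positivity
  have hgrow : ∃ s : ℝ, s ≠ 0 ∧ OscGrows s a c (l₁, 0) ∧ OscGrows (-s) a c (l₂, 0) := by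
    have hn₁ : ¬ OscEigen a c (l₁, 0) := fun h => by
      rw [airyBdry_eq_zero_of_oscEigen h, zero_mul] at hneg
      exact lt_irrefl _ hneg
    have hn₂ : ¬ OscEigen a c (l₂, 0) := fun h => by
      rw [airyBdry_eq_zero_of_oscEigen h, mul_zero] at hneg
      exact lt_irrefl _ hneg
    have hlt : airyAi 0 * airyBdry a c l₁ * (airyAi 0 * airyBdry a c l₂) < 0 := by nlinarith
    rcases oscGrows_of_not_oscEigen hn₁ with g1 | g1 <;>
      rcases oscGrows_of_not_oscEigen hn₂ with g2 | g2 <;>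
      have e1 := g1.mul_airyBdry_neg (by norm_num) <;>
      have e2 := g2.mul_airyBdry_neg (by norm_num)
    · nlinarith
    · exact ⟨1, one_ne_zero, g1, g2⟩
    · exact ⟨-1, by norm_num, g1, by rwa [neg_neg]⟩
    · nlinarith
  obtain ⟨s, hs, g1, g2⟩ := hgrow
  have hslice : ∀ l : ℝ, Tendsto (fun e : ℝ => (l, e)) (nhdsWithin 0 (Set.Ioi 0)) (nhds (l, 0)) :=
    fun l => (Continuous.tendsto (by fun_prop) 0).mono_left nhdsWithin_le_nhds
  filter_upwards [(hslice l₁).eventually (g1.eventually_nhds hs le_rfl),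
    (hslice l₂).eventually (g2.eventually_nhds (neg_ne_zero.2 hs) le_rfl),
    self_mem_nhdsWithin] with e h1 h2 he
  have he0 : (0 : ℝ) ≤ e := le_of_lt he
  by_contra! hno
  -- Without an eigenvalue, [l₁, l₂] would be covered by two disjoint open sets of growing energies,
  -- both nonempty on it.
  have hopen : ∀ s : ℝ, s ≠ 0 → IsOpen {l : ℝ | OscGrows s a c (l, e)} := fun s hs =>
    isOpen_iff_mem_nhds.2 fun l hl => by
      have hc : Continuous fun l : ℝ => (l, e) := by fun_prop
      exact hc.continuousAt.eventually (OscGrows.eventually_nhds hs hl he0)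
  obtain ⟨l, -, hl1, hl2⟩ := (isPreconnected_Icc (a := l₁) (b := l₂)) _ _ (hopen s hs)
    (hopen (-s) (neg_ne_zero.2 hs)) (fun l hl' => by
      have hn := hno l (abs_lt.2 ⟨by linarith [hl'.1], by linarith [hl'.2]⟩)
      simp only [OscEigen, not_forall, not_le] at hn
      obtain ⟨v, hv, hpos⟩ := hn
      have hs2 : 0 < (s * oscU a c (l, e) v) * (s * oscW a c (l, e) v) := by
        have : 0 < s ^ 2 := by positivity
        nlinarith
      rcases pos_and_pos_or_neg_and_neg_of_mul_pos hs2 with h | h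
      · exact Or.inl ⟨v, hv, h.1, h.2⟩
      · exact Or.inr ⟨v, hv, by linarith [h.1], by linarith [h.2]⟩)
    ⟨l₁, ⟨le_rfl, hl.le⟩, h1⟩ ⟨l₂, ⟨hl.le, le_rfl⟩, h2⟩
  exact OscGrows.not_neg hs hl1 he0 hl2

theorem eventually_integral_oscU_pos (hne : a ≠ 0 ∨ c ≠ 0) (h₀ : OscEigen a c (l₀, 0)) :
    ∀ᶠ x : (ℝ × ℝ) × (ℝ × ℝ) in nhds ((l₀, 0), (l₀, 0)),
      (0 ≤ x.1.2 ∧ OscEigen a c x.1) ∧ (0 ≤ x.2.2 ∧ OscEigen a c x.2) →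
      0 < ∫ v in Set.Ioi 0, v ^ 0 * (oscU a c x.1 v * oscU a c x.2 v) := by
  refine eventually_inf_principal (s := {x : (ℝ × ℝ) × (ℝ × ℝ) | (0 ≤ x.1.2 ∧ OscEigen a c x.1) ∧
    (0 ≤ x.2.2 ∧ OscEigen a c x.2)}).1 ?_
  set L := nhds (((l₀, 0), (l₀, 0)) : (ℝ × ℝ) × (ℝ × ℝ)) ⊓
    principal {x | (0 ≤ x.1.2 ∧ OscEigen a c x.1) ∧ (0 ≤ x.2.2 ∧ OscEigen a c x.2)} with hL
  have hmem : ∀ᶠ x in L, (0 ≤ x.1.2 ∧ OscEigen a c x.1) ∧ (0 ≤ x.2.2 ∧ OscEigen a c x.2) :=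
    eventually_inf_principal.2 (Eventually.of_forall fun _ h => h)
  have h1 : Tendsto (fun x : (ℝ × ℝ) × (ℝ × ℝ) => x.1) L (nhds (l₀, 0)) :=
    (continuous_fst.tendsto _).mono_left inf_le_left
  have h2 : Tendsto (fun x : (ℝ × ℝ) × (ℝ × ℝ) => x.2) L (nhds (l₀, 0)) :=
    (continuous_snd.tendsto _).mono_left inf_le_left
  exact (tendsto_integral_oscU h1 h2 (hmem.mono fun _ h => h.1) (hmem.mono fun _ h => h.2)
    0).eventually_const_lt (oscMoment_zero_pos hne h₀)

theorem eventually_abs_sub_le (hne : a ≠ 0 ∨ c ≠ 0) (h₀ : OscEigen a c (l₀, 0)) :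
    ∀ᶠ p : ℝ × ℝ in nhds (l₀, 0), 0 ≤ p.2 ∧ OscEigen a c p → |p.1 - l₀| ≤ p.2 * airyD (-l₀) := by
  refine eventually_inf_principal (s := {p | 0 ≤ p.2 ∧ OscEigen a c p}).1 ?_
  set L := nhds ((l₀, 0) : ℝ × ℝ) ⊓ principal {p | 0 ≤ p.2 ∧ OscEigen a c p} with hL
  have hmem : ∀ᶠ p in L, 0 ≤ p.2 ∧ OscEigen a c p :=
    eventually_inf_principal.2 (Eventually.of_forall fun _ h => h)
  have h1 : Tendsto (fun p : ℝ × ℝ => p) L (nhds (l₀, 0)) := tendsto_id.mono_left inf_le_left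
  have hlim := tendsto_integral_oscU h1 tendsto_const_nhds hmem
    (Eventually.of_forall fun _ => ⟨le_refl (0 : ℝ), h₀⟩)
  have hJ := oscMoment_zero_pos hne h₀
  have hr := ((hlim 2).div (hlim 0) hJ.ne').abs
  have hlt := oscMoment_two_div_lt hne h₀
  filter_upwards [hmem, hr.eventually_lt_const hlt, (hlim 0).eventually_const_lt hJ]
    with p hp hle hpos
  have hid := hp.2.integral_identity hp.1 h₀ le_rfl
  have heq : p.1 - l₀ = p.2 * ((∫ v in Set.Ioi 0, v ^ 2 * (oscU a c p v * oscU a c (l₀, 0) v)) /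
      ∫ v in Set.Ioi 0, v ^ 0 * (oscU a c p v * oscU a c (l₀, 0) v)) := by
    rw [← mul_div_assoc, eq_div_iff hpos.ne']
    simp only at hid ⊢
    linarith
  rw [heq, abs_mul, abs_of_nonneg hp.1, airyD_eq hne h₀]
  exact mul_le_mul_of_nonneg_left hle.le hp.1

/-- One radius serves both claims. For uniqueness, orthogonality at equal coupling contradicts the
positive overlap unless the energies agree. -/
theorem exists_radius_oscEigen (hne : a ≠ 0 ∨ c ≠ 0) (h₀ : OscEigen a c (l₀, 0)) :
    ∃ r > 0, ∀ e, 0 ≤ e → e < r → ∀ l, |l - l₀| < r → OscEigen a c (l, e) →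
      |l - l₀| ≤ e * airyD (-l₀) ∧ ∀ l', |l' - l₀| < r → OscEigen a c (l', e) → l = l' := by
  obtain ⟨r₁, hr₁, H₁⟩ := Metric.eventually_nhds_iff.1 (eventually_abs_sub_le hne h₀)
  obtain ⟨r₂, hr₂, H₂⟩ := Metric.eventually_nhds_iff.1 (eventually_integral_oscU_pos hne h₀)
  have hdist : ∀ {l e r : ℝ}, 0 ≤ e → e < r → |l - l₀| < r → dist (l, e) (l₀, (0 : ℝ)) < r := by
    intro l e r he her hl
    rw [Prod.dist_eq, Real.dist_eq, Real.dist_eq, sub_zero, abs_of_nonneg he]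
    exact max_lt hl her
  refine ⟨min r₁ r₂, lt_min hr₁ hr₂, fun e he her l hl hE => ⟨?_, fun l' hl' hE' => ?_⟩⟩
  · exact H₁ (hdist he (her.trans_le (min_le_left _ _)) (hl.trans_le (min_le_left _ _))) ⟨he, hE⟩
  · have her₂ := her.trans_le (min_le_right r₁ r₂)
    have hpos := H₂ (y := ((l, e), (l', e))) (by
      rw [Prod.dist_eq]
      exact max_lt (hdist he her₂ (hl.trans_le (min_le_right _ _)))
        (hdist he her₂ (hl'.trans_le (min_le_right _ _)))) ⟨⟨he, hE⟩, ⟨he, hE'⟩⟩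
    have hid := hE.integral_identity he hE' he
    simp only [sub_self, zero_mul] at hid
    linarith [(mul_eq_zero.1 hid).resolve_right hpos.ne']

end Perturbation

/-! ### Counting the spectrum at small coupling. -/

/-- The energies `l` for which the even or the odd solution of `u'' = (|v| + e v² - l) u` decays. -/
def oscSpec (e : ℝ) : Set ℝ := {l | OscEigen 1 0 (l, e) ∨ OscEigen 0 1 (l, e)}

theorem oscSpec_pos {e l : ℝ} (he : 0 ≤ e) (hl : l ∈ oscSpec e) : 0 < l := by
  rcases hl with h | h
  · exact h.energy_pos he (by norm_num) (by norm_num)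
  · exact h.energy_pos he (by norm_num) (by norm_num)

theorem airyBdry_one_zero (l : ℝ) : airyBdry 1 0 l = deriv airyAi (-l) := by simp [airyBdry]

theorem airyBdry_zero_one (l : ℝ) : airyBdry 0 1 l = -airyAi (-l) := by simp [airyBdry]

theorem hasDerivAt_airyBdry (a c l : ℝ) :
    HasDerivAt (airyBdry a c) (a * (l * airyAi (-l)) + c * deriv airyAi (-l)) l := by
  have h1 : HasDerivAt (fun l => deriv airyAi (-l)) (-l * airyAi (-l) * -1) l :=
    (hasDerivAt_deriv_airyAi (-l)).comp l (hasDerivAt_neg l)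
  have h2 : HasDerivAt (fun l => airyAi (-l)) (deriv airyAi (-l) * -1) l :=
    (hasDerivAt_airyAi (-l)).comp l (hasDerivAt_neg l)
  exact ((h1.const_mul a).sub (h2.const_mul c)).congr_deriv (by ring)

theorem exists_oscSpec_near {l₀ r : ℝ} (h : -l₀ ∈ airyZeros) (hr : 0 < r) :
    ∀ᶠ e in nhdsWithin 0 (Set.Ioi 0), ∃ l ∈ oscSpec e, |l - l₀| < r := by
  rcases h with h | h
  · have hne := deriv_airyAi_ne_zero h
    refine (exists_oscEigen_near (a := 0) (c := 1) (by simp [airyBdry, h])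
      (hasDerivAt_airyBdry 0 1 l₀) (by simpa using hne) hr).mono ?_
    rintro e ⟨l, h1, h2⟩
    exact ⟨l, Or.inr h2, h1⟩
  · have hne := mul_airyAi_ne_zero h
    refine (exists_oscEigen_near (a := 1) (c := 0) (by simp [airyBdry, h])
      (hasDerivAt_airyBdry 1 0 l₀) (by simpa using hne) hr).mono ?_
    rintro e ⟨l, h1, h2⟩
    exact ⟨l, Or.inl h2, h1⟩

theorem exists_radius_oscEigen_or {a c : ℝ} (hne : a ≠ 0 ∨ c ≠ 0) (l₀ : ℝ) :
    ∃ r > 0, ∀ e, 0 ≤ e → e < r → ∀ l, |l - l₀| < r → OscEigen a c (l, e) →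
      airyBdry a c l₀ = 0 ∧ |l - l₀| ≤ e * airyD (-l₀) ∧
        ∀ l', |l' - l₀| < r → OscEigen a c (l', e) → l = l' := by
  by_cases h : OscEigen a c (l₀, 0)
  · obtain ⟨r, hr, H⟩ := exists_radius_oscEigen hne h
    exact ⟨r, hr, fun e he her l hl hE => ⟨airyBdry_eq_zero_of_oscEigen h, H e he her l hl hE⟩⟩
  · obtain ⟨r, hr, H⟩ := Metric.eventually_nhds_iff.1 (eventually_not_oscEigen h le_rfl)
    refine ⟨r, hr, fun e he her l hl hE => absurd hE (H ?_)⟩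
    rw [Prod.dist_eq, Real.dist_eq, Real.dist_eq, sub_zero, abs_of_nonneg he]
    exact max_lt hl her

/-- Ai and Ai' have no common zero, so near l₀ at most one parity contributes; uniqueness within one
parity then becomes uniqueness in the whole spectrum. -/
theorem exists_radius_oscSpec (l₀ : ℝ) :
    ∃ r > 0, ∀ᶠ e in nhdsWithin 0 (Set.Ioi 0), ∀ l ∈ oscSpec e, |l - l₀| < r →
      -l₀ ∈ airyZeros ∧ |l - l₀| ≤ e * airyD (-l₀) ∧
        ∀ l' ∈ oscSpec e, |l' - l₀| < r → l = l' := by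
  obtain ⟨r₁, hr₁, H₁⟩ := exists_radius_oscEigen_or (a := 1) (c := 0) (by norm_num) l₀
  obtain ⟨r₂, hr₂, H₂⟩ := exists_radius_oscEigen_or (a := 0) (c := 1) (by norm_num) l₀
  have hr : 0 < min r₁ r₂ := lt_min hr₁ hr₂
  have h12 : ¬ (airyBdry 1 0 l₀ = 0 ∧ airyBdry 0 1 l₀ = 0) := fun ⟨h1, h2⟩ => by
    rw [airyBdry_one_zero] at h1
    rw [airyBdry_zero_one, neg_eq_zero] at h2
    exact deriv_airyAi_ne_zero h2 h1
  refine ⟨min r₁ r₂, hr, ?_⟩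
  filter_upwards [Ioo_mem_nhdsGT hr] with e he l hl hlr
  have he1 := he.2.trans_le (min_le_left r₁ r₂)
  have he2 := he.2.trans_le (min_le_right r₁ r₂)
  have K₁ := fun l hl => H₁ e he.1.le he1 l (lt_of_lt_of_le hl (min_le_left r₁ r₂))
  have K₂ := fun l hl => H₂ e he.1.le he2 l (lt_of_lt_of_le hl (min_le_right r₁ r₂))
  rcases hl with hl | hl
  · obtain ⟨k1, k2, k3⟩ := K₁ l hlr hl
    refine ⟨Or.inr (by rw [← airyBdry_one_zero, k1]), k2, fun l' hl' hlr' => ?_⟩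
    rcases hl' with hl' | hl'
    · exact k3 l' (hlr'.trans_le (min_le_left _ _)) hl'
    · exact absurd ⟨k1, (K₂ l' hlr' hl').1⟩ h12
  · obtain ⟨k1, k2, k3⟩ := K₂ l hlr hl
    refine ⟨Or.inl (by rw [← neg_eq_zero, ← airyBdry_zero_one, k1]), k2, fun l' hl' hlr' => ?_⟩
    rcases hl' with hl' | hl'
    · exact absurd ⟨(K₁ l' hlr' hl').1, k1⟩ h12
    · exact k3 l' (hlr'.trans_le (min_le_right _ _)) hl'

theorem eventually_oscSpec_count {l₀ : ℝ} (h₀ : -l₀ ∈ airyZeros) :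
    ∀ᶠ e in nhdsWithin 0 (Set.Ioi 0), ∃ l ∈ oscSpec e, |l - l₀| ≤ e * airyD (-l₀) ∧
      (oscSpec e ∩ Set.Iic l).encard = (airyZeros ∩ Set.Ici (-l₀)).encard := by
  set S : Set ℝ := Neg.neg '' (airyZeros ∩ Set.Ici (-l₀)) with hS
  have hSfin : S.Finite := (finite_airyZeros (-l₀)).image _
  have hScard : S.encard = (airyZeros ∩ Set.Ici (-l₀)).encard := neg_injective.encard_image _
  have hmemS : ∀ s, s ∈ S ↔ -s ∈ airyZeros ∧ s ≤ l₀ := fun s => by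
    refine ⟨?_, fun h => ⟨-s, ⟨h.1, neg_le_neg h.2⟩, neg_neg s⟩⟩
    rintro ⟨x, ⟨hx1, hx2⟩, rfl⟩
    rw [neg_neg]
    exact ⟨hx1, by linarith [Set.mem_Ici.1 hx2]⟩
  have hl₀S : l₀ ∈ S := (hmemS l₀).2 ⟨h₀, le_rfl⟩
  choose r hr H using exists_radius_oscSpec
  -- The radius m lies below the uniqueness radii, keeps the m-neighbourhoods of points of S
  -- disjoint, and leaves no further unperturbed eigenvalue in (l₀, l₀ + m].
  obtain ⟨m, hm0, hmr, hmsep, hmtop⟩ : ∃ m > 0, (∀ s ∈ S, m ≤ r s) ∧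
      (∀ s ∈ S, ∀ s' ∈ S, s < s' → 2 * m ≤ s' - s) ∧
      ∀ z, -z ∈ airyZeros → l₀ < z → l₀ + m < z := by
    have e1 : ∀ᶠ m in nhdsWithin (0 : ℝ) (Set.Ioi 0), ∀ s ∈ S, m ≤ r s :=
      (eventually_all_finite hSfin).2 fun s _ => by
        filter_upwards [Ioo_mem_nhdsGT (hr s)] with m hm using hm.2.le
    have e2 : ∀ᶠ m in nhdsWithin (0 : ℝ) (Set.Ioi 0), ∀ s ∈ S, ∀ s' ∈ S, s < s' →
        2 * m ≤ s' - s :=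
      (eventually_all_finite hSfin).2 fun s _ => (eventually_all_finite hSfin).2 fun s' _ => by
        by_cases hss : s < s'
        · filter_upwards [Ioo_mem_nhdsGT (half_pos (sub_pos.2 hss))] with m hm _
          linarith [hm.2]
        · exact Eventually.of_forall fun m h => absurd h hss
    have e3 : ∀ᶠ m in nhdsWithin (0 : ℝ) (Set.Ioi 0),
        ∀ x ∈ airyZeros ∩ Set.Ici (-(l₀ + 1)), x < -l₀ → x < -l₀ - m :=
      (eventually_all_finite (finite_airyZeros _)).2 fun x _ => by
        by_cases hx : x < -l₀
        · filter_upwards [Ioo_mem_nhdsGT (sub_pos.2 hx)] with m hm _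
          linarith [hm.2]
        · exact Eventually.of_forall fun m h => absurd h hx
    obtain ⟨m, h1, h2, h3, h4⟩ := (e1.and (e2.and (e3.and
      (Ioo_mem_nhdsGT (zero_lt_one' ℝ))))).exists
    refine ⟨m, h4.1, h1, h2, fun z hz hlz => ?_⟩
    rcases le_total z (l₀ + 1) with hz1 | hz1
    · have := h3 (-z) ⟨hz, neg_le_neg hz1⟩ (neg_lt_neg hlz)
      linarith
    · linarith [h4.2]
  have E1 : ∀ᶠ e in nhdsWithin (0 : ℝ) (Set.Ioi 0), ∀ s ∈ S, ∃ l ∈ oscSpec e, |l - s| < m :=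
    (eventually_all_finite hSfin).2 fun s hs => exists_oscSpec_near ((hmemS s).1 hs).1 hm0
  have E2 : ∀ᶠ e in nhdsWithin (0 : ℝ) (Set.Ioi 0), ∀ s ∈ S, ∀ l ∈ oscSpec e, |l - s| < r s →
      -s ∈ airyZeros ∧ |l - s| ≤ e * airyD (-s) ∧
        ∀ l' ∈ oscSpec e, |l' - s| < r s → l = l' :=
    (eventually_all_finite hSfin).2 fun s _ => H s
  -- No eigenvalue strays: every x in [0, l₀ + m] has a ball in which eigenvalues occur for small e
  -- only if x is in S, and finitely many balls cover the interval. Positivity of the spectrum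
  -- accounts for the left end 0.
  have E3 : ∀ᶠ e in nhdsWithin (0 : ℝ) (Set.Ioi 0), ∀ l ∈ Set.Icc 0 (l₀ + m), l ∈ oscSpec e →
      ∃ s ∈ S, |l - s| < m := by
    refine (isCompact_Icc (a := (0 : ℝ)) (b := l₀ + m)).induction_on
      (p := fun K => ∀ᶠ e in nhdsWithin (0 : ℝ) (Set.Ioi 0), ∀ l ∈ K, l ∈ oscSpec e →
        ∃ s ∈ S, |l - s| < m) ?_ ?_ ?_ ?_
    · exact Eventually.of_forall fun e l hl => absurd hl (Set.notMem_empty l)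
    · exact fun K K' hK h => h.mono fun e he l hl => he l (hK hl)
    · intro K K' h h'
      filter_upwards [h, h'] with e h1 h2 l hl
      exact hl.elim (h1 l) (h2 l)
    · intro x hx
      refine ⟨Metric.ball x (min m (r x)), mem_nhdsWithin_of_mem_nhds
        (Metric.ball_mem_nhds x (lt_min hm0 (hr x))), ?_⟩
      filter_upwards [H x] with e he l hl hle
      rw [Metric.mem_ball, Real.dist_eq] at hl
      have hx0 := (he l hle (hl.trans_le (min_le_right _ _))).1
      refine ⟨x, (hmemS x).2 ⟨hx0, ?_⟩, hl.trans_le (min_le_left _ _)⟩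
      by_contra! hlx
      exact absurd (hmtop x hx0 hlx) (not_lt.2 hx.2)
  filter_upwards [E1, E2, E3, self_mem_nhdsWithin] with e h1 h2 h3 he
  have he0 : (0 : ℝ) ≤ e := le_of_lt he
  -- Here g sends an unperturbed eigenvalue to the perturbed one near it. It is strictly increasing,
  -- and uniqueness makes it onto the eigenvalues up to g(l₀).
  choose! g hgs hgm using h1
  have hmono : ∀ s ∈ S, ∀ s' ∈ S, s < s' → g s < g s' := fun s hs s' hs' hss => by
    have k1 := (abs_lt.1 (hgm s hs)).2
    have k2 := (abs_lt.1 (hgm s' hs')).1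
    linarith [hmsep s hs s' hs' hss]
  have hinj : Set.InjOn g S := fun s hs s' hs' heq => by
    rcases lt_trichotomy s s' with h | h | h
    · exact absurd heq (hmono s hs s' hs' h).ne
    · exact h
    · exact absurd heq (hmono s' hs' s hs h).ne'
  refine ⟨g l₀, hgs l₀ hl₀S, (h2 l₀ hl₀S _ (hgs l₀ hl₀S)
    ((hgm l₀ hl₀S).trans_le (hmr l₀ hl₀S))).2.1, ?_⟩
  rw [← hScard, ← hinj.encard_image]
  congr 1
  ext l
  refine ⟨fun ⟨hl, hle⟩ => ?_, ?_⟩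
  · have hlt := (abs_lt.1 (hgm l₀ hl₀S)).2
    obtain ⟨s, hs, hsm⟩ := h3 l ⟨(oscSpec_pos he0 hl).le, by linarith [Set.mem_Iic.1 hle]⟩ hl
    exact ⟨s, hs, (h2 s hs (g s) (hgs s hs) ((hgm s hs).trans_le (hmr s hs))).2.2 l hl
      (hsm.trans_le (hmr s hs))⟩
  · rintro ⟨s, hs, rfl⟩
    refine ⟨hgs s hs, ?_⟩
    rcases ((hmemS s).1 hs).2.eq_or_lt with h | h
    · rw [h]; exact le_refl (g l₀)
    · exact (hmono s hs l₀ hl₀S h).le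

/-! ### The fiber operator: classical eigenfunctions, parity, norms. -/

theorem mem_fiberGraph_iff {b k : ℝ} {u f : L2R} :
    (u, f) ∈ fiberGraph b k ↔ ∃ y : (fiberOp b k).domain, (y : L2R) = u ∧ fiberOp b k y = f := by
  rw [← LinearPMap.mem_graph_iff (fiberOp b k) (x := (u, f)), fiberOp,
    Submodule.toLinearPMap_graph_eq _ (fiberGraph_single_valued b k)]

theorem mem_fiberEigenvalues_iff {b k E : ℝ} :
    E ∈ fiberEigenvalues b k ↔ ∃ u : L2R, u ≠ 0 ∧ (u, (E : ℂ) • u) ∈ fiberGraph b k := by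
  constructor
  · rintro ⟨y, hy, hE⟩
    exact ⟨y, hy, mem_fiberGraph_iff.2 ⟨y, rfl, hE⟩⟩
  · rintro ⟨u, hu, hm⟩
    obtain ⟨y, rfl, hE⟩ := mem_fiberGraph_iff.1 hm
    exact ⟨y, hu, hE⟩

theorem mem_fiberGraph_of_hasDerivAt {b k : ℝ} {u f : L2R} {ψ ψ' g : ℝ → ℂ} (hg : Continuous g)
    (hu : u =ᵐ[volume] ψ) (hf : f =ᵐ[volume] g) (hψ : ∀ x, HasDerivAt ψ (ψ' x) x)
    (hψ' : ∀ x, HasDerivAt ψ' ((effPotential b k x : ℂ) * ψ x - g x) x) :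
    (u, f) ∈ fiberGraph b k := by
  refine ⟨ψ, ψ', hu, hψ, fun x => ?_⟩
  have hc : Continuous ψ := continuous_iff_continuousAt.2 fun x => (hψ x).continuousAt
  have hV : Continuous fun t => (effPotential b k t : ℂ) := by unfold effPotential; fun_prop
  have hcong : ∫ t in (0 : ℝ)..x, ((effPotential b k t : ℂ) * ψ t - f t) =
      ∫ t in (0 : ℝ)..x, ((effPotential b k t : ℂ) * ψ t - g t) := by
    refine intervalIntegral.integral_congr_ae ?_
    filter_upwards [hf] with t ht _ using by rw [ht]
  rw [hcong, intervalIntegral.integral_eq_sub_of_hasDerivAt (fun t _ => hψ' t)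
    (((hV.mul hc).sub hg).intervalIntegrable _ _)]
  ring

/-- For an eigenfunction the integrand agrees almost everywhere with the continuous function (V -
E)ψ, so the weak equation holds classically. -/
theorem exists_hasDerivAt_of_mem_fiberGraph {b k E : ℝ} {u : L2R}
    (h : (u, (E : ℂ) • u) ∈ fiberGraph b k) :
    ∃ ψ ψ' : ℝ → ℂ, u =ᵐ[volume] ψ ∧ (∀ x, HasDerivAt ψ (ψ' x) x) ∧
      ∀ x, HasDerivAt ψ' ((effPotential b k x - E) • ψ x) x := by
  obtain ⟨ψ, ψ', hu, hψ, hi⟩ := h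
  refine ⟨ψ, ψ', hu, hψ, fun x => ?_⟩
  have hc : Continuous ψ := continuous_iff_continuousAt.2 fun x => (hψ x).continuousAt
  have hV : Continuous fun t => effPotential b k t - E := by unfold effPotential; fun_prop
  have hcs : Continuous fun t => (effPotential b k t - E) • ψ t := hV.smul hc
  have heq : ψ' = fun x => ψ' 0 + ∫ t in (0 : ℝ)..x, (effPotential b k t - E) • ψ t := by
    funext x
    rw [hi x]
    congr 1
    refine intervalIntegral.integral_congr_ae ?_
    filter_upwards [hu, Lp.coeFn_smul (E : ℂ) u] with t h1 h2 _
    rw [h2, Pi.smul_apply, h1, smul_eq_mul, Complex.real_smul]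
    push_cast
    ring
  rw [heq]
  exact (intervalIntegral.integral_hasDerivAt_right (hcs.intervalIntegrable _ _)
    (hcs.stronglyMeasurableAtFilter _ _) hcs.continuousAt).const_add _

theorem integrable_comp_abs_of_integrableOn {f : ℝ → ℝ} (hf : IntegrableOn f (Set.Ioi 0)) :
    Integrable fun x => f |x| := by
  have h1 : IntegrableOn (fun x => f |x|) (Set.Ioi 0) :=
    hf.congr_fun (fun x hx => by simp only [abs_of_pos (Set.mem_Ioi.1 hx)]) measurableSet_Ioi
  have h2 : IntegrableOn (fun x => f |x|) (Set.Iic 0) := by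
    rw [← Measure.map_neg_eq_self (volume : Measure ℝ)]
    let m : MeasurableEmbedding fun x : ℝ => -x := (Homeomorph.neg ℝ).measurableEmbedding
    rw [m.integrableOn_map_iff]
    simp_rw [Function.comp_def, abs_neg, Set.neg_preimage, Set.neg_Iic, neg_zero]
    exact Iff.mpr integrableOn_Ici_iff_integrableOn_Ioi h1
  have := h2.union h1
  rwa [Set.Iic_union_Ioi, integrableOn_univ] at this

theorem oscU_neg {a c : ℝ} (p : ℝ × ℝ) {σ : ℝ} (hσa : σ * a = a) (hσc : σ * c = -c) {v : ℝ}
    (hv : 0 ≤ v) : oscU a c p (-v) = σ * oscU a c p v := by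
  have hs : SolvesOn (oscPot p) (fun v => oscU a c p (-v)) fun v => -oscW a c p (-v) := by
    refine ⟨fun v _ => ?_, fun v _ => ?_⟩
    · refine ((hasDerivAt_oscU a c p (-v)).comp v (hasDerivAt_neg v)).congr_deriv (by ring)
    · refine ((hasDerivAt_oscW a c p (-v)).comp v (hasDerivAt_neg v)).neg.congr_deriv ?_
      simp only [oscPot, abs_neg]
      ring
  refine SolvesOn.eq_of_initial (continuous_oscPot p) hs ((solvesOn_osc a c p).const_mul σ)
    ?_ ?_ hv
  · simp only [neg_zero, oscU_zero, hσa]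
  · simp only [neg_zero, oscW_zero, hσc]

section Parity

variable {a c : ℝ}

theorem oscU_sq_abs (hac : a = 0 ∨ c = 0) (p : ℝ × ℝ) (v : ℝ) :
    oscU a c p v ^ 2 = oscU a c p |v| ^ 2 := by
  rcases le_total 0 v with hv | hv
  · rw [abs_of_nonneg hv]
  · rw [abs_of_nonpos hv]
    obtain ⟨w, rfl⟩ : ∃ w, v = -w := ⟨-v, by ring⟩
    have hw : 0 ≤ w := by linarith
    rw [neg_neg]
    rcases hac with rfl | rfl
    · rw [oscU_neg p (σ := -1) (by ring) (by ring) hw]; ring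
    · rw [oscU_neg p (σ := 1) (by ring) (by ring) hw]; ring

theorem integrable_pow_mul_oscU_sq {p : ℝ × ℝ} (hac : a = 0 ∨ c = 0) (hp : 0 ≤ p.2)
    (h : OscEigen a c p) (n : ℕ) {α : ℝ} (hα : α ≠ 0) :
    Integrable fun x : ℝ => |x| ^ n * oscU a c p (α * x) ^ 2 := by
  have h1 := integrable_comp_abs_of_integrableOn (h.integrableOn_pow_mul hp h hp n)
  have h2 := (h1.comp_mul_left' hα).const_mul ((|α| ^ n)⁻¹)
  refine h2.congr (Eventually.of_forall fun x => ?_)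
  have hα' : |α| ^ n ≠ 0 := pow_ne_zero n (abs_ne_zero.2 hα)
  simp only
  rw [oscU_sq_abs hac p (α * x), abs_mul, mul_pow]
  field_simp

theorem integral_pow_mul_oscU_sq {l : ℝ} (hac : a = 0 ∨ c = 0) (n : ℕ) {α : ℝ} (hα : 0 < α) :
    ∫ x : ℝ, |x| ^ n * oscU a c (l, 0) (α * x) ^ 2 = 2 * oscMoment a c l n / α ^ (n + 1) := by
  have h1 := integral_comp_abs
    (f := fun v => v ^ n * (oscU a c (l, 0) v * oscU a c (l, 0) v))
  have h2 := Measure.integral_comp_mul_left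
    (fun x => |x| ^ n * (oscU a c (l, 0) |x| * oscU a c (l, 0) |x|)) α
  rw [h1, abs_of_pos (inv_pos.2 hα), smul_eq_mul] at h2
  have h3 : ∀ x : ℝ, |x| ^ n * oscU a c (l, 0) (α * x) ^ 2 = (α ^ n)⁻¹ *
      (|α * x| ^ n * (oscU a c (l, 0) |α * x| * oscU a c (l, 0) |α * x|)) := fun x => by
    rw [oscU_sq_abs hac (l, 0) (α * x), abs_mul, abs_of_pos hα, mul_pow]
    field_simp
  simp_rw [h3]
  rw [integral_const_mul, h2, oscMoment, pow_succ]
  field_simp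

end Parity

theorem memLp_two_ofReal {g : ℝ → ℝ} (hc : Continuous g) (hi : Integrable fun x => g x ^ 2) :
    MemLp (fun x => (g x : ℂ)) 2 (volume : Measure ℝ) := by
  refine (memLp_two_iff_integrable_sq_norm
    (Complex.continuous_ofReal.comp hc).aestronglyMeasurable).2 ?_
  refine hi.congr (Eventually.of_forall fun x => ?_)
  change _ = ‖((g x : ℝ) : ℂ)‖ ^ 2
  rw [Complex.norm_real, Real.norm_eq_abs, sq_abs]

theorem norm_sq_of_ae_eq_ofReal {f : L2R} {g : ℝ → ℝ} (h : f =ᵐ[volume] fun x => (g x : ℂ)) :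
    ‖f‖ ^ 2 = ∫ x, g x ^ 2 := by
  have h1 : ((‖f‖ : ℂ)) ^ 2 = inner ℂ f f := (inner_self_eq_norm_sq_to_K (𝕜 := ℂ) f).symm
  rw [L2.inner_def] at h1
  have h2 : ∫ x, inner ℂ (f x) (f x) = ∫ x, ((g x ^ 2 : ℝ) : ℂ) := by
    refine integral_congr_ae ?_
    filter_upwards [h] with x hx
    rw [hx, inner_self_eq_norm_sq_to_K]
    simp only [Complex.norm_real, Real.norm_eq_abs]
    rw [← sq_abs (g x)]
    push_cast
    rfl
  rw [h2, integral_complex_ofReal] at h1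
  exact_mod_cast h1

/-! ### Eigenvalues of h(k) as decaying shooting solutions. -/

section Scaling

variable {a c b k E α : ℝ} {p : ℝ × ℝ}

theorem hasDerivAt_oscU_scaled (a c α : ℝ) (p : ℝ × ℝ) (κ x : ℝ) :
    HasDerivAt (fun x => ((κ * oscU a c p (α * x) : ℝ) : ℂ))
      ((κ * α * oscW a c p (α * x) : ℝ) : ℂ) x := by
  have h : HasDerivAt (fun x : ℝ => α * x) α x := by simpa using (hasDerivAt_id x).const_mul α
  refine HasDerivAt.ofReal_comp ?_
  exact (((hasDerivAt_oscU a c p (α * x)).comp x h).const_mul κ).congr_deriv (by ring)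

theorem hasDerivAt_oscW_scaled (a c α : ℝ) (p : ℝ × ℝ) (κ x : ℝ) :
    HasDerivAt (fun x => ((κ * α * oscW a c p (α * x) : ℝ) : ℂ))
      ((α ^ 2 * oscPot p (α * x) * (κ * oscU a c p (α * x)) : ℝ) : ℂ) x := by
  have h : HasDerivAt (fun x : ℝ => α * x) α x := by simpa using (hasDerivAt_id x).const_mul α
  refine HasDerivAt.ofReal_comp ?_
  exact (((hasDerivAt_oscW a c p (α * x)).comp x h).const_mul (κ * α)).congr_deriv (by ring)

theorem continuous_oscU_scaled (a c α : ℝ) (p : ℝ × ℝ) :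
    Continuous fun x => oscU a c p (α * x) :=
  (continuous_oscU a c).comp (by fun_prop : Continuous fun x : ℝ => (p, α * x))

theorem mem_fiberEigenvalues_of_oscEigen (hα : α ≠ 0) (hac : a = 0 ∨ c = 0) (hne : a ≠ 0 ∨ c ≠ 0)
    (hp : 0 ≤ p.2) (hV : ∀ x, effPotential b k x - E = α ^ 2 * oscPot p (α * x))
    (h : OscEigen a c p) : E ∈ fiberEigenvalues b k := by
  have hcont := continuous_oscU_scaled a c α p
  have hint : Integrable fun x => oscU a c p (α * x) ^ 2 := by
    simpa using integrable_pow_mul_oscU_sq hac hp h 0 hα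
  have hmem := memLp_two_ofReal hcont hint
  have hae := hmem.coeFn_toLp
  refine mem_fiberEigenvalues_iff.2 ⟨hmem.toLp _, fun h0 => ?_, ?_⟩
  · have hz : (fun x => (oscU a c p (α * x) : ℂ)) = 0 := by
      refine (Continuous.ae_eq_iff_eq volume (Complex.continuous_ofReal.comp hcont)
        continuous_zero).1 ?_
      refine hae.symm.trans ?_
      rw [h0]
      exact Lp.coeFn_zero _ _ _
    have hz' : oscU a c p = fun _ => 0 := by
      funext v
      have := congrFun hz (α⁻¹ * v)
      simpa [mul_inv_cancel_left₀ hα] using this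
    have ha : a = 0 := by rw [← oscU_zero a c p, hz']
    have hc : c = 0 := by
      rw [← oscW_zero a c p]
      have := hasDerivAt_oscU a c p 0
      rw [hz'] at this
      exact this.unique (hasDerivAt_const 0 0)
    tauto
  · refine mem_fiberGraph_of_hasDerivAt (g := fun x => (E : ℂ) * oscU a c p (α * x))
      (ψ' := fun x => ((1 * α * oscW a c p (α * x) : ℝ) : ℂ))
      (continuous_const.mul (Complex.continuous_ofReal.comp hcont)) hae ?_
      (fun x => by simpa using hasDerivAt_oscU_scaled a c α p 1 x)
      (fun x => ?_)
    · filter_upwards [hae, Lp.coeFn_smul (E : ℂ) (hmem.toLp _)] with x h1 h2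
      rw [h2, Pi.smul_apply, h1, smul_eq_mul]
    · refine (hasDerivAt_oscW_scaled a c α p 1 x).congr_deriv ?_
      rw [← hV x]
      push_cast
      ring

theorem oscEigen_of_memLp (hα : 0 < α) (hp : 0 ≤ p.2)
    (hV : ∀ x, effPotential b k x - E = α ^ 2 * oscPot p (α * x)) {φ φ' : ℝ → ℂ} {d : ℂ}
    (hd : d ≠ 0) (hφ : ∀ x, HasDerivAt φ (φ' x) x)
    (hφ' : ∀ x, HasDerivAt φ' ((effPotential b k x - E) • φ x) x) (h0 : φ 0 = d * a)
    (h0' : φ' 0 = d * (α * c)) (hL : MemLp φ 2 (volume : Measure ℝ)) : OscEigen a c p := by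
  have hVc : Continuous fun t => effPotential b k t - E := by unfold effPotential; fun_prop
  have heq : ∀ x, 0 ≤ x → φ x = d * oscU a c p (α * x) := fun x hx => by
    refine sub_eq_zero.1 (eq_zero_of_second_order
      (f := fun x => φ x - d * ((1 * oscU a c p (α * x) : ℝ) : ℂ))
      (f' := fun x => φ' x - d * ((1 * α * oscW a c p (α * x) : ℝ) : ℂ)) hVc
      (fun y _ => (hφ y).sub ((hasDerivAt_oscU_scaled a c α p 1 y).const_mul d))
      (fun y _ => ?_) ?_ ?_ hx) |>.trans (by simp)
    · refine ((hφ' y).sub ((hasDerivAt_oscW_scaled a c α p 1 y).const_mul d)).congr_deriv ?_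
      rw [← hV y]
      simp only [Complex.real_smul]
      push_cast
      ring
    · simp [oscU_zero, h0]
    · simp [oscW_zero, h0']
  refine oscEigen_of_integrableOn hp ?_
  have hi := (memLp_two_iff_integrable_sq_norm hL.1).1 hL
  have hnd : ‖d‖ ≠ 0 := norm_ne_zero_iff.2 hd
  have h1 : IntegrableOn (fun x => oscU a c p (α * x) ^ 2) (Set.Ioi 0) := by
    refine IntegrableOn.congr_fun ((hi.const_mul ((‖d‖ ^ 2)⁻¹)).integrableOn) (fun x hx => ?_)
      measurableSet_Ioi
    rw [heq x (le_of_lt hx), norm_mul, mul_pow, Complex.norm_real, Real.norm_eq_abs, sq_abs]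
    field_simp
  have h2 := (integrableOn_Ioi_comp_mul_left_iff (fun v => oscU a c p v ^ 2) 0 hα).1 h1
  rwa [mul_zero] at h2

theorem oscEigen_of_mem_fiberEigenvalues (hα : 0 < α) (hp : 0 ≤ p.2)
    (hV : ∀ x, effPotential b k x - E = α ^ 2 * oscPot p (α * x))
    (hE : E ∈ fiberEigenvalues b k) : OscEigen 1 0 p ∨ OscEigen 0 1 p := by
  obtain ⟨u, hu0, hu⟩ := mem_fiberEigenvalues_iff.1 hE
  obtain ⟨ψ, ψ', hψu, hψ, hψ'⟩ := exists_hasDerivAt_of_mem_fiberGraph hu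
  have hL : MemLp ψ 2 (volume : Measure ℝ) := (memLp_congr_ae hψu).1 (Lp.memLp u)
  have hLn : MemLp (fun x => ψ (-x)) 2 (volume : Measure ℝ) :=
    hL.comp_measurePreserving (Measure.measurePreserving_neg volume)
  have hneg : ∀ x, effPotential b k (-x) = effPotential b k x := fun x => by
    simp [effPotential]
  have hψn : ∀ x, HasDerivAt (fun x => ψ (-x)) (-ψ' (-x)) x := fun x => by
    have := (hψ (-x)).scomp x (hasDerivAt_neg x)
    exact this.congr_deriv (by simp)
  have hψn' : ∀ x, HasDerivAt (fun x => -ψ' (-x)) ((effPotential b k x - E) • ψ (-x)) x :=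
    fun x => by
      have := ((hψ' (-x)).scomp x (hasDerivAt_neg x)).neg
      exact this.congr_deriv (by simp [hneg])
  -- The potential is even, so the even and odd parts of ψ are again solutions. The even part is
  -- used if ψ(0) ≠ 0 and the odd part if only ψ'(0) ≠ 0. In the odd case d carries 1/α because the
  -- rescaled solution has slope α at 0.
  by_cases h0 : ψ 0 = 0
  · by_cases h0' : ψ' 0 = 0
    · exfalso
      have hVc : Continuous fun t => effPotential b k t - E := by unfold effPotential; fun_prop
      refine hu0 (Lp.eq_zero_iff_ae_eq_zero.2 ?_)
      filter_upwards [hψu] with x hx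
      rw [hx, Pi.zero_apply]
      rcases le_total 0 x with h | h
      · exact eq_zero_of_second_order hVc (fun y _ => hψ y) (fun y _ => hψ' y) h0 h0' h
      · have := eq_zero_of_second_order hVc (fun y _ => hψn y) (fun y _ => hψn' y)
          (by simpa using h0) (by simpa using h0') (neg_nonneg.2 h)
        simpa using this
    · refine Or.inr (oscEigen_of_memLp hα hp hV (φ := fun x => ψ x - ψ (-x))
        (φ' := fun x => ψ' x - -ψ' (-x)) (d := 2 * ψ' 0 / α) ?_
        (fun x => (hψ x).sub (hψn x)) (fun x => ?_) ?_ ?_ (hL.sub hLn))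
      · have : (α : ℂ) ≠ 0 := Complex.ofReal_ne_zero.2 hα.ne'
        exact div_ne_zero (mul_ne_zero two_ne_zero h0') this
      · rw [smul_sub]; exact (hψ' x).sub (hψn' x)
      · simp
      · have : (α : ℂ) ≠ 0 := Complex.ofReal_ne_zero.2 hα.ne'
        simp only [neg_zero, Complex.ofReal_one]
        field_simp
        ring
  · refine Or.inl (oscEigen_of_memLp hα hp hV (φ := fun x => ψ x + ψ (-x))
      (φ' := fun x => ψ' x + -ψ' (-x)) (d := 2 * ψ 0) (mul_ne_zero two_ne_zero h0)
      (fun x => (hψ x).add (hψn x)) (fun x => ?_) ?_ ?_ (hL.add hLn))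
    · rw [smul_add]; exact (hψ' x).add (hψn' x)
    · simp only [neg_zero, Complex.ofReal_one]; ring
    · simp

end Scaling

/-! ### Band functions and quasimodes of h(k). -/

theorem bandFunction_eq {b k E : ℝ} {n : ℕ} (h : IsNthEigenvalue b k n E) :
    bandFunction b n k = E := by
  have hset : {F : ℝ | (n : ℕ∞) ≤ (fiberEigenvalues b k ∩ Set.Iic F).encard} = Set.Ici E := by
    ext F
    simp only [Set.mem_ofPred_eq, Set.mem_Ici]
    refine ⟨fun hF => ?_, fun hF => ?_⟩
    · by_contra! hFE
      have hfin : (fiberEigenvalues b k ∩ Set.Iic E).Finite := by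
        rw [← Set.encard_lt_top_iff, h.2]; exact ENat.natCast_lt_top n
      have hss : fiberEigenvalues b k ∩ Set.Iic F ⊂ fiberEigenvalues b k ∩ Set.Iic E := by
        refine ⟨Set.inter_subset_inter_right _ (Set.Iic_subset_Iic.2 hFE.le), fun hc => ?_⟩
        exact absurd (Set.mem_Iic.1 (hc ⟨h.1, le_refl E⟩).2) (not_le.2 hFE)
      have := (hfin.subset hss.1).encard_lt_encard hss
      rw [h.2] at this
      exact absurd hF (not_le.2 this)
    · rw [← h.2]
      exact Set.encard_le_encard (Set.inter_subset_inter_right _ (Set.Iic_subset_Iic.2 hF))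
  rw [bandFunction, hset, csInf_Ici]

/-- The inverse length scale `(2b|k|)^{1/3}`. -/
def airyScale (b k : ℝ) : ℝ := (2 * b * |k|) ^ (1 / 3 : ℝ)

/-- The strength of the quadratic perturbation in the rescaled problem. -/
def airyCoupling (b k : ℝ) : ℝ := b ^ 2 / airyScale b k ^ 4

section Scale

variable {b k : ℝ}

theorem airyScale_pos (hb : 0 < b) (hk : k < 0) : 0 < airyScale b k := by
  have := abs_pos.2 hk.ne
  exact Real.rpow_pos_of_pos (by positivity) _

theorem airyScale_pow_three (hb : 0 < b) : airyScale b k ^ 3 = 2 * b * |k| := by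
  rw [airyScale, ← Real.rpow_natCast, ← Real.rpow_mul (by positivity)]
  norm_num

theorem airyScale_sq (hb : 0 < b) : airyScale b k ^ 2 = (2 * b * |k|) ^ (2 / 3 : ℝ) := by
  rw [airyScale, ← Real.rpow_natCast, ← Real.rpow_mul (by positivity)]
  norm_num

theorem airyCoupling_pos (hb : 0 < b) (hk : k < 0) : 0 < airyCoupling b k := by
  have := airyScale_pos hb hk
  unfold airyCoupling
  positivity

theorem effPotential_sub (hb : 0 < b) (hk : k < 0) (l x : ℝ) :
    effPotential b k x - (k ^ 2 + airyScale b k ^ 2 * l) =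
      airyScale b k ^ 2 * oscPot (l, airyCoupling b k) (airyScale b k * x) := by
  have hα := airyScale_pos hb hk
  have h3 := airyScale_pow_three (k := k) hb
  rw [abs_of_neg hk] at h3
  have h4 : airyScale b k ^ 2 * (airyCoupling b k * (airyScale b k * x) ^ 2) = b ^ 2 * x ^ 2 := by
    unfold airyCoupling
    field_simp
  simp only [effPotential, oscPot, abs_mul, abs_of_pos hα]
  linear_combination (-|x|) * h3 - h4 + b ^ 2 * sq_abs x

theorem airyEnergy_eq (hb : 0 < b) (l : ℝ) :
    airyEnergy b k (-l) = k ^ 2 + airyScale b k ^ 2 * l := by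
  rw [airyEnergy, airyScale_sq hb]
  ring

theorem airyBound_eq (hb : 0 < b) (hk : k < 0) (z : ℝ) :
    airyBound b k z = b ^ 2 / airyScale b k ^ 2 * airyD z := by
  have hk' : 0 < 2 * |k| := by have := abs_pos.2 hk.ne; positivity
  have h1 : airyScale b k ^ 2 = b ^ (2 / 3 : ℝ) * (2 * |k|) ^ (2 / 3 : ℝ) := by
    rw [airyScale_sq hb, ← Real.mul_rpow hb.le hk'.le]
    congr 1; ring
  have h2 : b ^ 2 = b ^ (2 / 3 : ℝ) * b ^ (4 / 3 : ℝ) := by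
    rw [← Real.rpow_add hb, ← Real.rpow_natCast]
    norm_num
  rw [airyBound, h1, h2, mul_div_mul_left _ _ (Real.rpow_pos_of_pos hb _).ne']

theorem airyBound_eq_coupling (hb : 0 < b) (hk : k < 0) (z : ℝ) :
    airyBound b k z = airyScale b k ^ 2 * (airyCoupling b k * airyD z) := by
  have hα := airyScale_pos hb hk
  rw [airyBound_eq hb hk, airyCoupling]
  field_simp

theorem fiberEigenvalues_eq_image (hb : 0 < b) (hk : k < 0) :
    fiberEigenvalues b k =
      (fun l => k ^ 2 + airyScale b k ^ 2 * l) '' oscSpec (airyCoupling b k) := by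
  have hα := airyScale_pos hb hk
  have hε := (airyCoupling_pos hb hk).le
  ext E
  constructor
  · intro hE
    have hEe : k ^ 2 + airyScale b k ^ 2 * ((E - k ^ 2) / airyScale b k ^ 2) = E := by
      field_simp; ring
    refine ⟨(E - k ^ 2) / airyScale b k ^ 2, ?_, hEe⟩
    refine oscEigen_of_mem_fiberEigenvalues hα hε (fun x => ?_) hE
    rw [← effPotential_sub hb hk, hEe]
  · rintro ⟨l, hl | hl, rfl⟩
    · exact mem_fiberEigenvalues_of_oscEigen hα.ne' (by norm_num) (by norm_num) hε
        (effPotential_sub hb hk l) hl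
    · exact mem_fiberEigenvalues_of_oscEigen hα.ne' (by norm_num) (by norm_num) hε
        (effPotential_sub hb hk l) hl

theorem tendsto_airyCoupling (hb : 0 < b) :
    Tendsto (airyCoupling b) atBot (nhdsWithin 0 (Set.Ioi 0)) := by
  refine tendsto_nhdsWithin_iff.2 ⟨?_, ?_⟩
  · have h1 : Tendsto (airyScale b) atBot atTop := by
      refine (tendsto_rpow_atTop (by norm_num : (0 : ℝ) < 1 / 3)).comp ?_
      exact tendsto_abs_atBot_atTop.const_mul_atTop (by positivity)
    exact tendsto_const_nhds.div_atTop ((tendsto_pow_atTop (by norm_num : 4 ≠ 0)).comp h1)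
  · filter_upwards [eventually_lt_atBot 0] with k hk using airyCoupling_pos hb hk

/-- The map l ↦ k² + α² l is increasing, so it preserves the count of eigenvalues and multiplies the
bound e D by α². -/
theorem eventually_bandFunction (hb : 0 < b) {z : ℝ} (hz : z ∈ airyZeros) {n : ℕ}
    (hn : (airyZeros ∩ Set.Ici z).encard = n) :
    ∀ᶠ k in atBot, IsNthEigenvalue b k n (bandFunction b n k) ∧
      |bandFunction b n k - airyEnergy b k z| ≤ airyBound b k z := by
  obtain ⟨l₀, rfl⟩ : ∃ l, z = -l := ⟨-z, by ring⟩
  filter_upwards [(tendsto_airyCoupling hb).eventually (eventually_oscSpec_count hz),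
    eventually_lt_atBot 0] with k ⟨l, hl, hle, hcard⟩ hk
  have hα := airyScale_pos hb hk
  have hmono : StrictMono fun l => k ^ 2 + airyScale b k ^ 2 * l := fun x y hxy => by
    have : 0 < airyScale b k ^ 2 := by positivity
    simp only
    nlinarith
  have hE : IsNthEigenvalue b k n (k ^ 2 + airyScale b k ^ 2 * l) := by
    rw [IsNthEigenvalue, fiberEigenvalues_eq_image hb hk, ← hn, ← hcard]
    refine ⟨⟨l, hl, rfl⟩, ?_⟩
    rw [← hmono.injective.encard_image (oscSpec (airyCoupling b k) ∩ Set.Iic l)]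
    congr 1
    ext E
    constructor
    · rintro ⟨⟨l', hl', rfl⟩, hle'⟩
      exact ⟨l', ⟨hl', hmono.le_iff_le.1 hle'⟩, rfl⟩
    · rintro ⟨l', ⟨hl', hle'⟩, rfl⟩
      exact ⟨⟨l', hl', rfl⟩, hmono.le_iff_le.2 hle'⟩
  rw [bandFunction_eq hE]
  refine ⟨hE, ?_⟩
  rw [airyEnergy_eq hb, airyBound_eq_coupling hb hk,
    show k ^ 2 + airyScale b k ^ 2 * l - (k ^ 2 + airyScale b k ^ 2 * l₀) =
      airyScale b k ^ 2 * (l - l₀) by ring, abs_mul, abs_of_pos (by positivity)]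
  exact mul_le_mul_of_nonneg_left hle (by positivity)

theorem airyC_pos (z : ℝ) : 0 < airyC z := by
  have hc : Continuous fun v => airyAi (v + z) ^ 2 :=
    (continuous_airyAi.comp (continuous_add_const z)).pow 2
  have hi : IntegrableOn (fun v => airyAi (v + z) ^ 2) (Set.Ioi 0) :=
    (integrableOn_pow_mul_airyAi_sq 0 z).congr_fun (fun v _ => by ring) measurableSet_Ioi
  refine setIntegral_Ioi_pos (x₀ := |z| + 1) hc.continuousOn (fun x _ => sq_nonneg _) hi
    (by positivity) ?_
  have := airyAi_ne_zero_of_nonneg (x := |z| + 1 + z) (by linarith [neg_abs_le z])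
  positivity

/-- Both parities at once: the rescaled shooting solution at zero coupling extends t⁻¹ Ai(v - l) to
the whole line, without separate differentiation at the corner of |x|. -/
theorem isQuasimode_of_airyBdry {a c l t : ℝ} {Ψ : ℝ → ℂ} (hb : 0 < b) (hk : k < 0)
    (hac : a = 0 ∨ c = 0) (hne : a ≠ 0 ∨ c ≠ 0) (h : airyBdry a c l = 0)
    (ht : ∀ v, 0 ≤ v → airyAi (v + -l) = t * oscU a c (l, 0) v)
    (hΨ : ∀ x, Ψ x =
      ((airyNorm b k (-l) * t * oscU a c (l, 0) (airyScale b k * x) : ℝ) : ℂ)) :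
    IsQuasimode b k (airyEnergy b k (-l)) (airyBound b k (-l)) Ψ := by
  have hα := airyScale_pos hb hk
  have hEig := (oscEigen_zero_iff hne).2 h
  set α := airyScale b k with hαdef
  set κ := airyNorm b k (-l) * t with hκ
  set E := airyEnergy b k (-l) with hE
  have hEl : E = k ^ 2 + α ^ 2 * l := airyEnergy_eq hb l
  set g : ℝ → ℝ := fun x => κ * oscU a c (l, 0) (α * x) with hg
  have hgc : Continuous g := (continuous_oscU_scaled a c α (l, 0)).const_mul κ
  have hJ0 := oscMoment_zero_pos hne hEig
  have hC : airyC (-l) = t ^ 2 * oscMoment a c l 0 := by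
    rw [airyC, oscMoment, ← integral_const_mul]
    refine setIntegral_congr_fun measurableSet_Ioi fun v hv => ?_
    simp only [ht v (le_of_lt hv)]
    ring
  have ht0 : t ≠ 0 := fun h0 => by
    have := airyC_pos (-l)
    rw [hC, h0, zero_pow two_ne_zero, zero_mul] at this
    exact lt_irrefl _ this
  have hκsq : κ ^ 2 = α / (2 * oscMoment a c l 0) := by
    have : airyNorm b k (-l) ^ 2 = α / (2 * airyC (-l)) :=
      Real.sq_sqrt (div_nonneg hα.le (by linarith [airyC_pos (-l)]))
    rw [hκ, mul_pow, this, hC]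
    field_simp
  have hint := fun n => integrable_pow_mul_oscU_sq (p := (l, 0)) hac le_rfl hEig n hα.ne'
  have hgint : Integrable fun x => g x ^ 2 := by
    refine ((hint 0).const_mul (κ ^ 2)).congr (Eventually.of_forall fun x => ?_)
    simp only [hg]; ring
  -- The residual (h(k) - E)g is exactly the neglected quadratic term.
  set q : ℝ → ℝ := fun x => b ^ 2 * x ^ 2 * g x with hq
  have hqc : Continuous q := by fun_prop
  have hqsq : ∀ x, q x ^ 2 =
      κ ^ 2 * b ^ 4 * (|x| ^ 4 * oscU a c (l, 0) (α * x) ^ 2) := fun x => by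
    have : |x| ^ 4 = x ^ 4 := by
      rw [show 4 = 2 * 2 by norm_num, pow_mul, sq_abs, ← pow_mul]
    simp only [hq, hg]
    rw [this]; ring
  have hqint : Integrable fun x => q x ^ 2 := by
    simp only [hqsq]
    exact (hint 4).const_mul _
  have hgm := memLp_two_ofReal hgc hgint
  have hqm := memLp_two_ofReal hqc hqint
  set u := hgm.toLp with hu
  set w := hqm.toLp with hw
  have huae : u =ᵐ[volume] fun x => (g x : ℂ) := hgm.coeFn_toLp
  have hwae : w =ᵐ[volume] fun x => (q x : ℂ) := hqm.coeFn_toLp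
  have hgraph : (u, (E : ℂ) • u + w) ∈ fiberGraph b k := by
    refine mem_fiberGraph_of_hasDerivAt (g := fun x => (E : ℂ) * g x + q x) (by fun_prop) huae ?_
      (fun x => hasDerivAt_oscU_scaled a c α (l, 0) κ x) (fun x => ?_)
    · filter_upwards [Lp.coeFn_add ((E : ℂ) • u) w, Lp.coeFn_smul (E : ℂ) u, huae, hwae]
        with x h1 h2 h3 h4
      rw [h1, Pi.add_apply, h2, Pi.smul_apply, h3, h4, smul_eq_mul]
    · refine (hasDerivAt_oscW_scaled a c α (l, 0) κ x).congr_deriv ?_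
      have hV : effPotential b k x = E + b ^ 2 * x ^ 2 + α ^ 2 * oscPot (l, 0) (α * x) := by
        have h1 := effPotential_sub hb hk l x
        have h4 : α ^ 2 * (airyCoupling b k * (α * x) ^ 2) = b ^ 2 * x ^ 2 := by
          unfold airyCoupling
          rw [← hαdef]
          field_simp
        simp only [oscPot, ← hαdef] at h1 ⊢
        linear_combination h1 + h4 - hEl
      rw [hV]
      simp only [hq, hg]
      push_cast
      ring
  obtain ⟨y, hy, hyf⟩ := mem_fiberGraph_iff.1 hgraph
  refine ⟨y, ?_, ?_, ?_⟩
  · rw [hy]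
    exact huae.trans (Eventually.of_forall fun x => (hΨ x).symm)
  · rw [hy]
    have h1 := norm_sq_of_ae_eq_ofReal huae
    have h2 : ∫ x, g x ^ 2 = κ ^ 2 * ∫ x, |x| ^ 0 * oscU a c (l, 0) (α * x) ^ 2 := by
      rw [← integral_const_mul]
      refine integral_congr_ae (Eventually.of_forall fun x => ?_)
      simp only [hg]; ring
    rw [h2, integral_pow_mul_oscU_sq hac 0 hα, hκsq] at h1
    have h3 : ‖u‖ ^ 2 = 1 := by rw [h1]; field_simp; ring
    exact (pow_eq_one_iff_of_nonneg (norm_nonneg u) two_ne_zero).1 h3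
  · rw [hyf, hy, add_sub_cancel_left]
    have hα2 : 0 ≤ b ^ 2 / α ^ 2 * airyD (-l) :=
      mul_nonneg (by positivity) (Real.sqrt_nonneg _)
    rw [airyBound_eq hb hk, ← hαdef]
    refine (pow_le_pow_iff_left₀ (norm_nonneg w) hα2 two_ne_zero).1 ?_
    have hJ4 : 0 ≤ oscMoment a c l 4 := setIntegral_nonneg measurableSet_Ioi fun v _ =>
      mul_nonneg (by positivity) (mul_self_nonneg _)
    rw [norm_sq_of_ae_eq_ofReal hwae, mul_pow, airyD_eq hne hEig,
      Real.sq_sqrt (div_nonneg hJ4 hJ0.le)]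
    simp only [hqsq]
    rw [integral_const_mul, integral_pow_mul_oscU_sq hac 4 hα, hκsq]
    -- The quasimode bound is an equality: both squares are b⁴/α⁴ times the fourth moment over the
    -- zeroth.
    refine le_of_eq ?_
    field_simp
    ring

theorem isQuasimode_airyEven (hb : 0 < b) (hk : k < 0) {j : ℕ} (hz : deriv airyAi (zAi' j) = 0) :
    IsQuasimode b k (airyEnergy b k (zAi' j)) (airyBound b k (zAi' j)) (airyEven b k j) := by
  obtain ⟨l, hl⟩ : ∃ l, zAi' j = -l := ⟨-zAi' j, by ring⟩
  have hα := airyScale_pos hb hk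
  rw [hl] at hz ⊢
  have hB : airyBdry 1 0 l = 0 := by rw [airyBdry_one_zero, hz]
  obtain ⟨t, -, -, -, ht⟩ := exists_airyAi_eq_mul_oscU (by norm_num) hB
  refine isQuasimode_of_airyBdry hb hk (by norm_num) (by norm_num) hB ht fun x => ?_
  have hx : oscU 1 0 (l, 0) (airyScale b k * |x|) = oscU 1 0 (l, 0) (airyScale b k * x) := by
    rcases le_total 0 x with h | h
    · rw [abs_of_nonneg h]
    · have := oscU_neg (a := 1) (c := 0) (l, 0) (σ := 1) (by ring) (by ring)
        (mul_nonneg hα.le (neg_nonneg.2 h))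
      rw [abs_of_nonpos h, ← one_mul (oscU 1 0 (l, 0) (airyScale b k * -x)), ← this]
      congr 1; ring
  have hv := ht (airyScale b k * |x|) (by positivity)
  rw [airyEven, hl]
  change ((airyNorm b k (-l) * airyAi (airyScale b k * |x| + -l) : ℝ) : ℂ) = _
  rw [hv, hx, mul_assoc]

theorem isQuasimode_airyOdd (hb : 0 < b) (hk : k < 0) {j : ℕ} (hz : airyAi (zAi j) = 0) :
    IsQuasimode b k (airyEnergy b k (zAi j)) (airyBound b k (zAi j)) (airyOdd b k j) := by
  obtain ⟨l, hl⟩ : ∃ l, zAi j = -l := ⟨-zAi j, by ring⟩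
  have hα := airyScale_pos hb hk
  rw [hl] at hz ⊢
  have hB : airyBdry 0 1 l = 0 := by rw [airyBdry_zero_one, hz, neg_zero]
  obtain ⟨t, -, -, -, ht⟩ := exists_airyAi_eq_mul_oscU (by norm_num) hB
  refine isQuasimode_of_airyBdry hb hk (by norm_num) (by norm_num) hB ht fun x => ?_
  have hx : Real.sign x * oscU 0 1 (l, 0) (airyScale b k * |x|) =
      oscU 0 1 (l, 0) (airyScale b k * x) := by
    -- At x = 0 the convention sign 0 = 0 agrees with the odd solution, which vanishes there.
    rcases lt_trichotomy 0 x with h | h | h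
    · rw [abs_of_pos h, Real.sign_of_pos h, one_mul]
    · rw [← h, Real.sign_zero, mul_zero, oscU_zero, zero_mul]
    · have := oscU_neg (a := 0) (c := 1) (l, 0) (σ := -1) (by ring) (by ring)
        (mul_nonneg hα.le (neg_nonneg.2 h.le))
      rw [abs_of_neg h, Real.sign_of_neg h, ← this]
      congr 1; ring
  have hv := ht (airyScale b k * |x|) (by positivity)
  rw [airyOdd, hl]
  change ((airyNorm b k (-l) * Real.sign x * airyAi (airyScale b k * |x| + -l) : ℝ) : ℂ) = _
  rw [hv, ← hx]
  congr 1
  ring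

end Scale

end

theorem mainTheorem11 (j : ℕ) (hj : 1 ≤ j) :
    -- the zeros `z_{Ai',j}`, `z_{Ai,j}` exist, and the integrals in `c_{X,j}`, `D_{X,j}` are finite
    (IsNthZero (deriv airyAi) j (zAi' j) ∧ IsNthZero airyAi j (zAi j)) ∧
    (∀ z ∈ ({zAi' j, zAi j} : Set ℝ),
      0 < airyC z ∧
      IntegrableOn (fun v : ℝ => airyAi (v + z) ^ 2) (Set.Ioi 0) ∧
      IntegrableOn (fun v : ℝ => v ^ 4 * airyAi (v + z) ^ 2) (Set.Ioi 0)) ∧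
    ∀ b : ℝ, 0 < b →
      -- quasimode estimates, even and odd
      (∀ k : ℝ, k < 0 →
        IsQuasimode b k (airyEnergy b k (zAi' j)) (airyBound b k (zAi' j)) (airyEven b k j) ∧
        IsQuasimode b k (airyEnergy b k (zAi j)) (airyBound b k (zAi j)) (airyOdd b k j)) ∧
      -- estimates on the even band functions `ω_{2j-1}` and the odd band functions `ω_{2j}`
      ∀ᶠ k in atBot,
        IsNthEigenvalue b k (2 * j - 1) (bandFunction b (2 * j - 1) k) ∧
        IsNthEigenvalue b k (2 * j) (bandFunction b (2 * j) k) ∧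
        |bandFunction b (2 * j - 1) k - airyEnergy b k (zAi' j)| ≤ airyBound b k (zAi' j) ∧
        |bandFunction b (2 * j) k - airyEnergy b k (zAi j)| ≤ airyBound b k (zAi j) := by
  obtain ⟨h1, h2, h3, h4⟩ := airy_zeros_spec j hj
  refine ⟨⟨h1, h2⟩, fun z _ => ⟨airyC_pos z, ?_, ?_⟩, fun b hb => ⟨fun k hk =>
    ⟨isQuasimode_airyEven hb hk h1.1, isQuasimode_airyOdd hb hk h2.1⟩, ?_⟩⟩
  · exact (integrableOn_pow_mul_airyAi_sq 0 z).congr_fun (fun v _ => by ring) measurableSet_Ioi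
  · exact (integrableOn_pow_mul_airyAi_sq 4 z).congr_fun (fun v _ => by ring) measurableSet_Ioi
  · filter_upwards [eventually_bandFunction hb (Or.inr h1.1) h3,
      eventually_bandFunction hb (Or.inl h2.1) h4] with k k1 k2
    exact ⟨k1.1, k2.1, k1.2, k2.2⟩
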